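/- \textbf{Setting.} Let $\pi\colon E\to M$ be a smooth fibre bundle, $\dim M=m\ge 1$, $\dim E=N+m$, with $M$ oriented by a volume form $\omega$. Let $\pi^1\colon J^1E\to E$ be its first jet bundle; let $\tau\colon\mathcal M\pi=\Lambda^m_1T^*E\to E$ be the bundle of $m$-forms on $E$ that vanish on any two $\pi$-vertical vectors, with its canonical forms $\Theta$ and $\Omega=-d\Theta$; let $\tau^1\colon J^{1*}E=\Lambda^m_1T^*E/\Lambda^m_0T^*E\to E$, where $\Lambda^m_0T^*E=\pi^*\Lambda^mT^*M$, and let $\mu\colon\mathcal M\pi\to J^{1*}E$ be the projection. Let $\mathcal L=\pounds\,\omega$ be a Lagrangian density, with $\pounds\in C^\infty(J^1E)$. Its extended Legendre map $\widetilde{FL}\colon J^1E\to\mathcal M\pi$ sends a jet to its Poincaré–Cartan form, regarded as a form on $E$ (in coordinates with $\omega=dx^1\wedge\dots\wedge dx^m$: $p^\alpha_A=\partial\pounds/\partial v^A_\alpha$, $p=\pounds-v^A_\alpha\,\partial\pounds/\partial v^A_\alpha$), and its restricted Legendre map is $FL=\mu\circ\widetilde{FL}$. Assume that $\mathcal L$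 is almost-regular (for instance hyper-regular): $\mathcal P=FL(J^1E)$ is a closed embedded submanifold $\jmath_0\colon\mathcal P\hookrightarrow J^{1*}E$, the induced map $FL_0\colon J^1E\to\mathcal P$ is a submersion, and the fibres of $FL$ are connected. Then there is a unique map $\hat h\colon\mathcal P\to\mathcal M\pi$ with $\hat h\circ FL_0=\widetilde{FL}$. Let $j_S\colon S\hookrightarrow J^1E$ and $\jmath_P\colon P\hookrightarrow\mathcal P$ be embedded submanifolds with $P=FL_0(S)$, and let $FL_S\colon S\to P$ be the (smooth, surjective) restriction of $FL_0$. For a manifold $B$ over $M$ and a map $\Phi\colon A\to B$, an $m$-vector field $K$ along $\Phi$ is a map $a\mapsto K(a)\in\Lambda^mT_{\Phi(a)}B$. It satisfies the \emph{structural condition} if it is non-vanishing, smoothly locally decomposable, and transverse to $B\to M$. Its class $\{K\}$ consists of the $fK$ with $f\in C^\infty(A)$ non-vanishing. The jet field and the Ehresmann connection form along $\Phi$ \emph{associated} with $\{K\}$ are those which define the same distribution $\mathcal D(K)=\{v: v\wedge K=0\}$. A section $\varphi$ of $A\to M$, defined on an open set $U\subseteq M$, is an \emph{integral section} of $\{K\}$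 if, for some non-vanishing smooth $f$, $\Lambda^mT(\Phi\circ\varphi)(u)=\omega(u)\,f(\varphi(x))\,K(\varphi(x))$ for all $x\in U$ and $u\in\Lambda^mT_xM$; it is an integral section of a jet field $Y$ along $\Phi$ if $T_x(\Phi\circ\varphi)=Y(\varphi(x))$ for all $x\in U$, and of a connection form if at each $\varphi(x)$ the image of $T_x(\Phi\circ\varphi)$ is the horizontal subspace. An object is \emph{integrable} if through every point of $A$ there is an integral section defined on an open subset of $M$. Let $\{X_{H_o}\}$ be a class of Hamilton–De Donder–Weyl $m$-vector fields of $\mathcal P$ on $P$: a class of $m$-vector fields along $\jmath_P$ which satisfy the structural condition and $i(X_{H_o})\,\hat h^*\Omega=0$ at the points of $P$. Let $\mathcal Y_{H_o}$, $\nabla_{H_o}$ be the associated jet field and connection form. Let $\{\tilde{\mathcal K}\}$ be the class of $m$-vector fields along $\widetilde{FL}\circ j_S$ given by $\Lambda^mT\hat h\circ\{X_{H_o}\}\circ FL_S$, that is, $\tilde{\mathcal K}(s)=f(s)\,\Lambda^mT\hat h\big(X_{H_o}(FL_S(s))\big)$ with $f\in C^\infty(S)$ non-vanishing; let $\tilde{\mathcal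 Y}$, $\tilde\nabla$ be its associated jet field and connection form, and let $\mathcal K=\Lambda^mT\mu\circ\tilde{\mathcal K}$, $\mathcal Y=T\mu\circ\tilde{\mathcal Y}$, $\nabla=T\mu\circ\tilde\nabla$ be the restricted objects, along $FL\circ j_S$. An object $\mathcal K$, $\mathcal Y$ or $\nabla$ is \emph{semi-holonomic} at $s\in S$ if $T\tau^1$ maps it to the jet $j_S(s)$, i.e. $\mathcal D(\Lambda^mT\tau^1\mathcal K(s))$ is the image of the jet $j_S(s)$ as a linear map $T_xM\to T_yE$, respectively $T\tau^1\circ\mathcal Y(s)=j_S(s)$, $T\tau^1\circ\nabla(s)=j_S(s)$; for the extended objects $\tau$ replaces $\tau^1$. A section $\varphi_S$ of $S\to M$ on $U$ is \emph{holonomic} if $j_S\circ\varphi_S=j^1\phi$ for a section $\phi$ of $\pi$ on $U$. An \emph{extended field operator} on $S$ is an $m$-vector field $\tilde{\mathcal K}$ (resp. jet field $\tilde{\mathcal Y}$, connection form $\tilde\nabla$) along $\widetilde{FL}\circ j_S$ which satisfies the structural condition (resp. is a jet field, an Ehresmann connection form), is semi-holonomic on $S$, and satisfies the field equation $\widetilde{FL}^*[i(\tilde{\mathcal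 K})(\Omega\circ\widetilde{FL})]=0$ (resp. $\widetilde{FL}^*[i(\tilde{\mathcal Y})(\Omega\circ\widetilde{FL})]=0$, $\widetilde{FL}^*[i(\tilde\nabla)(\Omega\circ\widetilde{FL})-(m-1)\,\Omega\circ\widetilde{FL}]=0$) on $S$; a \emph{restricted field operator} is the image of an extended one under $\mu$ (that is, its composition with $\Lambda^mT\mu$, resp. $T\mu$). \textbf{Theorem.} Let $(K,X)$ be any one of the pairs $(\{\mathcal K\},\{X_{H_o}\})$, $(\mathcal Y,\mathcal Y_{H_o})$, $(\nabla,\nabla_{H_o})$, $(\{\tilde{\mathcal K}\},\{X_{H_o}\})$, $(\tilde{\mathcal Y},\mathcal Y_{H_o})$, $(\tilde\nabla,\nabla_{H_o})$. Then: \begin{enumerate} \item[(0)] If $K$ is integrable, then so is $X$; if $FL_S$ is a submersion, then $K$ is integrable if and only if $X$ is. \item[(1)] If $\varphi_S$ is an integral section of $K$ on an open set $U\subseteq M$, then $\psi_P=FL_S\circ\varphi_S$ is an integral section of $X$ on $U$. \item[(2)] Conversely, if $\psi_P$ is an integral section of $X$ on an open set $U$, then every smooth $\varphi_S\colon U\to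 S$ with $FL_S\circ\varphi_S=\psi_P$ is an integral section of $K$. Such a $\varphi_S$ is holonomic if and only if $K$ is semi-holonomic at all the points $\varphi_S(x)$, $x\in U$. If $K$ is integrable, then all its integral sections are holonomic if and only if $K$ is semi-holonomic on $S$. \item[(3)] $K$ is a field operator (restricted or extended, of the corresponding kind) if and only if it is semi-holonomic on $S$. \end{enumerate} -/

import Mathlib

open scoped Manifold ContDiff Topology
open Set

noncomputable section

namespace FieldTheory

/-! ### Total spaces of fibre bundles as manifolds -/

section BundleAtlas

universe u

/-- A smooth system of local coordinates for the disjoint union of a family of sets `Z b`, `b ∈ B`: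
charts of the base with values in `V`, together with bijections of the fibres over the domain of
each chart with a fixed normed space `G`, such that all changes of coordinates are smooth. -/
structure BundleAtlas (B : Type u) [TopologicalSpace B]
    (V : Type*) [NormedAddCommGroup V] [NormedSpace ℝ V]
    (G : Type*) [NormedAddCommGroup G] [NormedSpace ℝ G] (Z : B → Type*) where
  /-- the set of indices of the charts -/
  ι : Type*
  /-- the charts of the base -/
  base : ι → OpenPartialHomeomorph B V
  nonempty : ∀ i, (base i).source.Nonempty
  /-- a chart around each point -/
  index : B → ι
  mem_index : ∀ b, b ∈ (base (index b)).source
  /-- the coordinates on the fibres -/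
  coord : ∀ i b, b ∈ (base i).source → (Z b ≃ G)
  contDiffOn_base : ∀ i j, ContDiffOn ℝ ∞ ((base i).symm.trans (base j))
    ((base i).symm.trans (base j)).source
  contDiffOn_trans : ∀ i j, ∃ T : V × G → G,
    ContDiffOn ℝ ∞ T (((base i).symm.trans (base j)).source ×ˢ univ) ∧
    ∀ b (hi : b ∈ (base i).source) (hj : b ∈ (base j).source) g,
      coord j b hj ((coord i b hi).symm g) = T (base i b, g)

namespace BundleAtlas

variable {B : Type u} [TopologicalSpace B] {V : Type*} [NormedAddCommGroup V] [NormedSpace ℝ V]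
  {G : Type*} [NormedAddCommGroup G] [NormedSpace ℝ G] {Z : B → Type*}
  (a : BundleAtlas B V G Z)

open Classical in
/-- The coordinate map `(b, z) ↦ (x, g)` of the total space. -/
def toCoord (i : a.ι) (z : Σ b, Z b) : V × G :=
  (a.base i z.1, if h : z.1 ∈ (a.base i).source then a.coord i z.1 h z.2 else 0)

open Classical in
/-- The inverse `(x, g) ↦ (b, z)` of the coordinate map of the total space. -/
def ofCoord (i : a.ι) (p : V × G) : Σ b, Z b :=
  if h : p.1 ∈ (a.base i).target then
    ⟨(a.base i).symm p.1, (a.coord i _ ((a.base i).map_target h)).symm p.2⟩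
  else ⟨(a.nonempty i).some, (a.coord i _ (a.nonempty i).some_mem).symm 0⟩

lemma toCoord_of_mem (i : a.ι) (b : B) (z : Z b) (h : b ∈ (a.base i).source) :
    a.toCoord i ⟨b, z⟩ = (a.base i b, a.coord i b h z) := by
  simp [toCoord, h]

lemma ofCoord_of_mem (i : a.ι) (x : V) (g : G) (h : x ∈ (a.base i).target) :
    a.ofCoord i (x, g) =
      ⟨(a.base i).symm x, (a.coord i _ ((a.base i).map_target h)).symm g⟩ := by
  simp [ofCoord, h]

/-- The chart `(b, z) ↦ (x, g)` of the total space. -/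
def chart (i : a.ι) : PartialEquiv (Σ b, Z b) (V × G) where
  toFun := a.toCoord i
  invFun := a.ofCoord i
  source := {z | z.1 ∈ (a.base i).source}
  target := {p | p.1 ∈ (a.base i).target}
  map_source' z hz := (a.base i).map_source hz
  map_target' := by
    rintro ⟨x, g⟩ hp
    rw [a.ofCoord_of_mem i x g hp]
    exact (a.base i).map_target hp
  left_inv' := by
    rintro ⟨b, z⟩ hz
    have hz' : b ∈ (a.base i).source := hz
    rw [a.toCoord_of_mem i b z hz', a.ofCoord_of_mem i _ _ ((a.base i).map_source hz')]
    have : ∀ (b' : B) (hb' : b' ∈ (a.base i).source), b' = b →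
        (⟨b', (a.coord i b' hb').symm (a.coord i b hz' z)⟩ : Σ b, Z b) = ⟨b, z⟩ := by
      rintro _ _ rfl
      simp
    exact this _ _ ((a.base i).left_inv hz')
  right_inv' := by
    rintro ⟨x, g⟩ hp
    have hp' : x ∈ (a.base i).target := hp
    rw [a.ofCoord_of_mem i x g hp', a.toCoord_of_mem i _ _ ((a.base i).map_target hp')]
    exact Prod.ext ((a.base i).right_inv hp') (by simp)

lemma chart_trans_source (i j : a.ι) : ((a.chart i).symm.trans (a.chart j)).source
    = ((a.base i).symm.trans (a.base j)).source ×ˢ univ := by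
  ext ⟨x, g⟩
  simp only [PartialEquiv.trans_source, PartialEquiv.symm_source, mem_inter_iff, mem_preimage,
    OpenPartialHomeomorph.trans_source, OpenPartialHomeomorph.symm_source, mem_prod, mem_univ,
    and_true]
  refine and_congr_right fun hx => ?_
  have hx' : x ∈ (a.base i).target := hx
  change (a.ofCoord i (x, g)).1 ∈ (a.base j).source ↔ _
  rw [a.ofCoord_of_mem i x g hx']

lemma contDiffOn_chart_trans (i j : a.ι) : ContDiffOn ℝ ∞ ((a.chart i).symm.trans (a.chart j))
    ((a.chart i).symm.trans (a.chart j)).source := by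
  obtain ⟨T, hT, hTc⟩ := a.contDiffOn_trans i j
  rw [chart_trans_source]
  have h1 : ContDiffOn ℝ ∞ (fun p : V × G => ((a.base i).symm.trans (a.base j)) p.1)
      (((a.base i).symm.trans (a.base j)).source ×ˢ univ) :=
    (a.contDiffOn_base i j).comp contDiff_fst.contDiffOn fun p hp => hp.1
  refine (h1.prodMk hT).congr ?_
  rintro ⟨x, g⟩ ⟨hx, -⟩
  simp only [OpenPartialHomeomorph.trans_source, OpenPartialHomeomorph.symm_source, mem_inter_iff,
    mem_preimage] at hx
  have hs : (a.base i).symm x ∈ (a.base i).source := (a.base i).map_target hx.1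
  have key := hTc _ hs hx.2 g
  rw [(a.base i).right_inv hx.1] at key
  change a.toCoord j (a.ofCoord i (x, g)) = _
  rw [a.ofCoord_of_mem i x g hx.1, a.toCoord_of_mem j _ _ hx.2, key]
  rfl

/-- The charts of the total space form an atlas. -/
def core : ChartedSpaceCore (V × G) (Σ b, Z b) where
  atlas := range a.chart
  chartAt z := a.chart (a.index z.1)
  mem_chart_source z := a.mem_index z.1
  chart_mem_atlas z := mem_range_self _
  open_source := by
    rintro _ _ ⟨i, rfl⟩ ⟨j, rfl⟩
    rw [chart_trans_source]
    exact ((a.base i).symm.trans (a.base j)).open_source.prod isOpen_univ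
  continuousOn_toFun := by
    rintro _ _ ⟨i, rfl⟩ ⟨j, rfl⟩
    exact (a.contDiffOn_chart_trans i j).continuousOn

/-- The total space is a smooth manifold. -/
theorem isManifold :
    let := a.core.toTopologicalSpace
    let := a.core.toChartedSpace
    IsManifold 𝓘(ℝ, V × G) ∞ (Σ b, Z b) := by
  let := a.core.toTopologicalSpace
  let := a.core.toChartedSpace
  apply isManifold_of_contDiffOn
  intro e e' he he'
  obtain ⟨_, ⟨f, rfl⟩, hf⟩ := he
  obtain ⟨_, ⟨f', rfl⟩, hf'⟩ := he'
  obtain ⟨_, ⟨⟨i, rfl⟩, rfl⟩, he⟩ := hf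
  obtain ⟨_, ⟨⟨j, rfl⟩, rfl⟩, he'⟩ := hf'
  rw [mem_singleton_iff] at he he'
  subst he he'
  have := a.contDiffOn_chart_trans i j
  simp only [modelWithCornersSelf_coe, modelWithCornersSelf_coe_symm, Function.id_comp,
    Function.comp_id, preimage_id, range_id, inter_univ]
  exact this

end BundleAtlas

end BundleAtlas

/-! ### Charts and fibre bundles -/

section Charts

variable {V : Type*} [NormedAddCommGroup V] [NormedSpace ℝ V]
  {B : Type*} [TopologicalSpace B] [ChartedSpace V B]

/-- A homeomorphism from an open subset of the manifold `B` to an open subset of its model space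
that is a diffeomorphism, i.e. a chart of the maximal atlas. -/
structure IsSmoothChart (e : OpenPartialHomeomorph B V) : Prop where
  contMDiffOn : ContMDiffOn 𝓘(ℝ, V) 𝓘(ℝ, V) ∞ e e.source
  contMDiffOn_symm : ContMDiffOn 𝓘(ℝ, V) 𝓘(ℝ, V) ∞ e.symm e.target

namespace IsSmoothChart

variable {e e' : OpenPartialHomeomorph B V}

lemma mdifferentiable (h : IsSmoothChart e) : e.MDifferentiable 𝓘(ℝ, V) 𝓘(ℝ, V) :=
  ⟨h.contMDiffOn.mdifferentiableOn (by simp), h.contMDiffOn_symm.mdifferentiableOn (by simp)⟩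

/-- The derivative of a chart at a point of its domain. -/
def deriv (h : IsSmoothChart e) {b : B} (hb : b ∈ e.source) : V ≃L[ℝ] V :=
  h.mdifferentiable.mfderiv hb

lemma hasMFDerivAt (h : IsSmoothChart e) {b : B} (hb : b ∈ e.source) :
    HasMFDerivAt 𝓘(ℝ, V) 𝓘(ℝ, V) e b ((h.deriv hb : V ≃L[ℝ] V) : V →L[ℝ] V) :=
  (h.mdifferentiable.mdifferentiableAt hb).hasMFDerivAt

lemma hasMFDerivAt_symm (h : IsSmoothChart e) {b : B} (hb : b ∈ e.source) :
    HasMFDerivAt 𝓘(ℝ, V) 𝓘(ℝ, V) e.symm (e b) (((h.deriv hb).symm : V ≃L[ℝ] V) : V →L[ℝ] V) :=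
  (h.mdifferentiable.mdifferentiableAt_symm (e.map_source hb)).hasMFDerivAt

lemma contDiffOn_trans (h : IsSmoothChart e) (h' : IsSmoothChart e') :
    ContDiffOn ℝ ∞ (e.symm.trans e') (e.symm.trans e').source := by
  rw [← contMDiffOn_iff_contDiffOn]
  exact h'.contMDiffOn.comp (h.contMDiffOn_symm.mono fun x hx => hx.1) fun x hx => hx.2

lemma deriv_comp_symm (h : IsSmoothChart e) (h' : IsSmoothChart e') {b : B}
    (hb : b ∈ e.source) (hb' : b ∈ e'.source) :
    ((h'.deriv hb' : V ≃L[ℝ] V) : V →L[ℝ] V).comp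
      (((h.deriv hb).symm : V ≃L[ℝ] V) : V →L[ℝ] V)
      = fderiv ℝ (e.symm.trans e') (e b) := by
  have h1 := h.hasMFDerivAt_symm hb
  have h2 : HasMFDerivAt 𝓘(ℝ, V) 𝓘(ℝ, V) e' (e.symm (e b))
      ((h'.deriv hb' : V ≃L[ℝ] V) : V →L[ℝ] V) := by
    have := h'.hasMFDerivAt hb'
    rw [e.left_inv hb]
    exact this
  have h3 : HasMFDerivAt 𝓘(ℝ, V) 𝓘(ℝ, V) (e.symm.trans e') (e b)
      (((h'.deriv hb' : V ≃L[ℝ] V) : V →L[ℝ] V).comp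
        (((h.deriv hb).symm : V ≃L[ℝ] V) : V →L[ℝ] V)) := h2.comp (e b) h1
  have h4 : HasFDerivAt (e.symm.trans e') (((h'.deriv hb' : V ≃L[ℝ] V) : V →L[ℝ] V).comp
        (((h.deriv hb).symm : V ≃L[ℝ] V) : V →L[ℝ] V)) (e b) :=
    hasMFDerivAt_iff_hasFDerivAt.1 h3
  exact h4.fderiv.symm

end IsSmoothChart

end Charts

section Linear

variable {W : Type*} [NormedAddCommGroup W] [NormedSpace ℝ W]
  {W' : Type*} [NormedAddCommGroup W'] [NormedSpace ℝ W'] [FiniteDimensional ℝ W']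
  {X : Type*} [NormedAddCommGroup X] [NormedSpace ℝ X]

/-- Smoothness can be tested after an injective linear map to a finite-dimensional space. -/
lemma contDiffOn_of_injective (L : W →ₗ[ℝ] W') (hL : Function.Injective L) {f : X → W}
    {s : Set X} (hf : ContDiffOn ℝ ∞ (fun x => L (f x)) s) : ContDiffOn ℝ ∞ f s := by
  obtain ⟨g, hg⟩ := L.exists_leftInverse_of_injective (LinearMap.ker_eq_bot.2 hL)
  have : f = fun x => g.toContinuousLinearMap (L (f x)) := by
    ext x
    exact (LinearMap.congr_fun hg (f x)).symm
  rw [this]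
  exact g.toContinuousLinearMap.contDiff.comp_contDiffOn hf

variable {m : ℕ}

/-- An alternating form as a multilinear form. -/
def toMultilinear : (W [⋀^Fin m]→L[ℝ] ℝ) →L[ℝ] ContinuousMultilinearMap ℝ (fun _ : Fin m => W) ℝ :=
  ContinuousAlternatingMap.toContinuousMultilinearMapCLM ℝ

lemma toMultilinear_injective : Function.Injective (toMultilinear (W := W) (m := m)) :=
  ContinuousAlternatingMap.toContinuousMultilinearMap_injective

instance instFiniteDimensionalMultilinear [FiniteDimensional ℝ W] :
    FiniteDimensional ℝ (ContinuousMultilinearMap ℝ (fun _ : Fin m => W) ℝ) :=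
  FiniteDimensional.of_injective
    (ContinuousMultilinearMap.toMultilinearMapLinear :
      ContinuousMultilinearMap ℝ (fun _ : Fin m => W) ℝ →ₗ[ℝ] _)
    ContinuousMultilinearMap.toMultilinearMap_injective

instance instFiniteDimensionalAlternating [FiniteDimensional ℝ W] :
    FiniteDimensional ℝ (W [⋀^Fin m]→L[ℝ] ℝ) :=
  FiniteDimensional.of_injective (toMultilinear (W := W) (m := m)).toLinearMap
    toMultilinear_injective

/-- The pull-back of an alternating form depends smoothly on the form and the linear map. -/
lemma contDiffOn_compContinuousLinearMap {s : Set X} {f : X → W [⋀^Fin m]→L[ℝ] ℝ}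
    {A : X → W' →L[ℝ] W} (hf : ContDiffOn ℝ ∞ f s) (hA : ContDiffOn ℝ ∞ A s) :
    ContDiffOn ℝ ∞ (fun x => (f x).compContinuousLinearMap (A x)) s := by
  refine contDiffOn_of_injective (toMultilinear (W := W') (m := m)).toLinearMap
    toMultilinear_injective ?_
  have h1 : ContDiffOn ℝ ∞ (fun x =>
      (ContinuousMultilinearMap.compContinuousLinearMapContinuousMultilinear ℝ
        (fun _ : Fin m => W') (fun _ : Fin m => W) ℝ) (fun _ => A x)) s :=
    (ContinuousMultilinearMap.contDiff _).comp_contDiffOn (contDiffOn_pi.2 fun _ => hA)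
  have h2 : ContDiffOn ℝ ∞ (fun x => toMultilinear (f x)) s :=
    (toMultilinear (W := W) (m := m)).contDiff.comp_contDiffOn hf
  exact h1.clm_apply h2

end Linear

/-- The model space of the base. -/
abbrev Base (m : ℕ) : Type := EuclideanSpace ℝ (Fin m)

/-- The model space of the typical fibre. -/
abbrev Fib (N : ℕ) : Type := EuclideanSpace ℝ (Fin N)

/-- The model space of the total space of a bundle. -/
abbrev Tot (m N : ℕ) : Type := Base m × Fib N

section Bundle

universe u v

variable (m N : ℕ) {M : Type v} [TopologicalSpace M] [ChartedSpace (Base m) M]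
  {E : Type u} [TopologicalSpace E] [ChartedSpace (Tot m N) E]

/-- `π : E → M` is a smooth fibre bundle, with `dim M = m` and `dim E = N + m`: there are a
manifold `Q` of dimension `N` and, around each point of `M`, local trivialisations
`π⁻¹(U) ≃ U × Q` that are diffeomorphisms over `U`. -/
class SmoothFiberBundle (π : E → M) : Prop where
  contMDiff : ContMDiff 𝓘(ℝ, Tot m N) 𝓘(ℝ, Base m) ∞ π
  exists_trivialization : ∃ (Q : Type u) (_ : TopologicalSpace Q) (_ : ChartedSpace (Fib N) Q),
    IsManifold 𝓘(ℝ, Fib N) ∞ Q ∧ Nonempty Q ∧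
    ∀ x : M, ∃ (U : Set M) (t : OpenPartialHomeomorph E (M × Q)), x ∈ U ∧
      t.source = π ⁻¹' U ∧ t.target = U ×ˢ univ ∧ (∀ y ∈ t.source, (t y).1 = π y) ∧
      ContMDiffOn 𝓘(ℝ, Tot m N) (𝓘(ℝ, Base m).prod 𝓘(ℝ, Fib N)) ∞ t t.source ∧
      ContMDiffOn (𝓘(ℝ, Base m).prod 𝓘(ℝ, Fib N)) 𝓘(ℝ, Tot m N) ∞ t.symm t.target

/-- The derivative `T_y π` of the projection; tangent spaces are modelled on the model space. -/
def dproj (π : E → M) (y : E) : Tot m N →L[ℝ] Base m :=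
  mfderiv 𝓘(ℝ, Tot m N) 𝓘(ℝ, Base m) π y

/-- A system of local coordinates `(x, y)` of `E` adapted to the bundle `π : E → M`. -/
structure AdaptedChart (π : E → M) where
  /-- the coordinates `(x, y)` on `E` -/
  tot : OpenPartialHomeomorph E (Tot m N)
  /-- the coordinates `x` on `M` -/
  bas : OpenPartialHomeomorph M (Base m)
  smooth_tot : IsSmoothChart tot
  smooth_bas : IsSmoothChart bas
  mapsTo : ∀ y ∈ tot.source, π y ∈ bas.source
  fst_tot : ∀ y ∈ tot.source, (tot y).1 = bas (π y)
  nonempty : tot.source.Nonempty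

namespace AdaptedChart

variable {m N} {π : E → M} [SmoothFiberBundle m N π] (c d : AdaptedChart m N π) {y : E}

/-- The derivative of the coordinates of `E`. -/
def D (hy : y ∈ c.tot.source) : Tot m N ≃L[ℝ] Tot m N := c.smooth_tot.deriv hy

/-- The derivative of the coordinates of `M`. -/
def Dbas (hy : y ∈ c.tot.source) : Base m ≃L[ℝ] Base m := c.smooth_bas.deriv (c.mapsTo y hy)

lemma fst_D (hy : y ∈ c.tot.source) (v : Tot m N) :
    (c.D hy v).1 = c.Dbas hy (dproj m N π y v) := by
  have h1 := c.smooth_tot.hasMFDerivAt hy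
  have h2 := c.smooth_bas.hasMFDerivAt (c.mapsTo y hy)
  have h3 : HasMFDerivAt 𝓘(ℝ, Tot m N) 𝓘(ℝ, Base m) π y (dproj m N π y) :=
    ((SmoothFiberBundle.contMDiff (m := m) (N := N) (π := π)).mdifferentiable
      (by simp) y).hasMFDerivAt
  have h4 : HasMFDerivAt 𝓘(ℝ, Tot m N) 𝓘(ℝ, Base m) (Prod.fst : Tot m N → Base m) (c.tot y)
      (ContinuousLinearMap.fst ℝ (Base m) (Fib N)) :=
    (ContinuousLinearMap.fst ℝ (Base m) (Fib N)).hasFDerivAt.hasMFDerivAt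
  have h5 := h4.comp y h1
  have h6 := h2.comp y h3
  have h7 : (c.bas ∘ π) =ᶠ[𝓝 y] (Prod.fst ∘ c.tot) := by
    filter_upwards [c.tot.open_source.mem_nhds hy] with z hz
    exact (c.fst_tot z hz).symm
  have h8 := hasMFDerivAt_unique h5 (h6.congr_of_eventuallyEq h7.symm)
  exact DFunLike.congr_fun h8 v

end AdaptedChart

variable [IsManifold 𝓘(ℝ, Base m) ∞ M]
variable (π : E → M) [SmoothFiberBundle m N π]

lemma exists_adaptedChart (y : E) : ∃ c : AdaptedChart m N π, y ∈ c.tot.source := by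
  obtain ⟨Q, _, _, _, _, hQ⟩ := SmoothFiberBundle.exists_trivialization (m := m) (N := N) (π := π)
  obtain ⟨U, t, hxU, hs, ht, hfst, hc, hc'⟩ := hQ (π y)
  have hy : y ∈ t.source := by rw [hs]; exact hxU
  let χ := chartAt (Base m) (π y)
  let κ := chartAt (Fib N) (t y).2
  have hχ : ContMDiffOn 𝓘(ℝ, Base m) 𝓘(ℝ, Base m) ∞ χ χ.source := contMDiffOn_chart
  have hχ' : ContMDiffOn 𝓘(ℝ, Base m) 𝓘(ℝ, Base m) ∞ χ.symm χ.target := contMDiffOn_chart_symm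
  have hκ : ContMDiffOn 𝓘(ℝ, Fib N) 𝓘(ℝ, Fib N) ∞ κ κ.source := contMDiffOn_chart
  have hκ' : ContMDiffOn 𝓘(ℝ, Fib N) 𝓘(ℝ, Fib N) ∞ κ.symm κ.target := contMDiffOn_chart_symm
  let p : OpenPartialHomeomorph (M × Q) (Tot m N) := χ.prod κ
  have hp : ContMDiffOn (𝓘(ℝ, Base m).prod 𝓘(ℝ, Fib N)) 𝓘(ℝ, Tot m N) ∞ p p.source := by
    rw [modelWithCornersSelf_prod, ← chartedSpaceSelf_prod]
    exact hχ.prodMap hκ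
  have hp' : ContMDiffOn 𝓘(ℝ, Tot m N) (𝓘(ℝ, Base m).prod 𝓘(ℝ, Fib N)) ∞ p.symm p.target := by
    rw [modelWithCornersSelf_prod, ← chartedSpaceSelf_prod]
    exact hχ'.prodMap hκ'
  have hmem : y ∈ (t.trans p).source := by
    refine ⟨hy, ?_, ?_⟩
    · change (t y).1 ∈ χ.source
      rw [hfst y hy]
      exact mem_chart_source _ _
    · exact mem_chart_source _ _
  refine ⟨⟨t.trans p, χ, ⟨?_, ?_⟩, ⟨hχ, hχ'⟩, ?_, ?_, ⟨y, hmem⟩⟩, hmem⟩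
  · exact hp.comp (hc.mono fun x hx => hx.1) fun x hx => hx.2
  · exact hc'.comp (hp'.mono fun x hx => hx.1) fun x hx => hx.2
  · rintro z ⟨hz, hz', -⟩
    rw [← hfst z hz]
    exact hz'
  · rintro z ⟨hz, -⟩
    change χ (t z).1 = _
    rw [hfst z hz]

end Bundle

/-! ### The jet bundle and the multimomentum bundles -/

section Forms

variable {m : ℕ} {V : Type*} [NormedAddCommGroup V] [NormedSpace ℝ V]
  {X : Type*} [NormedAddCommGroup X] [NormedSpace ℝ X]
  {V' : Type*} [NormedAddCommGroup V'] [NormedSpace ℝ V']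
  {X' : Type*} [NormedAddCommGroup X'] [NormedSpace ℝ X']

variable (m) in
/-- `Λ₁ᵐV*`: the `m`-forms on `V` that vanish on any two vectors which are vertical, i.e. in the
kernel of the projection `P : V → X`. -/
def Lam1 (P : V →L[ℝ] X) : Submodule ℝ (V [⋀^Fin m]→L[ℝ] ℝ) where
  carrier := {α | ∀ (v : Fin m → V) (i j : Fin m), i ≠ j → P (v i) = 0 → P (v j) = 0 → α v = 0}
  add_mem' {α β} hα hβ v i j hij hi hj := by
    simp [hα v i j hij hi hj, hβ v i j hij hi hj]
  zero_mem' := by simp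
  smul_mem' c α hα v i j hij hi hj := by simp [hα v i j hij hi hj]

variable (m) in
/-- `Λ₀ᵐV*`: the `m`-forms on `V` that are pulled back from `X` by the projection `P : V → X`. -/
def Lam0 (P : V →L[ℝ] X) : Submodule ℝ (V [⋀^Fin m]→L[ℝ] ℝ) where
  carrier := {α | ∃ β : X [⋀^Fin m]→L[ℝ] ℝ, α = β.compContinuousLinearMap P}
  add_mem' := by
    rintro _ _ ⟨β, rfl⟩ ⟨β', rfl⟩
    exact ⟨β + β', rfl⟩
  zero_mem' := ⟨0, rfl⟩
  smul_mem' := by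
    rintro c _ ⟨β, rfl⟩
    exact ⟨c • β, rfl⟩

lemma Lam1.comp_mem {P : V →L[ℝ] X} {P' : V' →L[ℝ] X'} {α : V [⋀^Fin m]→L[ℝ] ℝ}
    (hα : α ∈ Lam1 m P) (D : V' →L[ℝ] V) (hD : ∀ v, P' v = 0 → P (D v) = 0) :
    α.compContinuousLinearMap D ∈ Lam1 m P' := fun v i j hij hi hj =>
  hα (fun k => D (v k)) i j hij (hD _ hi) (hD _ hj)

variable (m) in
/-- Two forms of `Λ₁ᵐV*` are equivalent if their difference belongs to `Λ₀ᵐV*`. -/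
def lamSetoid (P : V →L[ℝ] X) : Setoid (Lam1 m P) where
  r α β := (α : V [⋀^Fin m]→L[ℝ] ℝ) - β ∈ Lam0 m P
  iseqv := by
    refine ⟨fun α => ?_, fun {α β} h => ?_, fun {α β γ} h h' => ?_⟩
    · rw [sub_self]; exact (Lam0 m P).zero_mem
    · rw [← neg_sub]; exact (Lam0 m P).neg_mem h
    · rw [← sub_add_sub_cancel]; exact (Lam0 m P).add_mem h h'

end Forms

section LinearCoordinates

variable (m N : ℕ)

/-- The projection `(x, y) ↦ x` of the model space. -/
abbrev fstL : Tot m N →L[ℝ] Base m := ContinuousLinearMap.fst ℝ (Base m) (Fib N)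

/-- The inclusion `x ↦ (x, 0)` of the model space. -/
abbrev inlL : Base m →L[ℝ] Tot m N := ContinuousLinearMap.inl ℝ (Base m) (Fib N)

/-- The model space of the fibres of `J¹E`, with coordinates `v`. -/
abbrev JetModel : Type := Base m →L[ℝ] Fib N

/-- The model space of the fibres of `Mπ`, with coordinates `(p_A^α, p)`. -/
abbrev MPiModel : Type := Lam1 m (fstL m N)

/-- The forms in `Λ₁ᵐ` whose component `p dx¹ ∧ … ∧ dxᵐ` is zero. -/
def dualModel : Submodule ℝ (Tot m N [⋀^Fin m]→L[ℝ] ℝ) where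
  carrier := {α | α ∈ Lam1 m (fstL m N) ∧ α.compContinuousLinearMap (inlL m N) = 0}
  add_mem' {α β} hα hβ := by
    refine ⟨(Lam1 m (fstL m N)).add_mem hα.1 hβ.1, ?_⟩
    change α.compContinuousLinearMap _ + β.compContinuousLinearMap _ = 0
    rw [hα.2, hβ.2, add_zero]
  zero_mem' := ⟨(Lam1 m (fstL m N)).zero_mem, rfl⟩
  smul_mem' c α hα := by
    refine ⟨(Lam1 m (fstL m N)).smul_mem c hα.1, ?_⟩
    change c • α.compContinuousLinearMap _ = 0
    rw [hα.2, smul_zero]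

/-- The model space of the fibres of `J¹*E`, with coordinates `p_A^α`. -/
abbrev J1DualModel : Type := dualModel m N

variable {m N}

/-- Removal of the component `p dx¹ ∧ … ∧ dxᵐ` of a form on the model space. -/
def removeP (α : Tot m N [⋀^Fin m]→L[ℝ] ℝ) : Tot m N [⋀^Fin m]→L[ℝ] ℝ :=
  α - (α.compContinuousLinearMap (inlL m N)).compContinuousLinearMap (fstL m N)

lemma removeP_mem {α : Tot m N [⋀^Fin m]→L[ℝ] ℝ} (hα : α ∈ Lam1 m (fstL m N)) :
    removeP α ∈ dualModel m N := by
  refine ⟨fun v i j hij hi hj => ?_, ?_⟩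
  · have h1 : α v = 0 := hα v i j hij hi hj
    have h2 : α (fun k => inlL m N (fstL m N (v k))) = 0 := by
      refine α.map_coord_zero i ?_
      rw [hi, map_zero]
    change α v - α (fun k => inlL m N (fstL m N (v k))) = 0
    rw [h1, h2, sub_zero]
  · ext v
    change α (fun k => inlL m N (v k))
      - α (fun k => inlL m N (fstL m N (inlL m N (v k)))) = 0
    simp

lemma removeP_eq_of_sub_mem {α β : Tot m N [⋀^Fin m]→L[ℝ] ℝ}
    (h : ∃ δ : Base m [⋀^Fin m]→L[ℝ] ℝ, α - β = δ.compContinuousLinearMap (fstL m N)) :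
    removeP α = removeP β := by
  obtain ⟨δ, h⟩ := h
  ext v
  have h1 := DFunLike.congr_fun h v
  have h2 := DFunLike.congr_fun h (fun k => inlL m N (fstL m N (v k)))
  change α v - α (fun k => inlL m N (fstL m N (v k)))
    = β v - β (fun k => inlL m N (fstL m N (v k)))
  change α v - β v = δ fun k => fstL m N (v k) at h1
  change α _ - β _ = δ fun k => fstL m N (inlL m N (fstL m N (v k))) at h2
  have h3 : (fun k => fstL m N (inlL m N (fstL m N (v k)))) = fun k => fstL m N (v k) := by
    funext k; simp
  rw [h3] at h2
  linarith

lemma removeP_eq_self {β : Tot m N [⋀^Fin m]→L[ℝ] ℝ} (h : β ∈ dualModel m N) :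
    removeP β = β := by
  rw [removeP, h.2]
  exact sub_zero _

variable {V : Type*} [NormedAddCommGroup V] [NormedSpace ℝ V]
  {X : Type*} [NormedAddCommGroup X] [NormedSpace ℝ X]
  {P : V →L[ℝ] X} (D : V ≃L[ℝ] Tot m N) (Db : X ≃L[ℝ] Base m)

lemma proj_symm (h : ∀ v, (D v).1 = Db (P v)) (w : Tot m N) : P (D.symm w) = Db.symm w.1 := by
  rw [ContinuousLinearEquiv.eq_symm_apply, ← h, ContinuousLinearEquiv.apply_symm_apply]

variable (h : ∀ v, (D v).1 = Db (P v))

/-- The coordinates of the right inverses of a projection `P`. -/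
def jetEquiv : {γ : X →L[ℝ] V // P.comp γ = ContinuousLinearMap.id ℝ X} ≃ JetModel m N where
  toFun γ := (ContinuousLinearMap.snd ℝ (Base m) (Fib N)).comp
    ((D : V →L[ℝ] Tot m N).comp (γ.1.comp (Db.symm : Base m →L[ℝ] X)))
  invFun v := ⟨(D.symm : Tot m N →L[ℝ] V).comp
    (((ContinuousLinearMap.id ℝ (Base m)).prod v).comp (Db : X →L[ℝ] Base m)), by
      ext x
      change P (D.symm (Db x, v (Db x))) = x
      rw [proj_symm D Db h]
      simp⟩
  left_inv γ := by
    refine Subtype.ext (ContinuousLinearMap.ext fun x => ?_)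
    change D.symm (Db x, (D (γ.1 (Db.symm (Db x)))).2) = γ.1 x
    rw [ContinuousLinearEquiv.symm_apply_eq, ContinuousLinearEquiv.symm_apply_apply]
    refine Prod.ext ?_ rfl
    rw [h]
    exact congrArg Db (DFunLike.congr_fun γ.2 x).symm
  right_inv v := by
    ext1 x
    change (D (D.symm (Db (Db.symm x), v (Db (Db.symm x))))).2 = v x
    simp

/-- The coordinates of the forms in `Λ₁ᵐ`. -/
def lam1Equiv : Lam1 m P ≃ MPiModel m N where
  toFun α := ⟨α.1.compContinuousLinearMap (D.symm : Tot m N →L[ℝ] V),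
    Lam1.comp_mem α.2 _ fun w hw => by
      change P (D.symm w) = 0
      rw [proj_symm D Db h]
      change w.1 = 0 at hw
      rw [hw, map_zero]⟩
  invFun β := ⟨β.1.compContinuousLinearMap (D : V →L[ℝ] Tot m N),
    Lam1.comp_mem β.2 _ fun w hw => by
      change (D w).1 = 0
      rw [h, hw, map_zero]⟩
  left_inv α := by
    refine Subtype.ext (ContinuousAlternatingMap.ext fun v => ?_)
    change α.1 (fun k => D.symm (D (v k))) = α.1 v
    simp
  right_inv β := by
    refine Subtype.ext (ContinuousAlternatingMap.ext fun v => ?_)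
    change β.1 (fun k => D (D.symm (v k))) = β.1 v
    simp

/-- The coordinates of the classes of forms in `Λ₁ᵐ` modulo `Λ₀ᵐ`. -/
def dualEquiv : Quotient (lamSetoid m P) ≃ J1DualModel m N where
  toFun := Quotient.lift
    (fun α => (⟨removeP (lam1Equiv D Db h α).1, removeP_mem (lam1Equiv D Db h α).2⟩ :
      J1DualModel m N)) (by
      rintro α β ⟨δ, hδ⟩
      refine Subtype.ext (removeP_eq_of_sub_mem
        ⟨δ.compContinuousLinearMap (Db.symm : Base m →L[ℝ] X), ?_⟩)
      ext w
      have := DFunLike.congr_fun hδ (fun k => D.symm (w k))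
      change α.1 (fun k => D.symm (w k)) - β.1 (fun k => D.symm (w k))
        = δ (fun k => P (D.symm (w k))) at this
      change α.1 (fun k => D.symm (w k)) - β.1 (fun k => D.symm (w k))
        = δ (fun k => Db.symm (w k).1)
      rw [this]
      congr 1
      funext k
      exact proj_symm D Db h _)
  invFun β := Quotient.mk _ ((lam1Equiv D Db h).symm ⟨β.1, β.2.1⟩)
  left_inv := by
    rintro ⟨α⟩
    refine Quotient.sound ?_
    refine ⟨(-(α.1.compContinuousLinearMap ((D.symm : Tot m N →L[ℝ] V).comp
      ((inlL m N).comp (Db : X →L[ℝ] Base m))))), ?_⟩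
    ext v
    change (α.1 (fun k => D.symm (D (v k)))
      - α.1 (fun k => D.symm (inlL m N (fstL m N (D (v k)))))) - α.1 v
      = - α.1 (fun k => D.symm (inlL m N (Db (P (v k)))))
    have h1 : ∀ k, fstL m N (D (v k)) = Db (P (v k)) := fun k => h _
    simp only [h1, ContinuousLinearEquiv.symm_apply_apply]
    ring
  right_inv β := by
    refine Subtype.ext ?_
    change removeP (lam1Equiv D Db h ((lam1Equiv D Db h).symm ⟨β.1, β.2.1⟩)).1 = β.1
    rw [Equiv.apply_symm_apply]
    exact removeP_eq_self β.2

end LinearCoordinates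

section Bundles

universe u v

variable (m N : ℕ) {M : Type v} [TopologicalSpace M] [ChartedSpace (Base m) M]
  {E : Type u} [TopologicalSpace E] [ChartedSpace (Tot m N) E] (π : E → M)

/-- The fibre of the jet bundle at `y ∈ E`: the value at `π(y)` of the first jet of a local section
`φ` with `φ(π(y)) = y` is its derivative, a linear map `γ : T_{π(y)}M → T_yE` with
`T_yπ ∘ γ = id`. -/
abbrev JetFiber (y : E) : Type :=
  {γ : Base m →L[ℝ] Tot m N // (dproj m N π y).comp γ = ContinuousLinearMap.id ℝ (Base m)}

/-- The fibre `Λ₁ᵐT_y*E` of the extended multimomentum bundle. -/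
abbrev MPiFiber (y : E) : Type := Lam1 m (dproj m N π y)

/-- The fibre `Λ₁ᵐT_y*E / Λ₀ᵐT_y*E` of the restricted multimomentum bundle. -/
abbrev J1DualFiber (y : E) : Type := Quotient (lamSetoid m (dproj m N π y))

/-- The first jet bundle `J¹E` of `π : E → M`. -/
def J1 : Type u := Σ y : E, JetFiber m N π y

/-- The extended multimomentum bundle `Mπ = Λ₁ᵐT*E`. -/
def MPi : Type u := Σ y : E, MPiFiber m N π y

/-- The restricted multimomentum bundle `J¹*E = Λ₁ᵐT*E / Λ₀ᵐT*E`. -/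
def J1Dual : Type u := Σ y : E, J1DualFiber m N π y

variable {m N π} in
lemma AdaptedChart.contDiffOn_trans (c d : AdaptedChart m N π) :
    ContDiffOn ℝ ∞ (c.tot.symm.trans d.tot) (c.tot.symm.trans d.tot).source :=
  c.smooth_tot.contDiffOn_trans d.smooth_tot

variable {m N π} in
lemma AdaptedChart.contDiffOn_fderiv_trans (c d : AdaptedChart m N π) :
    ContDiffOn ℝ ∞ (fderiv ℝ (c.tot.symm.trans d.tot)) (c.tot.symm.trans d.tot).source :=
  (c.contDiffOn_trans d).fderiv_of_isOpen (c.tot.symm.trans d.tot).open_source (by simp)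

variable {m N π} in
/-- The first component of a change of coordinates takes values in the domain of the
corresponding change of coordinates of the base. -/
lemma AdaptedChart.mapsTo_trans (c d : AdaptedChart m N π) {e : Tot m N}
    (he : e ∈ (c.tot.symm.trans d.tot).source) :
    ((c.tot.symm.trans d.tot) e).1 ∈ (d.bas.symm.trans c.bas).source := by
  have h1 : c.tot.symm e ∈ c.tot.source := c.tot.map_target he.1
  have h2 : c.tot.symm e ∈ d.tot.source := he.2
  change (d.tot (c.tot.symm e)).1 ∈ _
  rw [d.fst_tot _ h2]
  refine ⟨d.bas.map_source (d.mapsTo _ h2), ?_⟩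
  change d.bas.symm (d.bas _) ∈ c.bas.source
  rw [d.bas.left_inv (d.mapsTo _ h2)]
  exact c.mapsTo _ h1

variable {m N π} in
lemma AdaptedChart.contDiffOn_fderiv_bas (c d : AdaptedChart m N π) :
    ContDiffOn ℝ ∞ (fun e => fderiv ℝ (d.bas.symm.trans c.bas) ((c.tot.symm.trans d.tot) e).1)
      (c.tot.symm.trans d.tot).source :=
  ((d.smooth_bas.contDiffOn_trans c.smooth_bas).fderiv_of_isOpen
    (d.bas.symm.trans c.bas).open_source (m := ∞) (by simp)).comp
    (contDiff_fst.comp_contDiffOn (c.contDiffOn_trans d)) fun _ he => c.mapsTo_trans d he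

variable {m N π} in
/-- The change from the coordinates `c` to the coordinates `d` for jets. -/
def jetTrans (c d : AdaptedChart m N π) (p : Tot m N × JetModel m N) : JetModel m N :=
  (ContinuousLinearMap.snd ℝ (Base m) (Fib N)).comp
    ((fderiv ℝ (c.tot.symm.trans d.tot) p.1).comp
      ((inlL m N + (ContinuousLinearMap.inr ℝ (Base m) (Fib N)).comp p.2).comp
        (fderiv ℝ (d.bas.symm.trans c.bas) ((c.tot.symm.trans d.tot) p.1).1)))

variable {m N π} in
lemma contDiffOn_jetTrans (c d : AdaptedChart m N π) : ContDiffOn ℝ ∞ (jetTrans c d)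
    ((c.tot.symm.trans d.tot).source ×ˢ univ) := by
  have h0 : MapsTo (Prod.fst : Tot m N × JetModel m N → Tot m N)
      ((c.tot.symm.trans d.tot).source ×ˢ univ) (c.tot.symm.trans d.tot).source :=
    fun _ h => h.1
  have h1 := (c.contDiffOn_fderiv_trans d).comp contDiff_fst.contDiffOn h0
  have h2 := (c.contDiffOn_fderiv_bas d).comp contDiff_fst.contDiffOn h0
  have h3 : ContDiffOn ℝ ∞ (fun p : Tot m N × JetModel m N =>
      inlL m N + (ContinuousLinearMap.inr ℝ (Base m) (Fib N)).comp p.2)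
      ((c.tot.symm.trans d.tot).source ×ˢ univ) :=
    (contDiff_const.add (contDiff_const.clm_comp contDiff_snd)).contDiffOn
  exact contDiff_const.contDiffOn.clm_comp (h1.clm_comp (h3.clm_comp h2))

variable {m N π} in
/-- The change from the coordinates `c` to the coordinates `d` for forms. -/
def formTrans (c d : AdaptedChart m N π) (p : Tot m N × (Tot m N [⋀^Fin m]→L[ℝ] ℝ)) :
    Tot m N [⋀^Fin m]→L[ℝ] ℝ :=
  p.2.compContinuousLinearMap
    (fderiv ℝ (d.tot.symm.trans c.tot) ((c.tot.symm.trans d.tot) p.1))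

variable {m N π} in
lemma contDiffOn_formTrans (c d : AdaptedChart m N π) : ContDiffOn ℝ ∞ (formTrans c d)
    ((c.tot.symm.trans d.tot).source ×ˢ univ) := by
  have h0 : MapsTo (Prod.fst : Tot m N × (Tot m N [⋀^Fin m]→L[ℝ] ℝ) → Tot m N)
      ((c.tot.symm.trans d.tot).source ×ˢ univ) (c.tot.symm.trans d.tot).source :=
    fun _ h => h.1
  have h1 : MapsTo (c.tot.symm.trans d.tot) (c.tot.symm.trans d.tot).source
      (d.tot.symm.trans c.tot).source := by
    intro e he
    have h2 : c.tot.symm e ∈ d.tot.source := he.2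
    refine ⟨d.tot.map_source h2, ?_⟩
    change d.tot.symm (d.tot (c.tot.symm e)) ∈ c.tot.source
    rw [d.tot.left_inv h2]
    exact c.tot.map_target he.1
  exact contDiffOn_compContinuousLinearMap contDiff_snd.contDiffOn
    (((d.contDiffOn_fderiv_trans c).comp (c.contDiffOn_trans d) h1).comp
      contDiff_fst.contDiffOn h0)

variable {m N π} in
lemma AdaptedChart.trans_apply (c d : AdaptedChart m N π) {b : E} (hc : b ∈ c.tot.source) :
    (c.tot.symm.trans d.tot) (c.tot b) = d.tot b := by
  change d.tot (c.tot.symm (c.tot b)) = _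
  rw [c.tot.left_inv hc]

variable {m N π} in
open Classical in
/-- A change of coordinates for forms, as a map to a space of forms. -/
def subTrans (F F' : Submodule ℝ (Tot m N [⋀^Fin m]→L[ℝ] ℝ))
    (f : Tot m N × (Tot m N [⋀^Fin m]→L[ℝ] ℝ) → (Tot m N [⋀^Fin m]→L[ℝ] ℝ))
    (p : Tot m N × F) : F' :=
  if h : f (p.1, p.2) ∈ F' then ⟨f (p.1, p.2), h⟩ else 0

variable {m N π} in
lemma contDiffOn_subTrans (F F' : Submodule ℝ (Tot m N [⋀^Fin m]→L[ℝ] ℝ))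
    (f : Tot m N × (Tot m N [⋀^Fin m]→L[ℝ] ℝ) → (Tot m N [⋀^Fin m]→L[ℝ] ℝ)) {s : Set (Tot m N)}
    (hf : ContDiffOn ℝ ∞ f (s ×ˢ univ)) (hF : ∀ e ∈ s, ∀ g : F, f (e, g) ∈ F') :
    ContDiffOn ℝ ∞ (subTrans F F' f) (s ×ˢ univ) := by
  refine contDiffOn_of_injective F'.subtype Subtype.val_injective ?_
  have hs : ContDiff ℝ ∞ (fun p : Tot m N × F => (p.2 : Tot m N [⋀^Fin m]→L[ℝ] ℝ)) :=
    F.subtypeL.contDiff.comp (contDiff_snd (𝕜 := ℝ) (E := Tot m N) (F := F))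
  have h1 : ContDiff ℝ ∞ (fun p : Tot m N × F => (p.1, (p.2 : Tot m N [⋀^Fin m]→L[ℝ] ℝ))) :=
    contDiff_fst.prodMk hs
  refine (hf.comp h1.contDiffOn (t := s ×ˢ univ) fun p hp => ⟨hp.1, trivial⟩).congr ?_
  rintro ⟨e, g⟩ ⟨he, -⟩
  have := hF e he g
  simp [subTrans, this]

variable {m N π} in
/-- The change from the coordinates `c` to the coordinates `d` for classes of forms. -/
def dualTrans (c d : AdaptedChart m N π) (p : Tot m N × (Tot m N [⋀^Fin m]→L[ℝ] ℝ)) :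
    Tot m N [⋀^Fin m]→L[ℝ] ℝ :=
  removeP (formTrans c d p)

variable {m N π} in
lemma contDiffOn_dualTrans (c d : AdaptedChart m N π) : ContDiffOn ℝ ∞ (dualTrans c d)
    ((c.tot.symm.trans d.tot).source ×ˢ univ) :=
  (contDiffOn_formTrans c d).sub (contDiffOn_compContinuousLinearMap
    (contDiffOn_compContinuousLinearMap (contDiffOn_formTrans c d) contDiffOn_const)
    contDiffOn_const)

variable {m N π} in
lemma AdaptedChart.exists_eq (c d : AdaptedChart m N π) {e : Tot m N}
    (he : e ∈ (c.tot.symm.trans d.tot).source) :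
    ∃ b, b ∈ c.tot.source ∧ b ∈ d.tot.source ∧ c.tot b = e :=
  ⟨c.tot.symm e, c.tot.map_target he.1, he.2, c.tot.right_inv he.1⟩

variable [SmoothFiberBundle m N π]

variable {m N π} in
lemma AdaptedChart.formTrans_eq (c d : AdaptedChart m N π) {b : E}
    (hc : b ∈ c.tot.source) (hd : b ∈ d.tot.source) (g : MPiModel m N) :
    (lam1Equiv (d.D hd) (d.Dbas hd) (d.fst_D hd)
      ((lam1Equiv (c.D hc) (c.Dbas hc) (c.fst_D hc)).symm g)).1
      = formTrans c d (c.tot b, g.1) := by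
  have h1 := d.smooth_tot.deriv_comp_symm c.smooth_tot hd hc
  rw [formTrans]
  simp only
  rw [c.trans_apply d hc, ← h1]
  rfl

variable [IsManifold 𝓘(ℝ, Base m) ∞ M]

/-- The coordinates `(x, y, v)` of `J¹E`. -/
def jetAtlas : BundleAtlas E (Tot m N) (JetModel m N) (JetFiber m N π) where
  ι := AdaptedChart m N π
  base c := c.tot
  nonempty c := c.nonempty
  index y := (exists_adaptedChart m N π y).choose
  mem_index y := (exists_adaptedChart m N π y).choose_spec
  coord c y hy := jetEquiv (c.D hy) (c.Dbas hy) (c.fst_D hy)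
  contDiffOn_base c d := c.contDiffOn_trans d
  contDiffOn_trans c d := by
    refine ⟨jetTrans c d, contDiffOn_jetTrans c d, fun b hc hd v => ?_⟩
    have h1 := c.smooth_tot.deriv_comp_symm d.smooth_tot hc hd
    have h2 := d.smooth_bas.deriv_comp_symm c.smooth_bas (d.mapsTo b hd) (c.mapsTo b hc)
    ext1 x
    rw [jetTrans]
    simp only
    rw [c.trans_apply d hc, d.fst_tot b hd, ← h1, ← h2]
    change (d.D hd ((c.D hc).symm (c.Dbas hc ((d.Dbas hd).symm x),
      v (c.Dbas hc ((d.Dbas hd).symm x))))).2 = (d.D hd ((c.D hc).symm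
        ((c.Dbas hc ((d.Dbas hd).symm x), 0) + (0, v (c.Dbas hc ((d.Dbas hd).symm x)))))).2
    simp

/-- The coordinates `(x, y, p_A^α, p)` of `Mπ`. -/
def mpiAtlas : BundleAtlas E (Tot m N) (MPiModel m N) (MPiFiber m N π) where
  ι := AdaptedChart m N π
  base c := c.tot
  nonempty c := c.nonempty
  index y := (exists_adaptedChart m N π y).choose
  mem_index y := (exists_adaptedChart m N π y).choose_spec
  coord c y hy := lam1Equiv (c.D hy) (c.Dbas hy) (c.fst_D hy)
  contDiffOn_base c d := c.contDiffOn_trans d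
  contDiffOn_trans c d := by
    have key : ∀ e ∈ (c.tot.symm.trans d.tot).source, ∀ g : MPiModel m N,
        formTrans c d (e, g.1) ∈ Lam1 m (fstL m N) := by
      intro e he g
      obtain ⟨b, hc, hd, rfl⟩ := c.exists_eq d he
      rw [← c.formTrans_eq d hc hd]
      exact Subtype.prop _
    refine ⟨subTrans _ _ (formTrans c d),
      contDiffOn_subTrans _ _ _ (contDiffOn_formTrans c d) key, fun b hc hd g => Subtype.ext ?_⟩
    have h1 := c.formTrans_eq d hc hd g
    have h2 : formTrans c d (c.tot b, g.1) ∈ Lam1 m (fstL m N) := by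
      rw [← h1]
      exact Subtype.prop _
    rw [h1, subTrans, dif_pos h2]

/-- The coordinates `(x, y, p_A^α)` of `J¹*E`. -/
def dualAtlas : BundleAtlas E (Tot m N) (J1DualModel m N) (J1DualFiber m N π) where
  ι := AdaptedChart m N π
  base c := c.tot
  nonempty c := c.nonempty
  index y := (exists_adaptedChart m N π y).choose
  mem_index y := (exists_adaptedChart m N π y).choose_spec
  coord c y hy := dualEquiv (c.D hy) (c.Dbas hy) (c.fst_D hy)
  contDiffOn_base c d := c.contDiffOn_trans d
  contDiffOn_trans c d := by
    have key : ∀ e ∈ (c.tot.symm.trans d.tot).source, ∀ g : J1DualModel m N,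
        dualTrans c d (e, g.1) ∈ dualModel m N := by
      intro e he g
      obtain ⟨b, hc, hd, rfl⟩ := c.exists_eq d he
      refine removeP_mem ?_
      rw [← c.formTrans_eq d hc hd ⟨g.1, g.2.1⟩]
      exact Subtype.prop _
    refine ⟨subTrans _ _ (dualTrans c d),
      contDiffOn_subTrans _ _ _ (contDiffOn_dualTrans c d) key, fun b hc hd g => Subtype.ext ?_⟩
    have h1 := c.formTrans_eq d hc hd ⟨g.1, g.2.1⟩
    have h2 : dualTrans c d (c.tot b, g.1) ∈ dualModel m N := by
      refine removeP_mem ?_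
      rw [← c.formTrans_eq d hc hd ⟨g.1, g.2.1⟩]
      exact Subtype.prop _
    rw [subTrans, dif_pos h2]
    change _ = removeP (formTrans c d (c.tot b, g.1))
    rw [← h1]
    rfl

instance instTopologicalSpaceJ1 : TopologicalSpace (J1 m N π) :=
  (jetAtlas m N π).core.toTopologicalSpace

instance instChartedSpaceJ1 : ChartedSpace (Tot m N × JetModel m N) (J1 m N π) :=
  (jetAtlas m N π).core.toChartedSpace

instance instIsManifoldJ1 : IsManifold 𝓘(ℝ, Tot m N × JetModel m N) ∞ (J1 m N π) :=
  (jetAtlas m N π).isManifold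

instance instTopologicalSpaceMPi : TopologicalSpace (MPi m N π) :=
  (mpiAtlas m N π).core.toTopologicalSpace

instance instChartedSpaceMPi : ChartedSpace (Tot m N × MPiModel m N) (MPi m N π) :=
  (mpiAtlas m N π).core.toChartedSpace

instance instIsManifoldMPi : IsManifold 𝓘(ℝ, Tot m N × MPiModel m N) ∞ (MPi m N π) :=
  (mpiAtlas m N π).isManifold

instance instTopologicalSpaceJ1Dual : TopologicalSpace (J1Dual m N π) :=
  (dualAtlas m N π).core.toTopologicalSpace

instance instChartedSpaceJ1Dual : ChartedSpace (Tot m N × J1DualModel m N) (J1Dual m N π) :=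
  (dualAtlas m N π).core.toChartedSpace

instance instIsManifoldJ1Dual :
    IsManifold 𝓘(ℝ, Tot m N × J1DualModel m N) ∞ (J1Dual m N π) :=
  (dualAtlas m N π).isManifold

end Bundles

/-! ### Tangent maps, multivectors and differential forms

The tangent spaces of a manifold modelled on `H` are identified with `H`, as in Mathlib. -/

section Tangent

variable {H H₂ : Type*} [NormedAddCommGroup H] [NormedSpace ℝ H]
  [NormedAddCommGroup H₂] [NormedSpace ℝ H₂]
  {A B : Type*} [TopologicalSpace A] [ChartedSpace H A] [TopologicalSpace B] [ChartedSpace H₂ B]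

/-- The space `ΛᵐH` of `m`-vectors. -/
abbrev MV (m : ℕ) (H : Type*) [NormedAddCommGroup H] [NormedSpace ℝ H] : Type _ := ⋀[ℝ]^m H

/-- The space of alternating `k`-forms on `H`. -/
abbrev Alt (k : ℕ) (H : Type*) [NormedAddCommGroup H] [NormedSpace ℝ H] : Type _ :=
  H [⋀^Fin k]→L[ℝ] ℝ

/-- The space of linear maps from the model space of `M` to `H`. -/
abbrev Hom (m : ℕ) (H : Type*) [NormedAddCommGroup H] [NormedSpace ℝ H] : Type _ :=
  Base m →L[ℝ] H

variable (H H₂) in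
/-- The tangent map `T_a f : T_a A → T_{f(a)} B`. -/
def tmap (f : A → B) (a : A) : H →L[ℝ] H₂ :=
  mfderiv 𝓘(ℝ, H) 𝓘(ℝ, H₂) f a

/-- The map `Λᵐ F : ΛᵐH → ΛᵐH'` on `m`-vectors induced by a linear map `F`. -/
def lmap (m : ℕ) (F : H →L[ℝ] H₂) : MV m H →ₗ[ℝ] MV m H₂ :=
  exteriorPower.map m F.toLinearMap

/-- The value of an `m`-form on `m`-vectors. -/
def evalForm {m : ℕ} (α : Alt m H) : MV m H →ₗ[ℝ] ℝ :=
  exteriorPower.alternatingMapLinearEquiv α.toAlternatingMap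

/-- The subspace `𝒟(X) = {v | v ∧ X = 0}` associated with an `m`-vector `X`; for a non-zero
decomposable `X = v₁ ∧ … ∧ vₘ` this is the span of `v₁, …, vₘ`. -/
def distribution {m : ℕ} (X : MV m H) : Submodule ℝ H where
  carrier := {v | ExteriorAlgebra.ι ℝ v * (X : ExteriorAlgebra ℝ H) = 0}
  add_mem' {v w} hv hw := by
    change ExteriorAlgebra.ι ℝ (v + w) * (X : ExteriorAlgebra ℝ H) = 0
    rw [map_add, add_mul, hv, hw, add_zero]
  zero_mem' := by
    change ExteriorAlgebra.ι ℝ (0 : H) * (X : ExteriorAlgebra ℝ H) = 0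
    rw [map_zero, zero_mul]
  smul_mem' c v hv := by
    change ExteriorAlgebra.ι ℝ (c • v) * (X : ExteriorAlgebra ℝ H) = 0
    rw [map_smul, smul_mul_assoc, hv, smul_zero]

/-- The expression of a differential `k`-form `Θ` on `A` in the preferred chart at `a₀`. -/
def formInChart {k : ℕ} (Θ : A → Alt k H) (a₀ : A) (z : H) : Alt k H :=
  (Θ ((chartAt H a₀).symm z)).compContinuousLinearMap (tmap H H (chartAt H a₀).symm z)

/-- Smoothness of a differential form. -/
def IsSmoothForm {k : ℕ} (Θ : A → Alt k H) : Prop :=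
  ∀ a₀ : A, ContDiffOn ℝ ∞ (formInChart Θ a₀) (chartAt H a₀).target

/-- The exterior derivative of a differential form, computed at each point in the preferred chart
at this point; this chart also provides the identification of the tangent space with `H`. -/
def dForm {k : ℕ} (Θ : A → Alt k H) (a : A) : Alt (k + 1) H :=
  extDeriv (formInChart Θ a) (chartAt H a a)

/-- The pull-back of a differential form by a map. -/
def pullback {k : ℕ} (f : A → B) (Θ : B → Alt k H₂) (a : A) : Alt k H :=
  (Θ (f a)).compContinuousLinearMap (tmap H H₂ f a)

end Tangent

/-! ### Multivector fields, jet fields and connections along maps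

Here `H` is the model space of `A`, `ρ : B → M` is a projection to the base, `Φ : A → B` is a map and `ρ ∘ Φ : A → M` is the
corresponding projection of `A`.  -/

section Along

variable {m : ℕ} {M : Type*} [TopologicalSpace M] [ChartedSpace (Base m) M]
  (H : Type*) [NormedAddCommGroup H] [NormedSpace ℝ H] (H₂ : Type*)
  [NormedAddCommGroup H₂] [NormedSpace ℝ H₂]
  {A B : Type*} [TopologicalSpace A] [ChartedSpace H A] [TopologicalSpace B] [ChartedSpace H₂ B]

/-- A vector field `v` along `Φ : A → B`, i.e. `v(a) ∈ T_{Φ(a)}B`, which is smooth on `U`. -/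
def IsSmoothVFOn [IsManifold 𝓘(ℝ, H₂) ∞ B] (Φ : A → B) (v : A → H₂) (U : Set A) : Prop :=
  ContMDiffOn 𝓘(ℝ, H) 𝓘(ℝ, H₂).tangent ∞
    (fun a => (⟨Φ a, v a⟩ : TangentBundle 𝓘(ℝ, H₂) B)) U

/-- `K` is a non-vanishing, (smooth) locally decomposable and `ρ`-transverse `m`-vector field along
`Φ : A → B`, where `K(a) ∈ Λᵐ T_{Φ(a)}B`. -/
structure IsMVFieldAlong [IsManifold 𝓘(ℝ, H₂) ∞ B] (ρ : B → M) (Φ : A → B)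
    (K : A → MV m H₂) : Prop where
  ne_zero : ∀ a, K a ≠ 0
  locally_decomposable : ∀ a₀, ∃ U : Set A, IsOpen U ∧ a₀ ∈ U ∧ ∃ v : Fin m → A → H₂,
    (∀ i, IsSmoothVFOn H H₂ Φ (v i) U) ∧
    ∀ a ∈ U, K a = exteriorPower.ιMulti ℝ m fun i => v i a
  transverse : ∀ a, lmap m (tmap H₂ (Base m) ρ (Φ a)) (K a) ≠ 0

/-- `Y` is a (smooth) jet field along `Φ : A → B`: the value of `Y` at `a` is a jet at `Φ(a)` of
sections of `ρ : B → M`, i.e. a linear map `T_{ρ(Φ(a))}M → T_{Φ(a)}B` which is a right inverse of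
the tangent map of `ρ`. -/
structure IsJetFieldAlong [IsManifold 𝓘(ℝ, H₂) ∞ B] [IsManifold 𝓘(ℝ, Base m) ∞ M] (ρ : B → M)
    (Φ : A → B) (Y : A → Hom m H₂) : Prop where
  smooth : ∀ (V : Set M) (Z : M → Base m), IsOpen V →
    IsSmoothVFOn (Base m) (Base m) (id : M → M) Z V →
    IsSmoothVFOn H H₂ Φ (fun a => Y a (Z (ρ (Φ a)))) ((fun a => ρ (Φ a)) ⁻¹' V)
  right_inv : ∀ a, (tmap H₂ (Base m) ρ (Φ a)).comp (Y a) = ContinuousLinearMap.id ℝ (Base m)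

/-- `C` is a (smooth) Ehresmann connection form along `Φ : A → B`: the value of `C` at `a` is a
linear map `T_{ρ(Φ(a))}M → T_{Φ(a)}B`, i.e. a `ρ`-semibasic one-form with values in `TB`, such that
`C^* ξ = ξ` for every `ρ`-semibasic covector `ξ`. -/
structure IsConnectionAlong [IsManifold 𝓘(ℝ, H₂) ∞ B] [IsManifold 𝓘(ℝ, Base m) ∞ M] (ρ : B → M)
    (Φ : A → B) (C : A → Hom m H₂) : Prop where
  smooth : ∀ (V : Set M) (Z : M → Base m), IsOpen V →
    IsSmoothVFOn (Base m) (Base m) (id : M → M) Z V →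
    IsSmoothVFOn H H₂ Φ (fun a => C a (Z (ρ (Φ a)))) ((fun a => ρ (Φ a)) ⁻¹' V)
  semibasic : ∀ a (ξ : H₂ →L[ℝ] ℝ), (∀ w, (tmap H₂ (Base m) ρ (Φ a)) w = 0 → ξ w = 0) →
    (ξ.comp (C a)).comp (tmap H₂ (Base m) ρ (Φ a)) = ξ

/-- The jet field `Y` along `Φ` is associated with the class of the `m`-vector field `K`: they
define the same distribution. -/
def JetAssociated [IsManifold 𝓘(ℝ, H₂) ∞ B] [IsManifold 𝓘(ℝ, Base m) ∞ M] (ρ : B → M)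
    (Φ : A → B) (K : A → MV m H₂) (Y : A → Hom m H₂) : Prop :=
  IsJetFieldAlong H H₂ ρ Φ Y ∧ ∀ a, LinearMap.range (Y a).toLinearMap = distribution (K a)

/-- The connection form `C` along `Φ` is associated with the class of the `m`-vector field `K`:
they define the same distribution. -/
def ConnectionAssociated [IsManifold 𝓘(ℝ, H₂) ∞ B] [IsManifold 𝓘(ℝ, Base m) ∞ M] (ρ : B → M)
    (Φ : A → B) (K : A → MV m H₂) (C : A → Hom m H₂) : Prop :=
  IsConnectionAlong H H₂ ρ Φ C ∧ ∀ a, LinearMap.range (C a).toLinearMap = distribution (K a)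

variable (m) in
/-- `φ` is a smooth section of `p : A → M` on the set `U`. -/
structure IsSectionOn (p : A → M) (U : Set M) (φ : M → A) : Prop where
  smooth : ContMDiffOn 𝓘(ℝ, Base m) 𝓘(ℝ, H) ∞ φ U
  section_eq : ∀ x ∈ U, p (φ x) = x

/-- `φ` is an integral section, on the open set `U`, of the class of the `m`-vector field `K` along
`Φ : A → B`: there is a non-vanishing smooth function `f` such that, for all `x ∈ U` and all
`m`-vectors `u` at `x`, `Λᵐ T(Φ ∘ φ)(u) = vol(u) f(φ(x)) K(φ(x))`. -/
def IsIntegralMV (vol : M → Base m [⋀^Fin m]→L[ℝ] ℝ) (p : A → M) (Φ : A → B) (K : A → MV m H₂)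
    (U : Set M) (φ : M → A) : Prop :=
  IsSectionOn m H p U φ ∧ ∃ f : A → ℝ, ContMDiff 𝓘(ℝ, H) 𝓘(ℝ, ℝ) ∞ f ∧ (∀ a, f a ≠ 0) ∧
    ∀ x ∈ U, ∀ u : MV m (Base m),
      lmap m (tmap (Base m) H₂ (Φ ∘ φ) x) u = (evalForm (vol x) u * f (φ x)) • K (φ x)

/-- `φ` is an integral section, on the open set `U`, of the jet field `Y` along `Φ : A → B`: the
first jet of `Φ ∘ φ` is `Y ∘ φ`. -/
def IsIntegralJet (p : A → M) (Φ : A → B) (Y : A → Hom m H₂) (U : Set M) (φ : M → A) :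
    Prop :=
  IsSectionOn m H p U φ ∧ ∀ x ∈ U, (tmap (Base m) H₂ (Φ ∘ φ) x) = Y (φ x)

/-- `φ` is an integral section, on the open set `U`, of the connection form `C` along `Φ : A → B`:
the tangent spaces of the image of `Φ ∘ φ` are the horizontal subspaces. -/
def IsIntegralConn (p : A → M) (Φ : A → B) (C : A → Hom m H₂) (U : Set M) (φ : M → A) :
    Prop :=
  IsSectionOn m H p U φ ∧ ∀ x ∈ U,
    LinearMap.range (tmap (Base m) H₂ (Φ ∘ φ) x).toLinearMap =
      LinearMap.range (C (φ x)).toLinearMap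

/-- Integrability: through every point there is an integral section defined on an open set. Here
`Int U φ` means that `φ` is an integral section on `U`. -/
def Integrable (p : A → M) (Int : Set M → (M → A) → Prop) : Prop :=
  ∀ a, ∃ (U : Set M) (φ : M → A), IsOpen U ∧ p a ∈ U ∧ Int U φ ∧ φ (p a) = a

end Along

/-! ### Lagrangian and Hamiltonian field theory -/

/-- The model space of `J¹E`. -/
abbrev J1Model (m N : ℕ) : Type := Tot m N × JetModel m N

/-- The model space of `Mπ`. -/
abbrev MPiTot (m N : ℕ) : Type := Tot m N × MPiModel m N

/-- The model space of `J¹*E`. -/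
abbrev J1DualTot (m N : ℕ) : Type := Tot m N × J1DualModel m N

section Theory

universe u v

variable (m N : ℕ) {M : Type v} [TopologicalSpace M] [ChartedSpace (Base m) M]
  {E : Type u} [TopologicalSpace E] [ChartedSpace (Tot m N) E] (π : E → M)

variable {m N π}

/-- The projection `π¹ : J¹E → E`. -/
def J1.proj (a : J1 m N π) : E := a.1

/-- The projection `τ : Mπ → E`. -/
def MPi.proj (q : MPi m N π) : E := q.1

/-- The projection `τ¹ : J¹*E → E`. -/
def J1Dual.proj (q : J1Dual m N π) : E := q.1

/-- The jet `a ∈ J¹E` as a linear map `T_{π(y)}M → T_yE`, where `y = π¹(a)`. -/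
def J1.lin (a : J1 m N π) : Base m →L[ℝ] Tot m N := a.2.1

/-- The projection `μ : Mπ → J¹*E`. -/
def mu (q : MPi m N π) : J1Dual m N π := ⟨q.1, Quotient.mk _ q.2⟩

/-- The linear maps from `T_{π(y)}M` to the vertical subspace `V_yπ` of `T_yE`, i.e. the direction
of the affine space of the jets at `y`. -/
def vertHom (π : E → M) (y : E) : Submodule ℝ (Base m →L[ℝ] Tot m N) where
  carrier := {η | (dproj m N π y).comp η = 0}
  add_mem' {η ζ} hη hζ := by
    change (dproj m N π y).comp (η + ζ) = 0
    rw [ContinuousLinearMap.comp_add, hη, hζ, add_zero]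
  zero_mem' := ContinuousLinearMap.comp_zero _
  smul_mem' c η hη := by
    change (dproj m N π y).comp (c • η) = 0
    rw [ContinuousLinearMap.comp_smul, show (dproj m N π y).comp η = 0 from hη]
    ext1 x
    exact smul_zero (A := Base m) c

/-- The sum of a jet `a` at `y` and a vertical linear map `η`. -/
def J1.add (a : J1 m N π) (η : vertHom (m := m) (N := N) π a.proj) : J1 m N π :=
  ⟨a.1, a.2.1 + η.1, by
    have h : (dproj m N π a.1).comp η.1 = 0 := η.2
    rw [ContinuousLinearMap.comp_add, h, add_zero]
    exact a.2.2⟩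

/-- The derivative of a function `L` on `J¹E` along the fibres of `π¹ : J¹E → E`. -/
def fibreDeriv (L : J1 m N π → ℝ) (a : J1 m N π) :
    vertHom (m := m) (N := N) π a.proj →L[ℝ] ℝ :=
  fderiv ℝ (fun η => L (a.add η)) 0

/-- For `Z ∈ T_yE` and a coordinate `α`, the vertical linear map
`x ↦ x^α (Z - γ(T_yπ(Z)))`, where `γ` is the jet `a`. -/
def vertEnd (a : J1 m N π) (α : Fin m) : Tot m N →ₗ[ℝ] vertHom (m := m) (N := N) π a.proj where
  toFun Z := ⟨(EuclideanSpace.proj α : Base m →L[ℝ] ℝ).smulRight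
      (Z - a.lin (dproj m N π a.proj Z)), by
    ext1 x
    have h : dproj m N π a.proj (a.lin (dproj m N π a.proj Z)) = dproj m N π a.proj Z :=
      DFunLike.congr_fun a.2.2 _
    change dproj m N π a.proj (x α • (Z - a.lin (dproj m N π a.proj Z))) = 0
    rw [map_smul, map_sub, h, sub_self, smul_zero]⟩
  map_add' Z Z' := by
    refine Subtype.ext (ContinuousLinearMap.ext fun x => ?_)
    change x α • (Z + Z' - a.lin (dproj m N π a.proj (Z + Z'))) =
      x α • (Z - a.lin (dproj m N π a.proj Z)) + x α • (Z' - a.lin (dproj m N π a.proj Z'))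
    rw [map_add, map_add, ← smul_add]
    congr 1
    abel
  map_smul' c Z := by
    refine Subtype.ext (ContinuousLinearMap.ext fun x => ?_)
    change x α • (c • Z - a.lin (dproj m N π a.proj (c • Z))) =
      c • x α • (Z - a.lin (dproj m N π a.proj Z))
    rw [map_smul, map_smul, ← smul_sub, smul_comm]

/-- The linear map `T_yE → T_{π(y)}M`,
`Z ↦ (∂L/∂v^A_α) (Z^A - v^A_β Z^β) ∂/∂x^α`, at the jet `a = (x^α, y^A, v^A_α)`. -/
def momentumMap (L : J1 m N π → ℝ) (a : J1 m N π) : Tot m N →L[ℝ] Base m :=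
  LinearMap.toContinuousLinearMap
    (∑ α : Fin m, ((fibreDeriv L a).toLinearMap.comp (vertEnd a α)).smulRight
      (EuclideanSpace.single α (1 : ℝ) : Base m))

/-- The form `L π^*vol + (∂L/∂v^A_α) (dy^A - v^A_β dx^β) ∧ i(∂/∂x^α) π^*vol` on `T_yE` at the jet
`a = (x^α, y^A, v^A_α)`, which is the Poincaré–Cartan form of the Lagrangian density `L vol`,
considered as a form on `T_yE`. -/
def legendreForm (vol : M → Base m [⋀^Fin m]→L[ℝ] ℝ) (L : J1 m N π → ℝ) (a : J1 m N π) :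
    Tot m N [⋀^Fin m]→L[ℝ] ℝ :=
  L a • (vol (π a.proj)).compContinuousLinearMap (dproj m N π a.proj) +
    (vol (π a.proj)).fderivCompContinuousLinearMap (dproj m N π a.proj) (momentumMap L a)

lemma legendreForm_mem (vol : M → Base m [⋀^Fin m]→L[ℝ] ℝ) (L : J1 m N π → ℝ) (a : J1 m N π) :
    legendreForm vol L a ∈ Lam1 m (dproj m N π a.proj) := by
  intro v i j hij hi hj
  have h1 : (vol (π a.proj)) (fun k => dproj m N π a.proj (v k)) = 0 :=
    (vol (π a.proj)).map_coord_zero i hi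
  have h2 : ∀ k, (vol (π a.proj)) (fun l => Function.update
      (fun _ => dproj m N π a.proj) k (momentumMap L a) l (v l)) = 0 := by
    intro k
    by_cases hk : k = i
    · refine (vol (π a.proj)).map_coord_zero j ?_
      rw [Function.update_of_ne (by rw [hk]; exact hij.symm)]
      exact hj
    · refine (vol (π a.proj)).map_coord_zero i ?_
      rw [Function.update_of_ne (Ne.symm hk)]
      exact hi
  change L a • (vol (π a.proj)) (fun k => dproj m N π a.proj (v k)) +
    (vol (π a.proj)).fderivCompContinuousLinearMap (dproj m N π a.proj) (momentumMap L a) v = 0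
  rw [ContinuousAlternatingMap.fderivCompContinuousLinearMap_apply, h1, smul_zero, zero_add]
  exact Finset.sum_eq_zero fun k _ => h2 k

/-- The extended Legendre map of the Lagrangian density `L vol`; in coordinates with
`vol = dx¹ ∧ … ∧ dxᵐ`, `p_A^α = ∂L/∂v^A_α` and `p = L - v^A_α ∂L/∂v^A_α`. -/
def extLegendre (vol : M → Base m [⋀^Fin m]→L[ℝ] ℝ) (L : J1 m N π → ℝ) (a : J1 m N π) :
    MPi m N π :=
  ⟨a.1, legendreForm vol L a, legendreForm_mem vol L a⟩

/-- The restricted Legendre map of the Lagrangian density `L vol`. -/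
def legendre (vol : M → Base m [⋀^Fin m]→L[ℝ] ℝ) (L : J1 m N π → ℝ) (a : J1 m N π) :
    J1Dual m N π :=
  mu (extLegendre vol L a)

variable [IsManifold 𝓘(ℝ, Base m) ∞ M] [SmoothFiberBundle m N π]

/-- The Liouville form `Θ` of `Mπ`. -/
def liouville (q : MPi m N π) : Alt m (MPiTot m N) :=
  q.2.1.compContinuousLinearMap (tmap (MPiTot m N) (Tot m N) (MPi.proj (π := π)) q)

/-- The canonical `(m+1)`-form `Ω = -dΘ` of `Mπ`. -/
def canonicalForm (q : MPi m N π) : Alt (m + 1) (MPiTot m N) :=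
  -dForm (H := MPiTot m N) (liouville (π := π)) q

/-- `φ` is holonomic on the open set `U`: there it is the first jet `j¹φ₀` of a section `φ₀`
of `π`. -/
def IsHolonomicOn (U : Set M) (φ : M → J1 m N π) : Prop :=
  ∃ φ₀ : M → E, IsSectionOn m (Tot m N) π U φ₀ ∧
    ∀ x ∈ U, (φ x).proj = φ₀ x ∧ (φ x).lin = tmap (Base m) (Tot m N) φ₀ x

section SemiHolonomy

variable (H : Type*) [NormedAddCommGroup H] [NormedSpace ℝ H]
  {B : Type*} [TopologicalSpace B] [ChartedSpace H B] {S : Type*}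

/-- The `m`-vector field `K` along `Φ : S → B`, where `j : S → J¹E` and `τ : B → E`, is
semi-holonomic at `s`: the subspace of `TE` defined by the `m`-vector `Λᵐ Tτ (K(s))` is the
horizontal subspace of the jet `j(s)`. -/
def IsSemiHolonomicMV (j : S → J1 m N π) (τ : B → E) (Φ : S → B) (K : S → MV m H) (s : S) :
    Prop :=
  distribution (lmap m (tmap H (Tot m N) τ (Φ s)) (K s)) = LinearMap.range (j s).lin.toLinearMap

/-- The jet field (or connection form) `Y` along `Φ : S → B`, where `j : S → J¹E` and `τ : B → E`,
is semi-holonomic at `s`: the jet `Tτ ∘ Y(s)` is `j(s)`. -/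
def IsSemiHolonomicJet (j : S → J1 m N π) (τ : B → E) (Φ : S → B) (Y : S → Hom m H)
    (s : S) : Prop :=
  (tmap H (Tot m N) τ (Φ s)).comp (Y s) = (j s).lin

end SemiHolonomy

section Systems

variable (vol : M → Base m [⋀^Fin m]→L[ℝ] ℝ) (L : J1 m N π → ℝ)

/-- The Lagrangian density `L vol` is almost-regular: the image `𝒫` of the restricted Legendre map
`FL` is (the image under `j₀` of) a closed embedded submanifold `𝒫` of `J¹*E`, the map
`FL₀ : J¹E → 𝒫` induced by `FL` is a submersion, and the fibres of `FL` are connected. -/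
structure IsAlmostRegular (HQ : Type*) [NormedAddCommGroup HQ] [NormedSpace ℝ HQ]
    {Q : Type*} [TopologicalSpace Q] [ChartedSpace HQ Q]
    (j₀ : Q → J1Dual m N π) (FL₀ : J1 m N π → Q) : Prop where
  embedding : Manifold.IsSmoothEmbedding 𝓘(ℝ, HQ) 𝓘(ℝ, J1DualTot m N) ∞ j₀
  closed : IsClosed (range j₀)
  comp_eq : ∀ a, j₀ (FL₀ a) = legendre vol L a
  surjective : Function.Surjective FL₀
  submersion : Manifold.IsSubmersion 𝓘(ℝ, J1Model m N) 𝓘(ℝ, HQ) ∞ FL₀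
  connected : ∀ a, IsConnected (legendre vol L ⁻¹' {legendre vol L a})

/-- The map `ĥ : 𝒫 → Mπ` such that `ĥ ∘ FL₀` is the extended Legendre map; it is the composition
of the map `h̃ : 𝒫 → 𝒫̃` onto the image `𝒫̃` of the extended Legendre map with the inclusion of
`𝒫̃`. -/
def hMap {Q : Type*} {FL₀ : J1 m N π → Q} (hFL₀ : Function.Surjective FL₀) (q : Q) : MPi m N π :=
  extLegendre vol L (Function.surjInv hFL₀ q)

/-- `X` is a Hamilton–De Donder–Weyl `m`-vector field on the submanifold `P` of `𝒫`: a non-vanishing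
locally decomposable `m`-vector field of `𝒫` on `P`, transverse to the projection `ρ : 𝒫 → M`, such
that `i(X) ĥ^*Ω = 0` at the points of `P`. -/
structure IsHDW {HQ Q : Type*} [NormedAddCommGroup HQ] [NormedSpace ℝ HQ]
    [TopologicalSpace Q] [ChartedSpace HQ Q] [IsManifold 𝓘(ℝ, HQ) ∞ Q]
    (HP : Type*) [NormedAddCommGroup HP] [NormedSpace ℝ HP]
    {P : Type*} [TopologicalSpace P] [ChartedSpace HP P]
    (ρ : Q → M) (h : Q → MPi m N π) (jP : P → Q) (X : P → MV m HQ) : Prop where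
  structural : IsMVFieldAlong HP HQ ρ jP X
  field_eq : ∀ p (w : HQ), evalForm
    ((pullback (H := HQ) (H₂ := MPiTot m N) h canonicalForm (jP p)).curryLeft w) (X p) = 0

variable (HS : Type*) [NormedAddCommGroup HS] [NormedSpace ℝ HS]
  {S : Type*} [TopologicalSpace S] [ChartedSpace HS S] (jS : S → J1 m N π)

/-- The tangent map of the extended Legendre map at the jet `a`. -/
def tLegendre (a : J1 m N π) : J1Model m N →L[ℝ] MPiTot m N :=
  tmap (J1Model m N) (MPiTot m N) (extLegendre vol L) a

/-- Extended `m`-vector field operators on the submanifold `S` of `J¹E`: they satisfy the structural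
condition, the field equation `FL̃^*[i(K)(Ω ∘ FL̃)] = 0` and the semi-holonomy condition. -/
structure IsExtMVOperator (K : S → MV m (MPiTot m N)) : Prop where
  structural : IsMVFieldAlong HS (MPiTot m N) (π ∘ MPi.proj) (extLegendre vol L ∘ jS) K
  field_eq : ∀ s w, evalForm
    ((canonicalForm (extLegendre vol L (jS s))).curryLeft (tLegendre vol L (jS s) w)) (K s) = 0
  semiHolonomic : ∀ s, IsSemiHolonomicMV (MPiTot m N) jS MPi.proj (extLegendre vol L ∘ jS) K s

/-- Extended jet field operators on the submanifold `S` of `J¹E`: they satisfy the structural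
condition, the field equation `FL̃^*[i(Y)(Ω ∘ FL̃)] = 0` and the semi-holonomy condition. -/
structure IsExtJetOperator (Y : S → Hom m (MPiTot m N)) : Prop where
  structural : IsJetFieldAlong HS (MPiTot m N) (π ∘ MPi.proj) (extLegendre vol L ∘ jS) Y
  field_eq : ∀ s w, ((canonicalForm (extLegendre vol L (jS s))).curryLeft
    (tLegendre vol L (jS s) w)).compContinuousLinearMap (Y s) = 0
  semiHolonomic : ∀ s, IsSemiHolonomicJet (MPiTot m N) jS MPi.proj (extLegendre vol L ∘ jS) Y s

/-- Extended connection operators on the submanifold `S` of `J¹E`: they satisfy the structural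
condition, the field equation `FL̃^*[i(C)(Ω ∘ FL̃) - (m-1)(Ω ∘ FL̃)] = 0` and the semi-holonomy
condition. Here `i(C)` is the derivation that extends the transpose of the endomorphism
`C ∘ T(π ∘ τ)` of the tangent space of `Mπ`. -/
structure IsExtConnOperator (C : S → Hom m (MPiTot m N)) : Prop where
  structural : IsConnectionAlong HS (MPiTot m N) (π ∘ MPi.proj) (extLegendre vol L ∘ jS) C
  field_eq : ∀ s, ((canonicalForm (extLegendre vol L (jS s))).fderivCompContinuousLinearMap
      (ContinuousLinearMap.id ℝ _)
      ((C s).comp (tmap (MPiTot m N) (Base m) (π ∘ MPi.proj) (extLegendre vol L (jS s))))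
    - ((m : ℝ) - 1) • canonicalForm (extLegendre vol L (jS s))).compContinuousLinearMap
      (tLegendre vol L (jS s)) = 0
  semiHolonomic : ∀ s, IsSemiHolonomicJet (MPiTot m N) jS MPi.proj (extLegendre vol L ∘ jS) C s

variable {HS}

/-- The tangent map of `μ : Mπ → J¹*E` at the image of the jet `a` under the extended Legendre
map. -/
def tMu (a : J1 m N π) : MPiTot m N →L[ℝ] J1DualTot m N :=
  tmap (MPiTot m N) (J1DualTot m N) mu (extLegendre vol L a)

/-- The restricted `m`-vector field `Λᵐ Tμ ∘ K` defined by `K`. -/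
def restrictMV (K : S → MV m (MPiTot m N)) (s : S) : MV m (J1DualTot m N) :=
  lmap m (tMu vol L (jS s)) (K s)

/-- The restricted jet field (or connection form) `Tμ ∘ Y` defined by `Y`. -/
def restrictJet (Y : S → Hom m (MPiTot m N)) (s : S) : Hom m (J1DualTot m N) :=
  (tMu vol L (jS s)).comp (Y s)

/-- Restricted `m`-vector field operators on `S`: those of the form `Λᵐ Tμ ∘ K` for an extended
`m`-vector field operator `K`. -/
def IsRestrictedMVOperator (HS : Type*) [NormedAddCommGroup HS] [NormedSpace ℝ HS]
    [ChartedSpace HS S] (K₁ : S → MV m (J1DualTot m N)) : Prop :=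
  ∃ K, IsExtMVOperator vol L HS jS K ∧ K₁ = restrictMV vol L jS K

/-- Restricted jet field operators on `S`: those of the form `j¹μ ∘ Y` for an extended jet field
operator `Y`. -/
def IsRestrictedJetOperator (HS : Type*) [NormedAddCommGroup HS] [NormedSpace ℝ HS]
    [ChartedSpace HS S] (Y₁ : S → Hom m (J1DualTot m N)) : Prop :=
  ∃ Y, IsExtJetOperator vol L HS jS Y ∧ Y₁ = restrictJet vol L jS Y

/-- Restricted connection operators on `S`: those of the form `Tμ ∘ C` for an extended connection
operator `C`. -/
def IsRestrictedConnOperator (HS : Type*) [NormedAddCommGroup HS] [NormedSpace ℝ HS]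
    [ChartedSpace HS S] (C₁ : S → Hom m (J1DualTot m N)) : Prop :=
  ∃ C, IsExtConnOperator vol L HS jS C ∧ C₁ = restrictJet vol L jS C

end Systems

/-- The relations between integrability and integral sections of an object along a Legendre map on
the submanifold `S` of `J¹E` and of an object on the submanifold `P` of `𝒫`. Here `IntK U φ` and
`IntX U ψ` mean that `φ : U → S` and `ψ : U → P` are integral sections on `U` of these objects,
`SemiK s` means that the object on `S` is semi-holonomic at `s`, and `OpK` means that it is a field
operator. -/
structure IntegralCorrespondence {HS S HP P : Type*} [NormedAddCommGroup HS] [NormedSpace ℝ HS]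
    [TopologicalSpace S] [ChartedSpace HS S] [NormedAddCommGroup HP] [NormedSpace ℝ HP]
    [TopologicalSpace P] [ChartedSpace HP P] (jS : S → J1 m N π) (FLS : S → P)
    (pS : S → M) (pP : P → M) (IntK : Set M → (M → S) → Prop) (SemiK : S → Prop) (OpK : Prop)
    (IntX : Set M → (M → P) → Prop) : Prop where
  integrable_of_integrable : Integrable pS IntK → Integrable pP IntX
  integrable_iff : Manifold.IsSubmersion 𝓘(ℝ, HS) 𝓘(ℝ, HP) ∞ FLS →
    (Integrable pS IntK ↔ Integrable pP IntX)
  integral_map : ∀ (U : Set M) (φ : M → S), IsOpen U → IntK U φ → IntX U (FLS ∘ φ)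
  integral_lift : ∀ (U : Set M) (ψ : M → P) (φ : M → S), IsOpen U → IntX U ψ →
    ContMDiffOn 𝓘(ℝ, Base m) 𝓘(ℝ, HS) ∞ φ U → (∀ x ∈ U, FLS (φ x) = ψ x) →
      IntK U φ ∧ (IsHolonomicOn U (jS ∘ φ) ↔ ∀ x ∈ U, SemiK (φ x))
  holonomic_iff : Integrable pS IntK →
    ((∀ (U : Set M) (φ : M → S), IsOpen U → IntK U φ → IsHolonomicOn U (jS ∘ φ)) ↔
      ∀ s, SemiK s)
  operator_iff : OpK ↔ ∀ s, SemiK s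

end Theory

end FieldTheory

end

open FieldTheory

open scoped Manifold ContDiff Topology
open Set
open FieldTheory

set_option linter.unusedSectionVars false

namespace FieldTheory

/-! ### Decomposable multivectors -/

section Multivectors

variable {m n : ℕ} {H : Type*} [NormedAddCommGroup H] [NormedSpace ℝ H]
  {H₂ : Type*} [NormedAddCommGroup H₂] [NormedSpace ℝ H₂]
  {H₃ : Type*} [NormedAddCommGroup H₃] [NormedSpace ℝ H₃]

/-! All six cases reduce to one statement about jet fields. Transversality makes the distribution of
an object the image of a splitting of the tangent map to `M`, and a splitting is determined by its
image (`eq_of_range_eq`). Hence a connection form coincides with the associated jet field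
(`ConnectionAssociated.eq`), and a class of multivector fields has a representative given by the
multivectors of the horizontal subspaces, with a smooth non-vanishing coefficient
(`JetAssociated.exists_density`). Integral sections and semi-holonomy therefore agree for the three
kinds of object, and `IntegralCorrespondence.congr` transfers the result.

The geometric input is that `ĥ` is a smooth immersion with `ĥ ∘ FL₀ = FL̃` and `μ ∘ ĥ = j₀`. Along a
curve in a fibre of `FL` the point of `E` and the momenta `∂L/∂v` are constant, so the remaining
component `p = L - v ∂L/∂v` has zero derivative (`extLegendre_eq_of_curve`). As the fibres are
connected and `FL₀` is a submersion, `FL̃` is constant on them. Local sections of `FL₀` make `ĥ`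
smooth, and `j₀` being an immersion makes `ĥ` one.

The jet field along the Legendre map is then `TF ∘ Y_X ∘ FL_S`, with `F = ĥ` in the extended case
and `F = j₀` in the restricted one. Since `TF` is injective it can be cancelled: a section `φ` is
integral for `K` exactly when `FL_S ∘ φ` is integral for `X` (`isIntegralJet_comp_iff`). This gives
the passage of integral sections in both directions; when `FL_S` is a submersion its local sections
lift integral sections through any point. Projecting an integral section to `E` shows that its
underlying section of `π` has derivative `Tτ ∘ Y`, so holonomy means that this is the jet `j_S`
(`isHolonomicOn_iff`).

For field operators only semi-holonomy is at stake. The structural condition is inherited from `X`,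
and the field equation is automatic: `TFL̃` factors through `Tĥ`, so the pulled-back contraction is
a contraction of `ĥ^*Ω` with `X`. For connections the equation says that the pulled-back form is an
eigenvector, with eigenvalue `m - 1`, of the derivation defined by the horizontal projector. This
holds because the form can be non-zero only on tuples with exactly two vertical entries among `m +
1` (`sum_update_projector`). The restricted operators follow since `τ = τ¹ ∘ μ`. -/

lemma ιMulti_ne_zero_iff {v : Fin n → H} :
    exteriorPower.ιMulti ℝ n v ≠ 0 ↔ LinearIndependent ℝ v := by
  constructor
  · intro h
    by_contra hv
    exact h (AlternatingMap.map_linearDependent _ v hv)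
  · intro hv h
    -- The left inverse `g` sends `v i` to the `i`-th unit vector, so the determinant pulled back by
    -- `g` is an alternating form with value `1` on `v`; it factors through the exterior power.
    obtain ⟨g, hg⟩ := (Fintype.linearCombination ℝ v).exists_leftInverse_of_injective
      (LinearMap.ker_eq_bot.2 (linearIndependent_iff_injective_fintypeLinearCombination.1 hv))
    have h1 : ∀ i, g (v i) = Pi.single i 1 := by
      intro i
      have := LinearMap.congr_fun hg (Pi.single i 1)
      simpa using this
    have h2 := exteriorPower.alternatingMapLinearEquiv_apply_ιMulti
      ((Matrix.detRowAlternating (n := Fin n) (R := ℝ)).compLinearMap g) v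
    rw [h, map_zero] at h2
    have h3 : (fun i => g (v i)) = (1 : Matrix (Fin n) (Fin n) ℝ) := by
      funext i
      rw [h1]
      funext j
      simp [Matrix.one_apply, Pi.single_apply, eq_comm]
    change (0 : ℝ) = Matrix.det (fun i => g (v i)) at h2
    rw [h3, Matrix.det_one] at h2
    exact zero_ne_one h2

lemma lmap_ιMulti (F : H →L[ℝ] H₂) (v : Fin m → H) :
    lmap m F (exteriorPower.ιMulti ℝ m v) = exteriorPower.ιMulti ℝ m fun i => F (v i) :=
  exteriorPower.map_apply_ιMulti _ _

lemma lmap_lmap (F : H →L[ℝ] H₂) (F' : H₂ →L[ℝ] H₃) (X : MV m H) :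
    lmap m F' (lmap m F X) = lmap m (F'.comp F) X := by
  have := exteriorPower.map_comp (n := m) F.toLinearMap F'.toLinearMap
  exact (LinearMap.congr_fun this X).symm

lemma lmap_injective {F : H →L[ℝ] H₂} (hF : Function.Injective F) :
    Function.Injective (lmap m F) :=
  exteriorPower.map_injective_field hF

lemma evalForm_ιMulti (α : Alt m H) (v : Fin m → H) :
    evalForm α (exteriorPower.ιMulti ℝ m v) = α v :=
  exteriorPower.alternatingMapLinearEquiv_apply_ιMulti _ _

lemma evalForm_lmap (α : Alt m H₂) (F : H →L[ℝ] H₂) (X : MV m H) :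
    evalForm α (lmap m F X) = evalForm (α.compContinuousLinearMap F) X := by
  have : (evalForm α).comp (lmap m F) = evalForm (α.compContinuousLinearMap F) := by
    refine exteriorPower.linearMap_ext (AlternatingMap.ext fun v => ?_)
    change evalForm α (lmap m F (exteriorPower.ιMulti ℝ m v)) =
      evalForm (α.compContinuousLinearMap F) (exteriorPower.ιMulti ℝ m v)
    rw [lmap_ιMulti, evalForm_ιMulti, evalForm_ιMulti]
    rfl
  exact LinearMap.congr_fun this X

lemma distribution_smul {c : ℝ} (hc : c ≠ 0) (X : MV m H) :
    distribution (c • X) = distribution X := by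
  ext v
  change ExteriorAlgebra.ι ℝ v * ((c • X : MV m H) : ExteriorAlgebra ℝ H) = 0 ↔
    ExteriorAlgebra.ι ℝ v * (X : ExteriorAlgebra ℝ H) = 0
  rw [Submodule.coe_smul, mul_smul_comm, smul_eq_zero_iff_right hc]

/-- The distribution of a non-zero decomposable `m`-vector is the span of its factors. -/
lemma distribution_ιMulti {v : Fin m → H} (hv : LinearIndependent ℝ v) :
    distribution (exteriorPower.ιMulti ℝ m v) = Submodule.span ℝ (range v) := by
  ext x
  -- The product of `x` with `v₁ ∧ … ∧ vₘ` is again decomposable, so its vanishing is linear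
  -- dependence of `x, v₁, …, vₘ`.
  have h1 : x ∈ distribution (exteriorPower.ιMulti ℝ m v) ↔
      exteriorPower.ιMulti ℝ (m + 1) (Fin.cons x v : Fin (m + 1) → H) = 0 := by
    rw [← Subtype.coe_inj]
    change ExteriorAlgebra.ι ℝ x * (ExteriorAlgebra.ιMulti ℝ m v) = 0 ↔
      ExteriorAlgebra.ιMulti ℝ (m + 1) (Fin.cons x v : Fin (m + 1) → H) = 0
    rw [ExteriorAlgebra.ιMulti_succ_apply]
    rfl
  rw [h1, ← not_iff_not, ← ne_eq, ιMulti_ne_zero_iff, linearIndependent_finCons]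
  exact ⟨fun h => h.2, fun h => ⟨hv, h⟩⟩

/-- The `m`-vector `e₁ ∧ … ∧ eₘ` of the standard basis. -/
noncomputable def stdMV (m : ℕ) : MV m (Base m) :=
  exteriorPower.ιMulti ℝ m (EuclideanSpace.basisFun (Fin m) ℝ)

lemma stdMV_ne_zero : stdMV m ≠ 0 :=
  ιMulti_ne_zero_iff.2 (EuclideanSpace.basisFun (Fin m) ℝ).toBasis.linearIndependent

/-- The top exterior power of an `m`-dimensional space is a line. -/
lemma exists_eq_smul {k : MV m (Base m)} (hk : k ≠ 0) (u : MV m (Base m)) :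
    ∃ c : ℝ, u = c • k := by
  have h : Module.finrank ℝ (MV m (Base m)) = 1 := by
    rw [exteriorPower.finrank_eq, finrank_euclideanSpace_fin, Nat.choose_self]
  obtain ⟨c, hc⟩ := (finrank_eq_one_iff_of_nonzero' k hk).1 h u
  exact ⟨c, hc.symm⟩

lemma evalForm_ne_zero {α : Alt m (Base m)} (hα : α ≠ 0) {k : MV m (Base m)} (hk : k ≠ 0) :
    evalForm α k ≠ 0 := by
  intro h
  refine hα (ContinuousAlternatingMap.ext fun v => ?_)
  obtain ⟨c, hc⟩ := exists_eq_smul hk (exteriorPower.ιMulti ℝ m v)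
  rw [← evalForm_ιMulti, hc, map_smul, h, smul_zero]
  rfl

/-- Makes the proportionality factor explicit through a volume form, so that its smooth dependence
on a point can be proved. -/
lemma eq_smul_of_evalForm {α : Alt m (Base m)} (hα : α ≠ 0) {k : MV m (Base m)} (hk : k ≠ 0)
    (u : MV m (Base m)) : u = (evalForm α u * (evalForm α k)⁻¹) • k := by
  obtain ⟨c, rfl⟩ := exists_eq_smul hk u
  rw [map_smul, smul_eq_mul, mul_assoc, mul_inv_cancel₀ (evalForm_ne_zero hα hk), mul_one]

lemma injective_of_comp_eq_id {R : H →L[ℝ] H₂} {Y : H₂ →L[ℝ] H}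
    (h : R.comp Y = ContinuousLinearMap.id ℝ H₂) : Function.Injective Y :=
  Function.LeftInverse.injective (g := R) fun x => DFunLike.congr_fun h x

/-- A decomposable transverse `m`-vector is determined by its distribution and its projection. -/
lemma eq_lmap_of_range_eq {R : H →L[ℝ] Base m} {Y : Base m →L[ℝ] H} {X : MV m H}
    (hX : ∃ v, X = exteriorPower.ιMulti ℝ m v) (hX' : X ≠ 0)
    (hY : R.comp Y = ContinuousLinearMap.id ℝ (Base m))
    (h : LinearMap.range Y.toLinearMap = distribution X) : X = lmap m Y (lmap m R X) := by
  obtain ⟨v, rfl⟩ := hX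
  rw [distribution_ιMulti (ιMulti_ne_zero_iff.1 hX')] at h
  rw [lmap_ιMulti, lmap_ιMulti]
  congr 1
  funext i
  -- Each factor lies in the image of `Y`, where `Y ∘ R` is the identity.
  have hi : v i ∈ LinearMap.range Y.toLinearMap := by
    rw [h]
    exact Submodule.subset_span (mem_range_self i)
  obtain ⟨a, ha⟩ := hi
  have ha : Y a = v i := ha
  have h1 : R (Y a) = a := DFunLike.congr_fun hY a
  rw [← ha, h1]

/-- Up to a non-zero factor `k` is the wedge of the standard basis, whose images under the injective
`Y` are independent and span its range. -/
lemma distribution_lmap {Y : Base m →L[ℝ] H} (hY : Function.Injective Y) {k : MV m (Base m)}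
    (hk : k ≠ 0) : distribution (lmap m Y k) = LinearMap.range Y.toLinearMap := by
  obtain ⟨c, rfl⟩ := exists_eq_smul stdMV_ne_zero k
  have hc : c ≠ 0 := by
    rintro rfl
    exact hk (zero_smul _ _)
  have hb := (EuclideanSpace.basisFun (Fin m) ℝ).toBasis.linearIndependent
  have hs := (EuclideanSpace.basisFun (Fin m) ℝ).toBasis.span_eq
  rw [map_smul, distribution_smul hc, stdMV, lmap_ιMulti, distribution_ιMulti, LinearMap.range_eq_map]
  · rw [← hs, Submodule.map_span, ← range_comp]
    simp [Function.comp_def]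
  · have := hb.map' Y.toLinearMap (LinearMap.ker_eq_bot.2 hY)
    simpa [Function.comp_def] using this

/-- A splitting of `R` is the inverse of `R` restricted to the image of the splitting, hence is
determined by that image. -/
lemma eq_of_range_eq {R : H →L[ℝ] H₂} {Y Y' : H₂ →L[ℝ] H}
    (hY : R.comp Y = ContinuousLinearMap.id ℝ H₂)
    (hY' : R.comp Y' = ContinuousLinearMap.id ℝ H₂)
    (h : LinearMap.range Y.toLinearMap = LinearMap.range Y'.toLinearMap) : Y = Y' := by
  ext x
  have hx : Y x ∈ LinearMap.range Y'.toLinearMap := by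
    rw [← h]
    exact ⟨x, rfl⟩
  obtain ⟨z, hz⟩ := hx
  have hz : Y' z = Y x := hz
  have h1 : R (Y x) = x := DFunLike.congr_fun hY x
  have h2 : R (Y' z) = z := DFunLike.congr_fun hY' z
  rw [← hz, h2] at h1
  rw [← hz, h1]

/-- Two right inverses of a projection that induce proportional maps of `m`-vectors agree. -/
lemma eq_of_lmap_eq_smul {R : H →L[ℝ] Base m} {Y Y' : Base m →L[ℝ] H}
    {α : Alt m (Base m)} {X : MV m H} {c c' : ℝ}
    (hY : R.comp Y = ContinuousLinearMap.id ℝ (Base m))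
    (hY' : R.comp Y' = ContinuousLinearMap.id ℝ (Base m))
    (h : ∀ u, lmap m Y u = (evalForm α u * c) • X)
    (h' : ∀ u, lmap m Y' u = (evalForm α u * c') • X) : Y = Y' := by
  have key : ∀ (Z : Base m →L[ℝ] H) (d : ℝ), R.comp Z = ContinuousLinearMap.id ℝ (Base m) →
      (∀ u, lmap m Z u = (evalForm α u * d) • X) →
      LinearMap.range Z.toLinearMap = distribution X := by
    intro Z d hZ hd
    have hinj := injective_of_comp_eq_id hZ
    rw [← distribution_lmap hinj stdMV_ne_zero, hd]
    -- The coefficient cannot vanish: the injective map `Z` sends the non-zero standard `m`-vector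
    -- to a non-zero one.
    refine distribution_smul (fun h0 => ?_) X
    have h1 := hd (stdMV m)
    rw [h0, zero_smul] at h1
    exact stdMV_ne_zero (lmap_injective hinj (h1.trans (map_zero _).symm))
  exact eq_of_range_eq hY hY' ((key Y c hY h).trans (key Y' c' hY' h').symm)

/-- The components of `R` are themselves semibasic covectors; the condition applied to them says `R
∘ C ∘ R = R`, and `R` is onto. -/
lemma comp_eq_id_of_semibasic {R : H →L[ℝ] Base m} (hR : Function.Surjective R)
    {C : Base m →L[ℝ] H} (h : ∀ ξ : H →L[ℝ] ℝ, (∀ w, R w = 0 → ξ w = 0) → (ξ.comp C).comp R = ξ) :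
    R.comp C = ContinuousLinearMap.id ℝ (Base m) := by
  ext1 x
  obtain ⟨w, rfl⟩ := hR x
  ext i
  have := h ((EuclideanSpace.proj i : Base m →L[ℝ] ℝ).comp R) fun w hw => by simp [hw]
  exact DFunLike.congr_fun this w

end Multivectors

/-! ### Derivations defined by projectors -/

section Derivation

variable {n : ℕ} {H : Type*} [NormedAddCommGroup H] [NormedSpace ℝ H]

/-- Let `e` be a projector. If a form vanishes when at least `n` of its `n + 1` arguments belong to
the image of `e`, and also when three of them belong to the kernel of `e`, then it is an eigenvector,
with eigenvalue `n - 1`, of the derivation defined by `e`. -/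
lemma sum_update_projector (β : Alt (n + 1) H) (e : H →L[ℝ] H) (he : ∀ w, e (e w) = e w)
    (h1 : ∀ (w : Fin (n + 1) → H) (i : Fin (n + 1)), (∀ j, j ≠ i → e (w j) = w j) → β w = 0)
    (h2 : ∀ (w : Fin (n + 1) → H) (i j k : Fin (n + 1)), i ≠ j → i ≠ k → j ≠ k →
      e (w i) = 0 → e (w j) = 0 → e (w k) = 0 → β w = 0) :
    β.fderivCompContinuousLinearMap (ContinuousLinearMap.id ℝ H) e = ((n : ℝ) - 1) • β := by
  ext w
  set G := β.fderivCompContinuousLinearMap (ContinuousLinearMap.id ℝ H) e with hG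
  -- On a tuple with entries in the image of `e` over `s` and in its kernel elsewhere, the
  -- derivation multiplies the value by the cardinality of `s`. A non-zero value leaves at most two
  -- kernel entries by `h2` and at least two by `h1`, so this cardinality is `n + 1 - 2`.
  have key : ∀ (s : Finset (Fin (n + 1))) (a b : Fin (n + 1) → H), (∀ i, e (a i) = a i) →
      (∀ i, e (b i) = 0) → G (s.piecewise a b) = ((n : ℝ) - 1) * β (s.piecewise a b) := by
    intro s a b ha hb
    have hsum : G (s.piecewise a b) = (s.card : ℝ) * β (s.piecewise a b) := by
      rw [hG, ContinuousAlternatingMap.fderivCompContinuousLinearMap_apply]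
      have hterm : ∀ i, β (fun j => (Function.update (fun _ => ContinuousLinearMap.id ℝ H) i e j)
          (s.piecewise a b j)) = if i ∈ s then β (s.piecewise a b) else 0 := by
        intro i
        split_ifs with hi
        · congr 1
          funext j
          by_cases hj : j = i
          · subst hj
            simp [hi, ha]
          · simp [Function.update_of_ne hj]
        · refine β.map_coord_zero i ?_
          simp [hi, hb]
      rw [Finset.sum_congr rfl fun i _ => hterm i]
      simp
    rw [hsum]
    by_cases hβ : β (s.piecewise a b) = 0
    · rw [hβ, mul_zero, mul_zero]
    congr 1
    have hc : s.card + sᶜ.card = n + 1 := by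
      rw [Finset.card_add_card_compl, Fintype.card_fin]
    have hle : sᶜ.card ≤ 2 := by
      by_contra! hlt
      obtain ⟨i, j, k, hi, hj, hk, hij, hik, hjk⟩ := Finset.two_lt_card_iff.1 hlt
      rw [Finset.mem_compl] at hi hj hk
      refine hβ (h2 _ i j k hij hik hjk ?_ ?_ ?_) <;> simp [hi, hj, hk, hb]
    have hge : 1 < sᶜ.card := by
      by_contra! hlt
      refine hβ ?_
      rcases sᶜ.eq_empty_or_nonempty with h0 | ⟨i, hi⟩
      · have hs : ∀ j, j ∈ s := fun j => by
          rw [Finset.compl_eq_empty_iff] at h0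
          simp [h0]
        exact h1 _ 0 fun j _ => by simp [hs, ha]
      · refine h1 _ i fun j hj => ?_
        have hjs : j ∈ s := by
          by_contra hjs
          exact hj (Finset.card_le_one.1 hlt j (Finset.mem_compl.2 hjs) i hi)
        simp [hjs, ha]
    have : (s.card : ℝ) + 2 = n + 1 := by
      have : s.card + 2 = n + 1 := by omega
      exact_mod_cast this
    linarith
  -- Splitting every argument into its image and kernel parts and expanding by multilinearity
  -- reduces to the tuples just treated.
  have hw : w = (fun i => e (w i)) + fun i => (w i - e (w i)) := by
    funext i
    simp
  have e1 : ∀ γ : Alt (n + 1) H, γ w = ∑ s : Finset (Fin (n + 1)),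
      γ (s.piecewise (fun i => e (w i)) fun i => (w i - e (w i))) := by
    intro γ
    conv_lhs => rw [hw]
    exact γ.toMultilinearMap.map_add_univ _ _
  change G w = ((n : ℝ) - 1) * β w
  rw [e1 G, e1 β, Finset.mul_sum]
  exact Finset.sum_congr rfl fun s _ => key s _ _ (fun i => he _) fun i => by simp [he]

/-- A form on an `n`-dimensional space is determined by its value on the standard basis. -/
lemma alternating_ext_std {m : ℕ} {α β : Alt m (Base m)}
    (h : α (EuclideanSpace.basisFun (Fin m) ℝ) = β (EuclideanSpace.basisFun (Fin m) ℝ)) :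
    α = β := by
  have h1 : evalForm α (stdMV m) = evalForm β (stdMV m) := by
    rw [stdMV, evalForm_ιMulti, evalForm_ιMulti, h]
  ext v
  obtain ⟨c, hc⟩ := exists_eq_smul stdMV_ne_zero (exteriorPower.ιMulti ℝ m v)
  rw [← evalForm_ιMulti, ← evalForm_ιMulti, hc, map_smul, map_smul, h1]

end Derivation

/-! ### Tangent maps, submersions and immersions -/

section Manifolds

variable {H : Type*} [NormedAddCommGroup H] [NormedSpace ℝ H]
  {H₂ : Type*} [NormedAddCommGroup H₂] [NormedSpace ℝ H₂]
  {H₃ : Type*} [NormedAddCommGroup H₃] [NormedSpace ℝ H₃]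
  {A : Type*} [TopologicalSpace A] [ChartedSpace H A]
  {B : Type*} [TopologicalSpace B] [ChartedSpace H₂ B]
  {D : Type*} [TopologicalSpace D] [ChartedSpace H₃ D]

lemma tmap_comp {g : B → D} {f : A → B} (a : A) (hg : MDifferentiableAt 𝓘(ℝ, H₂) 𝓘(ℝ, H₃) g (f a))
    (hf : MDifferentiableAt 𝓘(ℝ, H) 𝓘(ℝ, H₂) f a) :
    tmap H H₃ (g ∘ f) a = (tmap H₂ H₃ g (f a)).comp (tmap H H₂ f a) :=
  mfderiv_comp a hg hf

lemma tmap_congr {f g : A → B} {a : A} (h : f =ᶠ[𝓝 a] g) : tmap H H₂ f a = tmap H H₂ g a :=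
  h.mfderiv_eq

lemma tmap_id (a : A) : tmap H H (id : A → A) a = ContinuousLinearMap.id ℝ H :=
  mfderiv_id

lemma tmap_eq_of_eqOn {f g : A → B} {U : Set A} (hU : IsOpen U) (h : ∀ x ∈ U, f x = g x) {a : A}
    (ha : a ∈ U) : tmap H H₂ f a = tmap H H₂ g a :=
  tmap_congr (by filter_upwards [hU.mem_nhds ha] with x hx using h x hx)

/-- A submersion has smooth local sections through every point. -/
lemma exists_section_of_isSubmersion {f : A → B}
    (hf : Manifold.IsSubmersion 𝓘(ℝ, H) 𝓘(ℝ, H₂) ∞ f) (a : A) :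
    ∃ (U : Set B) (σ : B → A), IsOpen U ∧ f a ∈ U ∧ σ (f a) = a ∧
      ContMDiffOn 𝓘(ℝ, H₂) 𝓘(ℝ, H) ∞ σ U ∧ ∀ b ∈ U, f (σ b) = b := by
  have h := hf.isSubmersionAt a
  set d := h.domChart with hd
  set c := h.codChart with hc
  have hw : ∀ z ∈ d.target, c (f (d.symm z)) = (h.equiv z).1 := by
    intro z hz
    have hz' : z ∈ (d.extend 𝓘(ℝ, H)).target := by simpa using hz
    simpa using h.writtenInCharts hz'
  have had : a ∈ d.source := h.mem_domChart_source
  have hac : f a ∈ c.source := h.mem_codChart_source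
  have hmaps : ∀ z ∈ d.source, f z ∈ c.source := fun z hz => h.source_subset_preimage_source hz
  have hfst : (h.equiv (d a)).1 = c (f a) := by
    rw [← hw _ (d.map_source had), d.left_inv had]
  -- In adapted charts the submersion is a linear projection; the section keeps the fibre coordinate
  -- frozen at its value `z₀` at `a`, so that it passes through `a`.
  set z₀ := (h.equiv (d a)).2 with hz₀
  let F : H₂ → H := fun x => h.equiv.symm (x, z₀)
  have hF : ContDiff ℝ ∞ F := h.equiv.symm.contDiff.comp (contDiff_id.prodMk contDiff_const)
  have hFa : F (c (f a)) = d a := by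
    change h.equiv.symm (c (f a), z₀) = d a
    rw [← hfst, hz₀]
    simp
  refine ⟨c.source ∩ c ⁻¹' (F ⁻¹' d.target), fun b => d.symm (F (c b)), ?_, ?_, ?_, ?_, ?_⟩
  · exact c.isOpen_inter_preimage (d.open_target.preimage hF.continuous)
  · refine ⟨hac, ?_⟩
    change F (c (f a)) ∈ d.target
    rw [hFa]
    exact d.map_source had
  · change d.symm (F (c (f a))) = a
    rw [hFa, d.left_inv had]
  · have h1 : ContMDiffOn 𝓘(ℝ, H₂) 𝓘(ℝ, H₂) ∞ c c.source :=
      contMDiffOn_of_mem_maximalAtlas h.codChart_mem_maximalAtlas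
    have h2 : ContMDiffOn 𝓘(ℝ, H) 𝓘(ℝ, H) ∞ d.symm d.target :=
      contMDiffOn_symm_of_mem_maximalAtlas h.domChart_mem_maximalAtlas
    exact h2.comp (hF.contMDiff.comp_contMDiffOn (h1.mono inter_subset_left)) fun b hb => hb.2
  · rintro b ⟨hb, hb'⟩
    have hb' : F (c b) ∈ d.target := hb'
    refine c.injOn (hmaps _ (d.map_target hb')) hb ?_
    rw [hw _ hb']
    simp [F]

/-- Nearby points of a fibre of a submersion can be joined by a smooth curve in the fibre. -/
lemma exists_curve_of_isSubmersion {f : A → B}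
    (hf : Manifold.IsSubmersion 𝓘(ℝ, H) 𝓘(ℝ, H₂) ∞ f) (a : A) :
    ∀ᶠ a' in 𝓝 a, f a' = f a → ∃ (I : Set ℝ) (γ : ℝ → A), IsOpen I ∧ Icc 0 1 ⊆ I ∧ γ 0 = a ∧
      γ 1 = a' ∧ ContMDiffOn 𝓘(ℝ, ℝ) 𝓘(ℝ, H) ∞ γ I ∧ ∀ t ∈ I, f (γ t) = f a := by
  have h := hf.isSubmersionAt a
  set d := h.domChart with hd
  set c := h.codChart with hc
  have hw : ∀ z ∈ d.target, c (f (d.symm z)) = (h.equiv z).1 := by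
    intro z hz
    have hz' : z ∈ (d.extend 𝓘(ℝ, H)).target := by simpa using hz
    simpa using h.writtenInCharts hz'
  have had : a ∈ d.source := h.mem_domChart_source
  have hac : f a ∈ c.source := h.mem_codChart_source
  have hmaps : ∀ z ∈ d.source, f z ∈ c.source := fun z hz => h.source_subset_preimage_source hz
  obtain ⟨r, hr, hball⟩ := Metric.isOpen_iff.1 d.open_target (d a) (d.map_source had)
  have hnhds : d.source ∩ d ⁻¹' Metric.ball (d a) r ∈ 𝓝 a :=
    (d.isOpen_inter_preimage Metric.isOpen_ball).mem_nhds ⟨had, Metric.mem_ball_self hr⟩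
  filter_upwards [hnhds] with a' ha' hfa
  have had' : a' ∈ d.source := ha'.1
  -- The curve is a segment in the domain chart. It stays in a ball inside the chart for `t` in the
  -- unit interval, and the linear projection representing `f` is constant on it because it agrees
  -- at the two ends.
  let ℓ : ℝ → H := fun t => d a + t • (d a' - d a)
  have hℓ : ContDiff ℝ ∞ ℓ := contDiff_const.add (contDiff_id.smul contDiff_const)
  have hfst : ∀ z ∈ d.source, (h.equiv (d z)).1 = c (f z) := fun z hz => by
    rw [← hw _ (d.map_source hz), d.left_inv hz]
  refine ⟨ℓ ⁻¹' d.target, fun t => d.symm (ℓ t), d.open_target.preimage hℓ.continuous, ?_, ?_, ?_,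
    ?_, ?_⟩
  · intro t ht
    refine hball ?_
    have := (convex_ball (d a) r).add_smul_sub_mem (Metric.mem_ball_self hr) ha'.2 ht
    exact this
  · simp [ℓ, d.left_inv had]
  · simp [ℓ, d.left_inv had']
  · have h2 : ContMDiffOn 𝓘(ℝ, H) 𝓘(ℝ, H) ∞ d.symm d.target :=
      contMDiffOn_symm_of_mem_maximalAtlas h.domChart_mem_maximalAtlas
    exact h2.comp hℓ.contMDiff.contMDiffOn fun t ht => ht
  · intro t ht
    have ht : ℓ t ∈ d.target := ht
    refine c.injOn (hmaps _ (d.map_target ht)) hac ?_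
    rw [hw _ ht]
    simp [ℓ, hfst a had, hfst a' had', hfa]

/-- The tangent maps of an immersion are injective. -/
lemma tmap_injective_of_isImmersion {f : A → B}
    (hf : Manifold.IsImmersion 𝓘(ℝ, H) 𝓘(ℝ, H₂) ∞ f) (a : A) :
    Function.Injective (tmap H H₂ f a) := by
  have h := hf.isImmersionAt a
  set d := h.domChart with hd
  set c := h.codChart with hc
  have hw : ∀ z ∈ d.target, c (f (d.symm z)) = h.equiv (z, 0) := by
    intro z hz
    have hz' : z ∈ (d.extend 𝓘(ℝ, H)).target := by simpa using hz
    simpa using h.writtenInCharts hz'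
  have had : a ∈ d.source := h.mem_domChart_source
  have hac : f a ∈ c.source := h.mem_codChart_source
  -- In adapted charts the immersion is `z ↦ (z, 0)`; forgetting the second component is a local
  -- left inverse, and the chain rule then gives a left inverse of the tangent map.
  let r : B → A := fun b => d.symm (h.equiv.symm (c b)).1
  have hr : ∀ z ∈ d.source, (r ∘ f) z = z := by
    intro z hz
    have := hw _ (d.map_source hz)
    rw [d.left_inv hz] at this
    simp [r, this, d.left_inv hz]
  have hra : (h.equiv.symm (c (f a))).1 = d a := by
    have := hw _ (d.map_source had)
    rw [d.left_inv had] at this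
    simp [this]
  have h1 : MDifferentiableAt 𝓘(ℝ, H₂) 𝓘(ℝ, H₂) c (f a) :=
    ((contMDiffOn_of_mem_maximalAtlas (I := 𝓘(ℝ, H₂)) (n := ∞) h.codChart_mem_maximalAtlas).contMDiffAt
      (c.open_source.mem_nhds hac)).mdifferentiableAt (by simp)
  have h2 : MDifferentiableAt 𝓘(ℝ, H) 𝓘(ℝ, H) d.symm (h.equiv.symm (c (f a))).1 := by
    rw [hra]
    exact ((contMDiffOn_symm_of_mem_maximalAtlas (I := 𝓘(ℝ, H)) (n := ∞)
      h.domChart_mem_maximalAtlas).contMDiffAt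
      (d.open_target.mem_nhds (d.map_source had))).mdifferentiableAt (by simp)
  have h3 : MDifferentiableAt 𝓘(ℝ, H₂) 𝓘(ℝ, H) (fun y => (h.equiv.symm y).1) (c (f a)) :=
    (differentiableAt_fst.comp _ h.equiv.symm.differentiableAt).mdifferentiableAt
  have h4 : MDifferentiableAt 𝓘(ℝ, H₂) 𝓘(ℝ, H) r (f a) :=
    h2.comp (f a) (h3.comp (f a) h1)
  have h5 : MDifferentiableAt 𝓘(ℝ, H) 𝓘(ℝ, H₂) f a := hf.contMDiff.mdifferentiable (by simp) a
  have h6 := tmap_comp a h4 h5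
  rw [tmap_eq_of_eqOn d.open_source (g := id) hr had, tmap_id] at h6
  exact injective_of_comp_eq_id h6.symm

end Manifolds

/-! ### Smooth vector fields along maps -/

section VectorFields

variable {H : Type*} [NormedAddCommGroup H] [NormedSpace ℝ H]
  {H₂ : Type*} [NormedAddCommGroup H₂] [NormedSpace ℝ H₂]
  {H₃ : Type*} [NormedAddCommGroup H₃] [NormedSpace ℝ H₃]
  {A : Type*} [TopologicalSpace A] [ChartedSpace H A]
  {B : Type*} [TopologicalSpace B] [ChartedSpace H₂ B] [IsManifold 𝓘(ℝ, H₂) ∞ B]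
  {D : Type*} [TopologicalSpace D] [ChartedSpace H₃ D] [IsManifold 𝓘(ℝ, H₃) ∞ D]

lemma IsSmoothVFOn.map {Φ : A → B} {v : A → H₂} {U : Set A} (h : IsSmoothVFOn H H₂ Φ v U)
    {F : B → D} (hF : ContMDiff 𝓘(ℝ, H₂) 𝓘(ℝ, H₃) ∞ F) :
    IsSmoothVFOn H H₃ (F ∘ Φ) (fun a => tmap H₂ H₃ F (Φ a) (v a)) U :=
  (hF.contMDiff_tangentMap (m := ∞) (by simp)).comp_contMDiffOn h

lemma IsSmoothVFOn.comp {A' : Type*} {H' : Type*} [NormedAddCommGroup H'] [NormedSpace ℝ H']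
    [TopologicalSpace A'] [ChartedSpace H' A'] {Φ : A → B} {v : A → H₂} {U : Set A}
    (h : IsSmoothVFOn H H₂ Φ v U) {ψ : A' → A} (hψ : ContMDiff 𝓘(ℝ, H') 𝓘(ℝ, H) ∞ ψ) :
    IsSmoothVFOn H' H₂ (Φ ∘ ψ) (fun a => v (ψ a)) (ψ ⁻¹' U) :=
  ContMDiffOn.comp h hψ.contMDiffOn fun _ ha => ha

/-- Trivialisations of the tangent bundle are linear on fibres, so only the fibre component changes,
and it is multiplied by `f`. -/
lemma IsSmoothVFOn.smul {Φ : A → B} {v : A → H₂} {U : Set A} (h : IsSmoothVFOn H H₂ Φ v U)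
    {f : A → ℝ} (hf : ContMDiff 𝓘(ℝ, H) 𝓘(ℝ, ℝ) ∞ f) :
    IsSmoothVFOn H H₂ Φ (fun a => f a • v a) U := by
  intro a ha
  have h1 := Bundle.contMDiffWithinAt_totalSpace.1 (h a ha)
  refine Bundle.contMDiffWithinAt_totalSpace.2 ⟨h1.1, ?_⟩
  have h2 := (hf.contMDiffAt.contMDiffWithinAt (x := a) (s := U)).smul h1.2
  have hcont : ContinuousWithinAt Φ U a := h1.1.continuousWithinAt
  have hev : ∀ᶠ b in 𝓝[U] a, Φ b ∈ (chartAt H₂ (Φ a)).source :=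
    hcont ((chartAt H₂ (Φ a)).open_source.mem_nhds (mem_chart_source _ _))
  refine h2.congr_of_eventuallyEq ?_ ?_
  · filter_upwards [hev] with b hb
    exact ((trivializationAt H₂ (TangentSpace 𝓘(ℝ, H₂)) (Φ a)).linear ℝ
      (by simpa using hb)).map_smul (f b) (v b)
  · exact ((trivializationAt H₂ (TangentSpace 𝓘(ℝ, H₂)) (Φ a)).linear ℝ
      (by simp)).map_smul (f a) (v a)

/-- Near `a` both the form and the vectors are read in the preferred chart at `Φ a`, where the value
is a smooth function of the point and the vector components. It is needed for the smoothness of the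
coefficient relating a multivector field to its jet field. -/
lemma contMDiffAt_apply_form {m : ℕ} [FiniteDimensional ℝ H₂] {vol : B → Alt m H₂}
    (hvol : IsSmoothForm vol) {Φ : A → B} {v : Fin m → A → H₂} {U : Set A} (hU : IsOpen U)
    (hv : ∀ i, IsSmoothVFOn H H₂ Φ (v i) U) (hΦ : ContMDiff 𝓘(ℝ, H) 𝓘(ℝ, H₂) ∞ Φ) {a : A}
    (ha : a ∈ U) :
    ContMDiffAt 𝓘(ℝ, H) 𝓘(ℝ, ℝ) ∞ (fun b => vol (Φ b) fun i => v i b) a := by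
  let c := chartAt H₂ (Φ a)
  let u : Fin m → A → H₂ := fun i b =>
    (trivializationAt H₂ (TangentSpace 𝓘(ℝ, H₂)) (Φ a) ⟨Φ b, v i b⟩).2
  have hu : ∀ i, ContMDiffAt 𝓘(ℝ, H) 𝓘(ℝ, H₂) ∞ (u i) a := fun i =>
    (Bundle.contMDiffAt_totalSpace.1 ((hv i).contMDiffAt (hU.mem_nhds ha))).2
  let W : H₂ → (Fin m → H₂) → ℝ := fun z w => formInChart vol (Φ a) z w
  have hW : ∀ p ∈ c.target ×ˢ (univ : Set (Fin m → H₂)),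
      ContDiffAt ℝ ∞ (fun p : H₂ × (Fin m → H₂) => W p.1 p.2) p := by
    have h1 : ContDiffOn ℝ ∞ (fun p : H₂ × (Fin m → H₂) => formInChart vol (Φ a) p.1)
        (c.target ×ˢ univ) := (hvol (Φ a)).comp contDiff_fst.contDiffOn fun p hp => hp.1
    -- Evaluation on vectors `w` is pull-back by the linear map sending the `i`-th basis vector to
    -- `w i`, followed by evaluation on the standard basis; this reduces to the smoothness of
    -- pull-backs.
    have h2 : ContDiffOn ℝ ∞ (fun p : H₂ × (Fin m → H₂) =>
        ∑ i, (EuclideanSpace.proj i : Base m →L[ℝ] ℝ).smulRight (p.2 i)) (c.target ×ˢ univ) := by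
      refine ContDiffOn.sum fun i _ => ?_
      have : ContDiff ℝ ∞ (fun p : H₂ × (Fin m → H₂) => p.2 i) :=
        (contDiff_apply ℝ H₂ i).comp contDiff_snd
      exact (contDiff_const.smulRight this).contDiffOn
    have h3 := contDiffOn_compContinuousLinearMap h1 h2
    have h4 := (ContinuousAlternatingMap.apply ℝ (Base m) ℝ
      (fun i : Fin m => EuclideanSpace.single i (1 : ℝ))).contDiff.comp_contDiffOn h3 (n := ∞)
    intro p hp
    refine (h4.congr ?_).contDiffAt ((c.open_target.prod isOpen_univ).mem_nhds hp)
    intro q _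
    change formInChart vol (Φ a) q.1 q.2 = formInChart vol (Φ a) q.1 fun k =>
      (∑ i, (EuclideanSpace.proj i : Base m →L[ℝ] ℝ).smulRight (q.2 i))
        (EuclideanSpace.single k (1 : ℝ))
    congr 1
    funext k
    simp [sum_apply]
  have h1 : ContMDiffAt 𝓘(ℝ, H) 𝓘(ℝ, H₂) ∞ (fun b => c (Φ b)) a :=
    (contMDiffAt_of_mem_maximalAtlas (IsManifold.chart_mem_maximalAtlas _)
      (mem_chart_source _ _)).comp a hΦ.contMDiffAt
  have h2 : ContMDiffAt 𝓘(ℝ, H) 𝓘(ℝ, H₂ × (Fin m → H₂)) ∞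
      (fun b => (c (Φ b), fun i => u i b)) a :=
    h1.prodMk_space (contMDiffAt_pi_space.2 hu)
  have h3 : ContMDiffAt 𝓘(ℝ, H) 𝓘(ℝ, ℝ) ∞ (fun b => W (c (Φ b)) fun i => u i b) a :=
    (hW (c (Φ a), fun i => u i a) ⟨mem_chart_target _ _, trivial⟩).contMDiffAt.comp a h2
  refine h3.congr_of_eventuallyEq ?_
  filter_upwards [hΦ.continuous.continuousAt (c.open_source.mem_nhds (mem_chart_source _ _))]
    with b hb
  have hb : Φ b ∈ c.source := hb
  change vol (Φ b) _ = vol (c.symm (c (Φ b))) (fun i => tmap H₂ H₂ c.symm (c (Φ b)) (u i b))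
  rw [c.left_inv hb]
  congr 1
  funext i
  -- The trivialisation at `Φ a` acts on vectors as the derivative of the chart, which cancels the
  -- derivative of the inverse chart in the local expression of the form.
  have e1 : u i b = tmap H₂ H₂ c (Φ b) (v i b) := by
    have hb' : Φ b ∈ (trivializationAt H₂ (TangentSpace 𝓘(ℝ, H₂)) (Φ a)).baseSet := by simpa using hb
    have h4 := TangentBundle.continuousLinearMapAt_trivializationAt (I := 𝓘(ℝ, H₂)) hb
    have h5 := DFunLike.congr_fun h4 (v i b)
    have h6 := (trivializationAt H₂ (TangentSpace 𝓘(ℝ, H₂)) (Φ a)).coe_linearMapAt_of_mem (R := ℝ) hb'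
    refine (congrFun h6 (v i b)).symm.trans (h5.trans ?_)
    simp only [mfld_simps]
    rfl
  have e2 := tmap_comp (H := H₂) (H₂ := H₂) (H₃ := H₂) (g := c.symm) (f := c) (Φ b)
    (mdifferentiableAt_atlas_symm (chart_mem_atlas _ _) (c.map_source hb))
    (mdifferentiableAt_atlas (chart_mem_atlas _ _) hb)
  rw [tmap_eq_of_eqOn (f := c.symm ∘ c) (g := id) c.open_source (fun x hx => c.left_inv hx) hb, tmap_id] at e2
  rw [e1]
  exact DFunLike.congr_fun e2 (v i b)

end VectorFields

/-! ### The Poincaré–Cartan form in coordinates -/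

section LocalForm

variable {m N : ℕ}

/-- The coordinate expression `(Z, ℓ, v) ↦ ℓ_A^α (Z^A - v^A_β Z^β) ∂/∂x^α` of the momentum map. -/
noncomputable def localMomentum (ℓ : JetModel m N →L[ℝ] ℝ) (v : JetModel m N) :
    Tot m N →L[ℝ] Base m :=
  ∑ α : Fin m, ((ℓ.comp (ContinuousLinearMap.smulRightL ℝ (Base m) (Fib N)
    (EuclideanSpace.proj α : Base m →L[ℝ] ℝ))).comp
      (ContinuousLinearMap.snd ℝ (Base m) (Fib N) - v.comp (fstL m N))).smulRight
    (EuclideanSpace.single α (1 : ℝ) : Base m)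

lemma localMomentum_apply (ℓ : JetModel m N →L[ℝ] ℝ) (v : JetModel m N) (Z : Tot m N)
    (α : Fin m) : localMomentum ℓ v Z α =
      ℓ ((EuclideanSpace.proj α : Base m →L[ℝ] ℝ).smulRight (Z.2 - v Z.1)) := by
  rw [localMomentum, sum_apply]
  have : ∀ β : Fin m, (((ℓ.comp (ContinuousLinearMap.smulRightL ℝ (Base m) (Fib N)
      (EuclideanSpace.proj β : Base m →L[ℝ] ℝ))).comp
      (ContinuousLinearMap.snd ℝ (Base m) (Fib N) - v.comp (fstL m N))).smulRight
      (EuclideanSpace.single β (1 : ℝ) : Base m)) Z =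
      ℓ ((EuclideanSpace.proj β : Base m →L[ℝ] ℝ).smulRight (Z.2 - v Z.1)) •
        (EuclideanSpace.single β (1 : ℝ) : Base m) := fun β => rfl
  have hs : ∀ c : Fin m → ℝ, (∑ β, c β • (EuclideanSpace.single β (1 : ℝ) : Base m)) α = c α := by
    intro c
    simp [Pi.single_apply]
  rw [Finset.sum_congr rfl fun β _ => this β]
  exact hs _

/-- The coordinate expression of the Poincaré–Cartan form. -/
noncomputable def localForm (θ : Alt m (Base m)) (l : ℝ) (ℓ : JetModel m N →L[ℝ] ℝ)
    (v : JetModel m N) : Alt m (Tot m N) :=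
  l • θ.compContinuousLinearMap (fstL m N) +
    θ.fderivCompContinuousLinearMap (fstL m N) (localMomentum ℓ v)

lemma localForm_apply (θ : Alt m (Base m)) (l : ℝ) (ℓ : JetModel m N →L[ℝ] ℝ)
    (v : JetModel m N) (w : Fin m → Tot m N) :
    localForm θ l ℓ v w = l * θ (fun i => (w i).1) +
      ∑ k, θ (Function.update (fun i => (w i).1) k (localMomentum ℓ v (w k))) := by
  change l • θ (fun i => (w i).1) + θ.fderivCompContinuousLinearMap _ _ w = _
  rw [ContinuousAlternatingMap.fderivCompContinuousLinearMap_apply]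
  congr 1
  refine Finset.sum_congr rfl fun k _ => ?_
  congr 1
  funext j
  by_cases h : j = k
  · subst h
    simp
  · simp [Function.update_of_ne h]

/-- After expanding `u` in the basis, every term except the `k`-th repeats a basis vector. -/
lemma update_basisFun_apply (θ : Alt m (Base m)) (k : Fin m) (u : Base m) :
    θ (Function.update (EuclideanSpace.basisFun (Fin m) ℝ) k u) =
      u k * θ (EuclideanSpace.basisFun (Fin m) ℝ) := by
  have hu : u = ∑ j, u j • EuclideanSpace.basisFun (Fin m) ℝ j := by
    conv_lhs => rw [← (EuclideanSpace.basisFun (Fin m) ℝ).sum_repr u]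
    simp
  have hs := θ.toAlternatingMap.map_update_sum Finset.univ k
    (fun j => u j • EuclideanSpace.basisFun (Fin m) ℝ j) (EuclideanSpace.basisFun (Fin m) ℝ)
  rw [← hu] at hs
  refine hs.trans ?_
  change ∑ j, θ (Function.update (EuclideanSpace.basisFun (Fin m) ℝ) k
    (u j • EuclideanSpace.basisFun (Fin m) ℝ j)) = _
  rw [Finset.sum_eq_single k]
  · rw [θ.map_update_smul, Function.update_eq_self]
    rfl
  · intro j _ hj
    rw [θ.map_update_smul]
    refine smul_eq_zero_of_right _ (θ.map_eq_zero_of_eq _ (i := k) (j := j) ?_ hj.symm)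
    rw [Function.update_self, Function.update_of_ne hj]
  · simp

lemma sum_smulRight_eq {F : Type*} [NormedAddCommGroup F] [NormedSpace ℝ F] (v : Base m →L[ℝ] F) :
    ∑ k, (EuclideanSpace.proj k : Base m →L[ℝ] ℝ).smulRight
      (v (EuclideanSpace.basisFun (Fin m) ℝ k)) = v := by
  ext x
  rw [sum_apply]
  conv_rhs => rw [← (EuclideanSpace.basisFun (Fin m) ℝ).sum_repr x, map_sum]
  simp

/-- The component `p = l - ℓ_A^α v^A_α`. -/
lemma localForm_comp_inl (θ : Alt m (Base m)) (l : ℝ) (ℓ : JetModel m N →L[ℝ] ℝ)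
    (v : JetModel m N) :
    (localForm θ l ℓ v).compContinuousLinearMap (inlL m N) = (l - ℓ v) • θ := by
  refine alternating_ext_std ?_
  change localForm θ l ℓ v (fun i => inlL m N (EuclideanSpace.basisFun (Fin m) ℝ i)) =
    (l - ℓ v) * θ (EuclideanSpace.basisFun (Fin m) ℝ)
  rw [localForm_apply]
  -- On the horizontal vector `(e_k, 0)` the difference `Z^A - v^A_β Z^β` is `-v(e_k)`, and only the
  -- `k`-th component of the momentum survives in slot `k`. The sum over `k` is then `-ℓ(v)`.
  have h : ∀ k, θ (Function.update (fun i => (inlL m N (EuclideanSpace.basisFun (Fin m) ℝ i)).1) k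
      (localMomentum ℓ v (inlL m N (EuclideanSpace.basisFun (Fin m) ℝ k)))) =
      - ℓ ((EuclideanSpace.proj k : Base m →L[ℝ] ℝ).smulRight
        (v (EuclideanSpace.basisFun (Fin m) ℝ k))) * θ (EuclideanSpace.basisFun (Fin m) ℝ) := by
    intro k
    rw [← map_neg]
    refine (update_basisFun_apply θ k _).trans ?_
    rw [localMomentum_apply]
    congr 2
    ext x
    simp
  rw [Finset.sum_congr rfl fun k _ => h k, ← Finset.sum_mul, Finset.sum_neg_distrib, ← map_sum,
    sum_smulRight_eq]
  change l * θ (EuclideanSpace.basisFun (Fin m) ℝ) + _ = _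
  ring

/-- The momenta are determined by the class of the Poincaré–Cartan form modulo semibasic forms. -/
lemma eq_of_removeP_localForm_eq {θ : Alt m (Base m)} (hθ : θ ≠ 0) {l l' : ℝ}
    {ℓ ℓ' : JetModel m N →L[ℝ] ℝ} {v v' : JetModel m N}
    (h : removeP (localForm θ l ℓ v) = removeP (localForm θ l' ℓ' v')) : ℓ = ℓ' := by
  have hθ' : θ (EuclideanSpace.basisFun (Fin m) ℝ) ≠ 0 := by
    intro h0
    exact hθ (alternating_ext_std h0)
  -- Replacing the `k`-th horizontal basis vector by the vertical vector `z` isolates the momentum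
  -- on the rank-one map `dx^k ⊗ z`: the semibasic parts vanish on a vertical entry. These maps
  -- span, so `ℓ` is recovered.
  have key : ∀ (l : ℝ) (ℓ : JetModel m N →L[ℝ] ℝ) (v : JetModel m N) (k : Fin m) (z : Fib N),
      removeP (localForm θ l ℓ v) (Function.update
        (fun i => inlL m N (EuclideanSpace.basisFun (Fin m) ℝ i)) k ((0 : Base m), z)) =
      ℓ ((EuclideanSpace.proj k : Base m →L[ℝ] ℝ).smulRight z) *
        θ (EuclideanSpace.basisFun (Fin m) ℝ) := by
    intro l ℓ v k z
    set w : Fin m → Tot m N := Function.update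
        (fun i => inlL m N (EuclideanSpace.basisFun (Fin m) ℝ i)) k ((0 : Base m), z) with hw
    have hwk : w k = (0, z) := by simp [hw]
    have h1 : localForm θ l ℓ v (fun i => inlL m N (fstL m N (w i))) = 0 := by
      refine (localForm θ l ℓ v).map_coord_zero k ?_
      simp [hwk]
    change localForm θ l ℓ v w - localForm θ l ℓ v (fun i => inlL m N (fstL m N (w i))) = _
    have h2 : (fun i => (w i).1) = Function.update (EuclideanSpace.basisFun (Fin m) ℝ) k 0 := by
      funext i
      by_cases hi : i = k
      · subst hi
        simp [hwk]
      · simp [hw, Function.update_of_ne hi]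
    rw [h1, sub_zero, localForm_apply, h2, Finset.sum_eq_single k]
    · rw [θ.map_coord_zero k (by simp), mul_zero, zero_add, Function.update_idem,
        update_basisFun_apply, localMomentum_apply, hwk]
      simp
    · intro j _ hj
      refine θ.map_coord_zero k ?_
      rw [Function.update_of_ne hj.symm]
      simp
    · simp
  have h3 : ∀ (k : Fin m) (z : Fib N), ℓ ((EuclideanSpace.proj k : Base m →L[ℝ] ℝ).smulRight z) =
      ℓ' ((EuclideanSpace.proj k : Base m →L[ℝ] ℝ).smulRight z) := by
    intro k z
    refine mul_right_cancel₀ hθ' ?_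
    rw [← key l ℓ v, ← key l' ℓ' v', h]
  refine ContinuousLinearMap.ext fun u => ?_
  rw [← sum_smulRight_eq u, map_sum, map_sum]
  exact Finset.sum_congr rfl fun k _ => h3 k _

variable {X : Type*} [NormedAddCommGroup X] [NormedSpace ℝ X]

lemma contDiffOn_localForm {s : Set X} {θ : X → Alt m (Base m)} {l : X → ℝ}
    {ℓ : X → (JetModel m N →L[ℝ] ℝ)} {v : X → JetModel m N} (hθ : ContDiffOn ℝ ∞ θ s)
    (hl : ContDiffOn ℝ ∞ l s) (hℓ : ContDiffOn ℝ ∞ ℓ s) (hv : ContDiffOn ℝ ∞ v s) :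
    ContDiffOn ℝ ∞ (fun x => localForm (θ x) (l x) (ℓ x) (v x)) s := by
  have h1 : ContDiffOn ℝ ∞ (fun x => localMomentum (ℓ x) (v x)) s := by
    refine ContDiffOn.sum fun α _ => ?_
    have e1 := hℓ.clm_comp (contDiffOn_const (c := ContinuousLinearMap.smulRightL ℝ (Base m) (Fib N)
      (EuclideanSpace.proj α : Base m →L[ℝ] ℝ)))
    have e2 := (contDiffOn_const (c := ContinuousLinearMap.snd ℝ (Base m) (Fib N))).sub
      (hv.clm_comp (contDiffOn_const (c := fstL m N)))
    exact (e1.clm_comp e2).smulRight contDiffOn_const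
  have h2 : ContDiffOn ℝ ∞ (fun x =>
      ContinuousAlternatingMap.fderivCompContinuousLinearMapCLM ℝ (fstL m N) (θ x)) s :=
    (ContinuousLinearMap.contDiff _).comp_contDiffOn hθ
  have h3 : ContDiffOn ℝ ∞ (fun x => (θ x).compContinuousLinearMap (fstL m N)) s :=
    contDiffOn_compContinuousLinearMap hθ contDiffOn_const
  exact (hl.smul h3).add (h2.clm_apply h1)

lemma localForm_mem (θ : Alt m (Base m)) (l : ℝ) (ℓ : JetModel m N →L[ℝ] ℝ) (v : JetModel m N) :
    localForm θ l ℓ v ∈ Lam1 m (fstL m N) := by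
  intro w i j hij hi hj
  have hi : (w i).1 = 0 := hi
  have hj : (w j).1 = 0 := hj
  rw [localForm_apply, θ.map_coord_zero i hi, mul_zero, zero_add]
  refine Finset.sum_eq_zero fun k _ => ?_
  by_cases hk : k = i
  · refine θ.map_coord_zero j ?_
    rw [Function.update_of_ne (by rw [hk]; exact hij.symm), hj]
  · refine θ.map_coord_zero i ?_
    rw [Function.update_of_ne (Ne.symm hk), hi]

end LocalForm

/-! ### Charts of the total spaces -/

namespace BundleAtlas

universe u

variable {B : Type u} [TopologicalSpace B] {V : Type*} [NormedAddCommGroup V] [NormedSpace ℝ V]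
  {G : Type*} [NormedAddCommGroup G] [NormedSpace ℝ G] {Z : B → Type*}
  (a : BundleAtlas B V G Z)

/-- The chart `(b, z) ↦ (x, g)` of the total space as a homeomorphism. -/
noncomputable def totChart (i : a.ι) :
    @OpenPartialHomeomorph (Σ b, Z b) (V × G) a.core.toTopologicalSpace _ :=
  a.core.openPartialHomeomorph (a.chart i) (mem_range_self i)

lemma isSmoothChart_totChart (i : a.ι) :
    let := a.core.toTopologicalSpace
    let := a.core.toChartedSpace
    IsSmoothChart (a.totChart i) := by
  let := a.core.toTopologicalSpace
  let := a.core.toChartedSpace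
  have := a.isManifold
  have h : a.totChart i ∈ atlas (V × G) (Σ b, Z b) := by
    change a.totChart i ∈ ⋃ (e : PartialEquiv (Σ b, Z b) (V × G)) (he : e ∈ a.core.atlas),
      {a.core.openPartialHomeomorph e he}
    simp only [mem_iUnion, mem_singleton_iff]
    exact ⟨a.chart i, mem_range_self i, rfl⟩
  have h' := IsManifold.subset_maximalAtlas (I := 𝓘(ℝ, V × G)) (n := ∞) h
  exact ⟨contMDiffOn_of_mem_maximalAtlas h', contMDiffOn_symm_of_mem_maximalAtlas h'⟩

lemma totChart_symm_fst (i : a.ι) {p : V × G} (hp : p.1 ∈ (a.base i).target) :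
    (a.ofCoord i p).1 = (a.base i).symm p.1 := by
  obtain ⟨x, g⟩ := p
  rw [a.ofCoord_of_mem i x g hp]

end BundleAtlas

/-! ### Maps and forms in arbitrary smooth charts -/

section Charts

variable {V : Type*} [NormedAddCommGroup V] [NormedSpace ℝ V]
  {V' : Type*} [NormedAddCommGroup V'] [NormedSpace ℝ V']
  {A : Type*} [TopologicalSpace A] [ChartedSpace V A]
  {B : Type*} [TopologicalSpace B] [ChartedSpace V' B]

lemma isSmoothChart_of_mem_atlas [IsManifold 𝓘(ℝ, V) ∞ A] {e : OpenPartialHomeomorph A V}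
    (he : e ∈ atlas V A) : IsSmoothChart e :=
  ⟨contMDiffOn_of_mem_maximalAtlas (IsManifold.subset_maximalAtlas he),
    contMDiffOn_symm_of_mem_maximalAtlas (IsManifold.subset_maximalAtlas he)⟩

lemma contMDiffOn_of_charts {e : OpenPartialHomeomorph A V} {e' : OpenPartialHomeomorph B V'}
    (he : IsSmoothChart e) (he' : IsSmoothChart e') {f : A → B} {F : V → V'}
    (hF : ContDiffOn ℝ ∞ F e.target) (hmaps : ∀ a ∈ e.source, f a ∈ e'.source)
    (hf : ∀ a ∈ e.source, e' (f a) = F (e a)) :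
    ContMDiffOn 𝓘(ℝ, V) 𝓘(ℝ, V') ∞ f e.source := by
  have h1 : ContMDiffOn 𝓘(ℝ, V) 𝓘(ℝ, V') ∞ (fun a => F (e a)) e.source :=
    (contMDiffOn_iff_contDiffOn.2 hF).comp he.contMDiffOn fun a ha => e.map_source ha
  have h2 : ContMDiffOn 𝓘(ℝ, V) 𝓘(ℝ, V') ∞ (fun a => e'.symm (F (e a))) e.source :=
    he'.contMDiffOn_symm.comp h1 fun a ha => by
      rw [mem_preimage, ← hf a ha]
      exact e'.map_source (hmaps a ha)
  refine h2.congr fun a ha => ?_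
  rw [← hf a ha, e'.left_inv (hmaps a ha)]

/-- A smooth form has a smooth expression in every chart. -/
lemma contDiffOn_form_chart [FiniteDimensional ℝ V] [IsManifold 𝓘(ℝ, V) ∞ A] {k : ℕ} {Θ : A → Alt k V}
    (hΘ : IsSmoothForm Θ) {e : OpenPartialHomeomorph A V} (he : IsSmoothChart e) :
    ContDiffOn ℝ ∞ (fun z => (Θ (e.symm z)).compContinuousLinearMap (tmap V V e.symm z))
      e.target := by
  intro z₀ hz₀
  set χ := chartAt V (e.symm z₀) with hχd
  have hχ : IsSmoothChart χ := isSmoothChart_of_mem_atlas (chart_mem_atlas V (e.symm z₀))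
  have hz : z₀ ∈ (e.symm.trans χ).source := ⟨hz₀, mem_chart_source V (e.symm z₀)⟩
  -- Near `z₀` the expression in `e` is the one in the preferred chart pulled back by the change of
  -- coordinates, which is smooth along with its derivative.
  have h1 : ContDiffOn ℝ ∞ (fun z => (formInChart Θ (e.symm z₀) ((e.symm.trans χ) z))
      |>.compContinuousLinearMap (fderiv ℝ (e.symm.trans χ) z)) (e.symm.trans χ).source := by
    refine contDiffOn_compContinuousLinearMap ((hΘ (e.symm z₀)).comp (he.contDiffOn_trans hχ) ?_)
      ((he.contDiffOn_trans hχ).fderiv_of_isOpen (e.symm.trans χ).open_source (by simp))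
    intro z hz
    exact χ.map_source hz.2
  refine ((h1.congr ?_).contDiffAt ((e.symm.trans χ).open_source.mem_nhds hz)).contDiffWithinAt
  rintro z ⟨hz, hz'⟩
  have hz : z ∈ e.target := hz
  have hz' : e.symm z ∈ χ.source := hz'
  have h2 := he.deriv_comp_symm hχ (e.map_target hz) hz'
  rw [e.right_inv hz] at h2
  have h3 : tmap V V e.symm z = ((he.deriv (e.map_target hz)).symm : V →L[ℝ] V) := by
    have := (he.hasMFDerivAt_symm (e.map_target hz)).mfderiv
    rwa [e.right_inv hz] at this
  have h4 : tmap V V χ.symm (χ (e.symm z)) = ((hχ.deriv hz').symm : V →L[ℝ] V) :=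
    (hχ.hasMFDerivAt_symm hz').mfderiv
  rw [h3, ← h2]
  have h5 : formInChart Θ (e.symm z₀) ((e.symm.trans χ) z) =
      (Θ (e.symm z)).compContinuousLinearMap ((hχ.deriv hz').symm : V →L[ℝ] V) := by
    change (Θ (χ.symm (χ (e.symm z)))).compContinuousLinearMap
      (tmap V V χ.symm (χ (e.symm z))) = _
    rw [h4, χ.left_inv hz']
  rw [h5]
  ext w
  change Θ (e.symm z) (fun i => _) = Θ (e.symm z) fun i => _
  congr 1
  funext i
  simp

end Charts

/-! ### Adapted coordinates on the jet and multimomentum bundles -/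

section Bundles

universe u v

variable {m N : ℕ} {M : Type v} [TopologicalSpace M] [ChartedSpace (Base m) M]
  [IsManifold 𝓘(ℝ, Base m) ∞ M]
  {E : Type u} [TopologicalSpace E] [ChartedSpace (Tot m N) E] {π : E → M}
  [SmoothFiberBundle m N π] (c : AdaptedChart m N π)

namespace AdaptedChart

/-- The coordinates `(x, y, v)` of `J¹E`. -/
noncomputable def jetChart : OpenPartialHomeomorph (J1 m N π) (J1Model m N) :=
  (jetAtlas m N π).totChart c

/-- The coordinates `(x, y, p_A^α, p)` of `Mπ`. -/
noncomputable def mpiChart : OpenPartialHomeomorph (MPi m N π) (MPiTot m N) :=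
  (mpiAtlas m N π).totChart c

/-- The coordinates `(x, y, p_A^α)` of `J¹*E`. -/
noncomputable def dualChart : OpenPartialHomeomorph (J1Dual m N π) (J1DualTot m N) :=
  (dualAtlas m N π).totChart c

lemma isSmoothChart_jetChart : IsSmoothChart (V := J1Model m N) (B := J1 m N π) c.jetChart :=
  (jetAtlas m N π).isSmoothChart_totChart c

lemma isSmoothChart_mpiChart : IsSmoothChart (V := MPiTot m N) (B := MPi m N π) c.mpiChart :=
  (mpiAtlas m N π).isSmoothChart_totChart c

lemma isSmoothChart_dualChart : IsSmoothChart (V := J1DualTot m N) (B := J1Dual m N π) c.dualChart :=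
  (dualAtlas m N π).isSmoothChart_totChart c

lemma jetChart_apply {a : J1 m N π} (ha : a.proj ∈ c.tot.source) :
    c.jetChart a = (c.tot a.proj, jetEquiv (c.D ha) (c.Dbas ha) (c.fst_D ha) a.2) :=
  (jetAtlas m N π).toCoord_of_mem c a.1 a.2 ha

lemma mpiChart_apply {q : MPi m N π} (hq : q.proj ∈ c.tot.source) :
    c.mpiChart q = (c.tot q.proj, lam1Equiv (c.D hq) (c.Dbas hq) (c.fst_D hq) q.2) :=
  (mpiAtlas m N π).toCoord_of_mem c q.1 q.2 hq

lemma dualChart_apply {q : J1Dual m N π} (hq : q.proj ∈ c.tot.source) :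
    c.dualChart q = (c.tot q.proj, dualEquiv (c.D hq) (c.Dbas hq) (c.fst_D hq) q.2) :=
  (dualAtlas m N π).toCoord_of_mem c q.1 q.2 hq

lemma proj_mpiChart_symm {p : MPiTot m N} (hp : p.1 ∈ c.tot.target) :
    (c.mpiChart.symm p).proj = c.tot.symm p.1 :=
  (mpiAtlas m N π).totChart_symm_fst c hp

end AdaptedChart

lemma contMDiff_of_adaptedCharts {H₁ : Type*} [NormedAddCommGroup H₁] [NormedSpace ℝ H₁]
    {H₂ : Type*} [NormedAddCommGroup H₂] [NormedSpace ℝ H₂]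
    {A : Type*} [TopologicalSpace A] [ChartedSpace H₁ A]
    {B : Type*} [TopologicalSpace B] [ChartedSpace H₂ B] (p : A → E) {f : A → B}
    (e : AdaptedChart m N π → OpenPartialHomeomorph A H₁)
    (hs : ∀ c a, p a ∈ c.tot.source → a ∈ (e c).source)
    (h : ∀ c, ContMDiffOn 𝓘(ℝ, H₁) 𝓘(ℝ, H₂) ∞ f (e c).source) :
    ContMDiff 𝓘(ℝ, H₁) 𝓘(ℝ, H₂) ∞ f := by
  intro a
  obtain ⟨c, hc⟩ := exists_adaptedChart m N π (p a)
  exact (h c).contMDiffAt ((e c).open_source.mem_nhds (hs c a hc))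

lemma contMDiff_MPi_proj : ContMDiff 𝓘(ℝ, MPiTot m N) 𝓘(ℝ, Tot m N) ∞ (MPi.proj (m := m) (N := N) (π := π)) :=
  contMDiff_of_adaptedCharts MPi.proj AdaptedChart.mpiChart (fun _ _ h => h) fun c =>
    contMDiffOn_of_charts c.isSmoothChart_mpiChart c.smooth_tot contDiff_fst.contDiffOn
      (fun _ ha => ha) fun a ha => by rw [c.mpiChart_apply ha]

lemma contMDiff_J1Dual_proj :
    ContMDiff 𝓘(ℝ, J1DualTot m N) 𝓘(ℝ, Tot m N) ∞ (J1Dual.proj (m := m) (N := N) (π := π)) :=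
  contMDiff_of_adaptedCharts J1Dual.proj AdaptedChart.dualChart (fun _ _ h => h) fun c =>
    contMDiffOn_of_charts c.isSmoothChart_dualChart c.smooth_tot contDiff_fst.contDiffOn
      (fun _ ha => ha) fun a ha => by rw [c.dualChart_apply ha]

lemma AdaptedChart.dualChart_mu {q : MPi m N π} (hq : q.proj ∈ c.tot.source) :
    c.dualChart (mu q) = ((c.mpiChart q).1,
      ⟨removeP (c.mpiChart q).2.1, removeP_mem (c.mpiChart q).2.2⟩) := by
  have h : (mu q).proj ∈ c.tot.source := hq
  rw [c.dualChart_apply h, c.mpiChart_apply hq]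
  rfl

/-- In adapted coordinates `μ` fixes `(x, y)` and drops the component `p`, which is linear in the
form. -/
lemma contMDiff_mu : ContMDiff 𝓘(ℝ, MPiTot m N) 𝓘(ℝ, J1DualTot m N) ∞ (mu (m := m) (N := N) (π := π)) := by
  refine contMDiff_of_adaptedCharts MPi.proj AdaptedChart.mpiChart (fun _ _ h => h) fun c =>
    contMDiffOn_of_charts c.isSmoothChart_mpiChart c.isSmoothChart_dualChart
      (F := fun p => (p.1, ⟨removeP p.2.1, removeP_mem p.2.2⟩)) ?_
      (fun _ ha => ha) fun a ha => c.dualChart_mu ha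
  refine contDiff_fst.contDiffOn.prodMk ?_
  refine contDiffOn_of_injective (dualModel m N).subtype Subtype.val_injective ?_
  have h1 : ContDiffOn ℝ ∞ (fun p : MPiTot m N => (p.2 : Alt m (Tot m N))) c.mpiChart.target :=
    ((Lam1 m (fstL m N)).subtypeL.contDiff.comp
      (contDiff_snd (𝕜 := ℝ) (E := Tot m N) (F := MPiModel m N))).contDiffOn
  exact h1.sub (contDiffOn_compContinuousLinearMap
    (contDiffOn_compContinuousLinearMap h1 contDiffOn_const) contDiffOn_const)

end Bundles

/-! ### The Legendre maps in coordinates -/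

section Legendre

/-- Chain rule along an affine map into the second factor; it turns the intrinsic fibre derivative
into a partial derivative in the coordinates `v`. -/
lemma fderiv_comp_affine_snd {W F G : Type*} [NormedAddCommGroup W] [NormedSpace ℝ W]
    [NormedAddCommGroup F] [NormedSpace ℝ F] [NormedAddCommGroup G] [NormedSpace ℝ G]
    {g : F × G → ℝ} {p : F × G} (hg : DifferentiableAt ℝ g p) (κ : W →L[ℝ] G) (η : W) :
    fderiv ℝ (fun η => g (p.1, p.2 + κ η)) 0 η =
      (fderiv ℝ g p).comp (ContinuousLinearMap.inr ℝ F G) (κ η) := by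
  have h1 : HasFDerivAt g (fderiv ℝ g p) (p.1, p.2 + κ 0) := by
    rw [map_zero, add_zero]
    exact hg.hasFDerivAt
  have h2 : HasFDerivAt (fun η : W => (p.1, p.2 + κ η)) ((0 : W →L[ℝ] F).prod κ) 0 :=
    (hasFDerivAt_const _ _).prodMk (κ.hasFDerivAt.const_add _)
  have h3 := (h1.comp (0 : W) h2).fderiv
  exact DFunLike.congr_fun h3 η

universe u v

variable {m N : ℕ} {M : Type v} [TopologicalSpace M] [ChartedSpace (Base m) M]
  [IsManifold 𝓘(ℝ, Base m) ∞ M]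
  {E : Type u} [TopologicalSpace E] [ChartedSpace (Tot m N) E] {π : E → M}
  [SmoothFiberBundle m N π] (c : AdaptedChart m N π)

namespace AdaptedChart

/-- The coordinate expression of a vertical linear map at `y`. -/
noncomputable def vertCoord {y : E} (hy : y ∈ c.tot.source) :
    vertHom (m := m) (N := N) π y →L[ℝ] JetModel m N :=
  (((ContinuousLinearMap.compL ℝ (Base m) (Base m) (Fib N)).flip
    ((c.Dbas hy).symm : Base m →L[ℝ] Base m)).comp
    (ContinuousLinearMap.compL ℝ (Base m) (Tot m N) (Fib N)
      ((ContinuousLinearMap.snd ℝ (Base m) (Fib N)).comp (c.D hy : Tot m N →L[ℝ] Tot m N)))).comp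
    (vertHom (m := m) (N := N) π y).subtypeL

lemma vertCoord_apply {y : E} (hy : y ∈ c.tot.source) (η : vertHom (m := m) (N := N) π y)
    (x : Base m) : c.vertCoord hy η x = (c.D hy (η.1 ((c.Dbas hy).symm x))).2 := rfl

/-- The jet coordinates are affine on each fibre, so adding a vertical map is a translation in `v`.
-/
lemma jetChart_add {a : J1 m N π} (ha : a.proj ∈ c.tot.source)
    (η : vertHom (m := m) (N := N) π a.proj) :
    c.jetChart (a.add η) = ((c.jetChart a).1, (c.jetChart a).2 + c.vertCoord ha η) := by
  have h : (a.add η).proj ∈ c.tot.source := ha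
  rw [c.jetChart_apply h, c.jetChart_apply ha]
  refine Prod.ext rfl ?_
  ext1 x
  change (c.D ha (a.2.1 ((c.Dbas ha).symm x) + η.1 ((c.Dbas ha).symm x))).2 =
    (c.D ha (a.2.1 ((c.Dbas ha).symm x))).2 + (c.D ha (η.1 ((c.Dbas ha).symm x))).2
  rw [map_add]
  rfl

/-- The coordinate expression of a function on `J¹E`. -/
noncomputable def localLagrangian (L : J1 m N π → ℝ) (p : J1Model m N) : ℝ := L (c.jetChart.symm p)

/-- The derivatives `∂L/∂v^A_α` in coordinates. -/
noncomputable def localMomenta (L : J1 m N π → ℝ) (p : J1Model m N) : JetModel m N →L[ℝ] ℝ :=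
  (fderiv ℝ (c.localLagrangian L) p).comp (ContinuousLinearMap.inr ℝ (Tot m N) (JetModel m N))

/-- The coordinate expression of an `m`-form on `M`. -/
noncomputable def localVolume (vol : M → Alt m (Base m)) (x : Base m) : Alt m (Base m) :=
  (vol (c.bas.symm x)).compContinuousLinearMap (tmap (Base m) (Base m) c.bas.symm x)

lemma contDiffOn_localLagrangian {L : J1 m N π → ℝ}
    (hL : ContMDiff 𝓘(ℝ, J1Model m N) 𝓘(ℝ, ℝ) ∞ L) :
    ContDiffOn ℝ ∞ (c.localLagrangian L) c.jetChart.target :=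
  contMDiffOn_iff_contDiffOn.1 (hL.comp_contMDiffOn c.isSmoothChart_jetChart.contMDiffOn_symm)

lemma contDiffOn_localMomenta {L : J1 m N π → ℝ}
    (hL : ContMDiff 𝓘(ℝ, J1Model m N) 𝓘(ℝ, ℝ) ∞ L) :
    ContDiffOn ℝ ∞ (c.localMomenta L) c.jetChart.target :=
  ((c.contDiffOn_localLagrangian hL).fderiv_of_isOpen (m := ∞) c.jetChart.open_target
    (by simp)).clm_comp contDiffOn_const

lemma contDiffOn_localVolume {vol : M → Alt m (Base m)} (hvol : IsSmoothForm vol) :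
    ContDiffOn ℝ ∞ (c.localVolume vol) c.bas.target :=
  contDiffOn_form_chart hvol c.smooth_bas

lemma fst_mem_bas_target {z : Tot m N} (hz : z ∈ c.tot.target) : z.1 ∈ c.bas.target := by
  have h := c.fst_tot _ (c.tot.map_target hz)
  rw [c.tot.right_inv hz] at h
  rw [h]
  exact c.bas.map_source (c.mapsTo _ (c.tot.map_target hz))

lemma localVolume_apply (vol : M → Alt m (Base m)) {y : E} (hy : y ∈ c.tot.source) :
    c.localVolume vol (c.tot y).1 =
      (vol (π y)).compContinuousLinearMap ((c.Dbas hy).symm : Base m →L[ℝ] Base m) := by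
  have h : tmap (Base m) (Base m) c.bas.symm (c.bas (π y)) = (c.Dbas hy).symm :=
    (c.smooth_bas.hasMFDerivAt_symm (c.mapsTo y hy)).mfderiv
  rw [c.fst_tot y hy, localVolume, h, c.bas.left_inv (c.mapsTo y hy)]

lemma localVolume_ne_zero {vol : M → Alt m (Base m)} {y : E} (hy : y ∈ c.tot.source)
    (h : vol (π y) ≠ 0) : c.localVolume vol (c.tot y).1 ≠ 0 := by
  rw [c.localVolume_apply vol hy]
  intro h0
  refine h (ContinuousAlternatingMap.ext fun w => ?_)
  have := DFunLike.congr_fun h0 fun i => c.Dbas hy (w i)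
  change vol (π y) (fun i => (c.Dbas hy).symm (c.Dbas hy (w i))) = 0 at this
  simpa using this

lemma fibreDeriv_eq {L : J1 m N π → ℝ} (hL : ContMDiff 𝓘(ℝ, J1Model m N) 𝓘(ℝ, ℝ) ∞ L)
    {a : J1 m N π} (ha : a.proj ∈ c.tot.source) (η : vertHom (m := m) (N := N) π a.proj) :
    fibreDeriv L a η = c.localMomenta L (c.jetChart a) (c.vertCoord ha η) := by
  have hp : c.jetChart a ∈ c.jetChart.target := c.jetChart.map_source ha
  have h1 : DifferentiableAt ℝ (c.localLagrangian L) (c.jetChart a) :=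
    ((c.contDiffOn_localLagrangian hL).contDiffAt
      (c.jetChart.open_target.mem_nhds hp)).differentiableAt (by simp)
  have h2 : (fun η : vertHom (m := m) (N := N) π a.proj => L (a.add η)) =
      fun η => c.localLagrangian L ((c.jetChart a).1, (c.jetChart a).2 + c.vertCoord ha η) := by
    funext η
    have h : (a.add η) ∈ c.jetChart.source := ha
    rw [localLagrangian, ← c.jetChart_add ha, c.jetChart.left_inv h]
  have h3 := fderiv_comp_affine_snd h1 (c.vertCoord ha) η
  rw [fibreDeriv, h2]
  exact h3

/-- The momentum map in coordinates. -/
lemma momentumMap_eq {L : J1 m N π → ℝ} (hL : ContMDiff 𝓘(ℝ, J1Model m N) 𝓘(ℝ, ℝ) ∞ L)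
    {a : J1 m N π} (ha : a.proj ∈ c.tot.source) (W : Tot m N) :
    c.Dbas ha (momentumMap L a ((c.D ha).symm W)) =
      localMomentum (c.localMomenta L (c.jetChart a)) (c.jetChart a).2 W := by
  set Z := (c.D ha).symm W with hZ
  have h1 : momentumMap L a Z = ∑ α, fibreDeriv L a (vertEnd a α Z) •
      (EuclideanSpace.single α (1 : ℝ) : Base m) := by
    change (∑ α : Fin m, ((fibreDeriv L a).toLinearMap.comp (vertEnd a α)).smulRight
      (EuclideanSpace.single α (1 : ℝ) : Base m)) Z = _
    rw [LinearMap.sum_apply]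
    rfl
  ext i
  rw [localMomentum_apply, h1, map_sum]
  have h2 : ∀ x : Base m, (c.Dbas ha x) i =
      ∑ α, x α * (c.Dbas ha (EuclideanSpace.single α (1 : ℝ))) i := by
    intro x
    conv_lhs => rw [← (EuclideanSpace.basisFun (Fin m) ℝ).sum_repr x, map_sum]
    simp
  -- The momentum map is defined with the standard basis of the model, not with the coordinates of
  -- `c`. The two differ by `Dbas`, which enters once directly and once inverted; the factors cancel
  -- and leave the rank-one map `dx^i ⊗ (W.2 - v W.1)`.
  have h3 : ∑ α, (c.Dbas ha (EuclideanSpace.single α (1 : ℝ))) i • c.vertCoord ha (vertEnd a α Z) =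
      (EuclideanSpace.proj i : Base m →L[ℝ] ℝ).smulRight (W.2 - (c.jetChart a).2 W.1) := by
    ext1 x
    have h4 : (c.D ha (Z - a.lin (dproj m N π a.proj Z))).2 = W.2 - (c.jetChart a).2 W.1 := by
      rw [map_sub, hZ, proj_symm (c.D ha) (c.Dbas ha) (c.fst_D ha), c.jetChart_apply ha,
        ContinuousLinearEquiv.apply_symm_apply]
      rfl
    have h5 : ∀ α, c.vertCoord ha (vertEnd a α Z) x =
        ((c.Dbas ha).symm x) α • (W.2 - (c.jetChart a).2 W.1) := by
      intro α
      rw [vertCoord_apply]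
      change (c.D ha (((c.Dbas ha).symm x) α • (Z - a.lin (dproj m N π a.proj Z)))).2 = _
      rw [map_smul, ← h4]
      rfl
    rw [sum_apply]
    change ∑ α, (c.Dbas ha (EuclideanSpace.single α (1 : ℝ))) i •
      c.vertCoord ha (vertEnd a α Z) x = x i • (W.2 - (c.jetChart a).2 W.1)
    rw [Finset.sum_congr rfl fun α _ => by rw [h5 α, smul_smul], ← Finset.sum_smul]
    congr 1
    have h6 := h2 ((c.Dbas ha).symm x)
    rw [ContinuousLinearEquiv.apply_symm_apply] at h6
    rw [h6]
    exact Finset.sum_congr rfl fun α _ => mul_comm _ _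
  rw [← h3, map_sum]
  have h7 : ∀ (s : Fin m → Base m), (∑ α, s α) i = ∑ α, s α i := fun s => by simp
  rw [h7]
  refine Finset.sum_congr rfl fun α _ => ?_
  rw [map_smul, map_smul, c.fibreDeriv_eq hL ha, smul_eq_mul, mul_comm]
  rfl

/-- The coordinate expression of the extended Legendre map. -/
noncomputable def localLegendre (vol : M → Alt m (Base m)) (L : J1 m N π → ℝ) (p : J1Model m N) :
    MPiTot m N :=
  (p.1, ⟨localForm (c.localVolume vol p.1.1) (c.localLagrangian L p) (c.localMomenta L p) p.2,
    localForm_mem _ _ _ _⟩)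

lemma contDiffOn_localLegendre {vol : M → Alt m (Base m)} (hvol : IsSmoothForm vol)
    {L : J1 m N π → ℝ} (hL : ContMDiff 𝓘(ℝ, J1Model m N) 𝓘(ℝ, ℝ) ∞ L) :
    ContDiffOn ℝ ∞ (c.localLegendre vol L) c.jetChart.target := by
  refine contDiff_fst.contDiffOn.prodMk ?_
  refine contDiffOn_of_injective (Lam1 m (fstL m N)).subtype Subtype.val_injective ?_
  refine contDiffOn_localForm ?_ (c.contDiffOn_localLagrangian hL) (c.contDiffOn_localMomenta hL)
    contDiff_snd.contDiffOn
  exact (c.contDiffOn_localVolume hvol).comp (contDiff_fst.comp contDiff_fst).contDiffOn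
    fun p hp => c.fst_mem_bas_target hp

/-- Every ingredient of the Poincaré–Cartan form is natural under adapted coordinates: `π^*vol`
because the chart covers one of `M`, and the slot carrying the momentum by `momentumMap_eq`. -/
lemma mpiChart_extLegendre (vol : M → Alt m (Base m)) {L : J1 m N π → ℝ}
    (hL : ContMDiff 𝓘(ℝ, J1Model m N) 𝓘(ℝ, ℝ) ∞ L) {a : J1 m N π} (ha : a.proj ∈ c.tot.source) :
    c.mpiChart (extLegendre vol L a) = c.localLegendre vol L (c.jetChart a) := by
  have h : (extLegendre vol L a).proj ∈ c.tot.source := ha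
  have hfst : (c.jetChart a).1 = c.tot a.proj := by rw [c.jetChart_apply ha]
  have hL' : c.localLagrangian L (c.jetChart a) = L a := by
    rw [localLagrangian, c.jetChart.left_inv ha]
  rw [c.mpiChart_apply h]
  refine Prod.ext hfst.symm (Subtype.ext ?_)
  change (legendreForm vol L a).compContinuousLinearMap ((c.D ha).symm : Tot m N →L[ℝ] Tot m N) =
    localForm (c.localVolume vol (c.jetChart a).1.1) (c.localLagrangian L (c.jetChart a))
      (c.localMomenta L (c.jetChart a)) (c.jetChart a).2
  rw [hL', hfst, c.localVolume_apply vol ha]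
  ext w
  rw [localForm_apply]
  have h1 : ∀ i, dproj m N π a.proj ((c.D ha).symm (w i)) = (c.Dbas ha).symm (w i).1 := fun i =>
    proj_symm (c.D ha) (c.Dbas ha) (c.fst_D ha) (w i)
  change L a • vol (π a.proj) (fun i => dproj m N π a.proj ((c.D ha).symm (w i))) +
    (vol (π a.proj)).fderivCompContinuousLinearMap (dproj m N π a.proj) (momentumMap L a)
      (fun i => (c.D ha).symm (w i)) = L a * vol (π a.proj) (fun i => (c.Dbas ha).symm (w i).1) +
    ∑ k, vol (π a.proj) (fun i => (c.Dbas ha).symm (Function.update (fun i => (w i).1) k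
      (localMomentum (c.localMomenta L (c.jetChart a)) (c.jetChart a).2 (w k)) i))
  rw [ContinuousAlternatingMap.fderivCompContinuousLinearMap_apply]
  simp_rw [h1]
  rw [smul_eq_mul]
  congr 1
  refine Finset.sum_congr rfl fun k _ => ?_
  congr 1
  funext j
  by_cases hj : j = k
  · subst hj
    rw [Function.update_self, Function.update_self, ← c.momentumMap_eq hL ha,
      ContinuousLinearEquiv.symm_apply_apply]
  · rw [Function.update_of_ne hj, Function.update_of_ne hj, h1]

end AdaptedChart

lemma contMDiff_extLegendre {vol : M → Alt m (Base m)} (hvol : IsSmoothForm vol)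
    {L : J1 m N π → ℝ} (hL : ContMDiff 𝓘(ℝ, J1Model m N) 𝓘(ℝ, ℝ) ∞ L) :
    ContMDiff 𝓘(ℝ, J1Model m N) 𝓘(ℝ, MPiTot m N) ∞ (extLegendre vol L) :=
  contMDiff_of_adaptedCharts J1.proj AdaptedChart.jetChart (fun _ _ h => h) fun c =>
    contMDiffOn_of_charts c.isSmoothChart_jetChart c.isSmoothChart_mpiChart
      (c.contDiffOn_localLegendre hvol hL) (fun _ ha => ha)
      fun _ ha => c.mpiChart_extLegendre vol hL ha

end Legendre

/-! ### The extended Legendre map is constant along the fibres of the restricted one -/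

section Regular

universe u v

variable {m N : ℕ} {M : Type v} [TopologicalSpace M] [ChartedSpace (Base m) M]
  [IsManifold 𝓘(ℝ, Base m) ∞ M]
  {E : Type u} [TopologicalSpace E] [ChartedSpace (Tot m N) E] {π : E → M}
  [SmoothFiberBundle m N π]
  {vol : M → Alt m (Base m)} {L : J1 m N π → ℝ}

/-- On such a curve the point of `E` and the momenta `ℓ = ∂L/∂v` are fixed, so only `p = L - ℓ(v)`
could vary, and its derivative is `ℓ(v') - ℓ(v') = 0`. -/
lemma extLegendre_eq_of_curve (hvol_ne : ∀ x, vol x ≠ 0)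
    (hL : ContMDiff 𝓘(ℝ, J1Model m N) 𝓘(ℝ, ℝ) ∞ L) {I : Set ℝ} (hI : IsOpen I)
    (hI' : Icc 0 1 ⊆ I) {γ : ℝ → J1 m N π}
    (hγ : ContMDiffOn 𝓘(ℝ, ℝ) 𝓘(ℝ, J1Model m N) ∞ γ I)
    (hconst : ∀ t ∈ I, legendre vol L (γ t) = legendre vol L (γ 0)) :
    extLegendre vol L (γ 1) = extLegendre vol L (γ 0) := by
  obtain ⟨c, hc⟩ := exists_adaptedChart m N π (γ 0).proj
  have h0I : (0 : ℝ) ∈ I := hI' ⟨le_rfl, zero_le_one⟩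
  have h1I : (1 : ℝ) ∈ I := hI' ⟨zero_le_one, le_rfl⟩
  -- The curve stays over one point of `E`, so a single adapted chart serves for all of it.
  have hproj : ∀ t ∈ I, (γ t).proj = (γ 0).proj := fun t ht =>
    congrArg J1Dual.proj (hconst t ht)
  have hmem : ∀ t ∈ I, (γ t).proj ∈ c.tot.source := fun t ht => by rwa [hproj t ht]
  let p : ℝ → J1Model m N := fun t => c.jetChart (γ t)
  have hp1 : ∀ t ∈ I, (p t).1 = c.tot (γ 0).proj := fun t ht => by
    change (c.jetChart (γ t)).1 = _
    rw [c.jetChart_apply (hmem t ht)]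
    exact congrArg c.tot (hproj t ht)
  have hpsmooth : ContDiffOn ℝ ∞ p I :=
    contMDiffOn_iff_contDiffOn.1 (c.isSmoothChart_jetChart.contMDiffOn.comp hγ hmem)
  set θ := c.localVolume vol (c.tot (γ 0).proj).1 with hθ
  have hθ_ne : θ ≠ 0 := c.localVolume_ne_zero hc (hvol_ne _)
  have hrem : ∀ t ∈ I, removeP (localForm θ (c.localLagrangian L (p t)) (c.localMomenta L (p t))
      (p t).2) = removeP (localForm θ (c.localLagrangian L (p 0)) (c.localMomenta L (p 0))
      (p 0).2) := by
    have key : ∀ t ∈ I, removeP (localForm θ (c.localLagrangian L (p t)) (c.localMomenta L (p t))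
        (p t).2) = ((c.dualChart (legendre vol L (γ t))).2 : Alt m (Tot m N)) := by
      intro t ht
      have h : (extLegendre vol L (γ t)).proj ∈ c.tot.source := hmem t ht
      rw [legendre, c.dualChart_mu h, c.mpiChart_extLegendre vol hL (hmem t ht)]
      change _ = removeP (localForm (c.localVolume vol (p t).1.1) _ _ _)
      rw [hp1 t ht]
    intro t ht
    rw [key t ht, key 0 h0I, hconst t ht]
  -- The restricted Legendre map records exactly the momenta, because the volume form does not
  -- vanish.
  have hℓ : ∀ t ∈ I, c.localMomenta L (p t) = c.localMomenta L (p 0) := fun t ht =>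
    eq_of_removeP_localForm_eq hθ_ne (hrem t ht)
  have hLsmooth := c.contDiffOn_localLagrangian hL
  have htarget : ∀ t ∈ I, p t ∈ c.jetChart.target := fun t ht => c.jetChart.map_source (hmem t ht)
  -- The momenta may be frozen at their value at `0` before differentiating, so no derivative of
  -- `∂L/∂v` appears; the velocity has no component along `E`.
  have hderiv : ∀ t ∈ I, HasDerivAt
      (fun t => c.localLagrangian L (p t) - c.localMomenta L (p 0) (p t).2) 0 t := by
    intro t ht
    have e1 : HasDerivAt p (deriv p t) t :=
      ((hpsmooth.contDiffAt (hI.mem_nhds ht)).differentiableAt (by simp)).hasDerivAt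
    have e2 : HasFDerivAt (c.localLagrangian L) (fderiv ℝ (c.localLagrangian L) (p t)) (p t) :=
      ((hLsmooth.contDiffAt (c.jetChart.open_target.mem_nhds (htarget t ht))).differentiableAt
        (by simp)).hasFDerivAt
    have e3 : HasDerivAt (fun t => (p t).1) (deriv p t).1 t :=
      (ContinuousLinearMap.fst ℝ (Tot m N) (JetModel m N)).hasFDerivAt.comp_hasDerivAt t e1
    have e4 : HasDerivAt (fun t => (p t).2) (deriv p t).2 t :=
      (ContinuousLinearMap.snd ℝ (Tot m N) (JetModel m N)).hasFDerivAt.comp_hasDerivAt t e1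
    have e5 : (deriv p t).1 = 0 := by
      refine e3.unique ((hasDerivAt_const t (c.tot (γ 0).proj)).congr_of_eventuallyEq ?_)
      filter_upwards [hI.mem_nhds ht] with s hs using hp1 s hs
    have e6 : deriv p t = (0, (deriv p t).2) := Prod.ext e5 rfl
    have e7 := (e2.comp_hasDerivAt t e1).sub
      ((c.localMomenta L (p 0)).hasFDerivAt.comp_hasDerivAt t e4)
    have e8 : fderiv ℝ (c.localLagrangian L) (p t) (deriv p t) -
        c.localMomenta L (p 0) (deriv p t).2 = 0 := by
      rw [← hℓ t ht, sub_eq_zero]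
      conv_lhs => rw [e6]
      rfl
    rw [e8] at e7
    exact e7
  have hend : c.localLagrangian L (p 1) - c.localMomenta L (p 0) (p 1).2 =
      c.localLagrangian L (p 0) - c.localMomenta L (p 0) (p 0).2 :=
    constant_of_has_deriv_right_zero
      (fun t ht => (hderiv t (hI' ht)).continuousAt.continuousWithinAt)
      (fun t ht => (hderiv t (hI' (Ico_subset_Icc_self ht))).hasDerivWithinAt) 1
      ⟨zero_le_one, le_rfl⟩
  -- A form is recovered from its momenta and its component `p`.
  have hform : ∀ α β : Alt m (Tot m N), removeP α = removeP β →
      α.compContinuousLinearMap (inlL m N) = β.compContinuousLinearMap (inlL m N) → α = β := by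
    intro α β h1 h2
    rw [removeP, removeP, h2] at h1
    exact sub_left_injective h1
  have hlocal : c.localLegendre vol L (p 1) = c.localLegendre vol L (p 0) := by
    refine Prod.ext ((hp1 1 h1I).trans (hp1 0 h0I).symm) (Subtype.ext ?_)
    change localForm (c.localVolume vol (p 1).1.1) _ _ _ =
      localForm (c.localVolume vol (p 0).1.1) _ _ _
    rw [hp1 1 h1I, hp1 0 h0I]
    refine hform _ _ (hrem 1 h1I) ?_
    rw [localForm_comp_inl, localForm_comp_inl, hℓ 1 h1I, hend]
  have h1 : extLegendre vol L (γ 1) ∈ c.mpiChart.source := hmem 1 h1I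
  have h0 : extLegendre vol L (γ 0) ∈ c.mpiChart.source := hmem 0 h0I
  refine c.mpiChart.injOn h1 h0 ?_
  rw [c.mpiChart_extLegendre vol hL (hmem 1 h1I), c.mpiChart_extLegendre vol hL (hmem 0 h0I)]
  exact hlocal

namespace IsAlmostRegular

variable {HQ : Type*} [NormedAddCommGroup HQ] [NormedSpace ℝ HQ]
  {Q : Type*} [TopologicalSpace Q] [ChartedSpace HQ Q] {j₀ : Q → J1Dual m N π} {FL₀ : J1 m N π → Q}

lemma legendre_eq_iff (hreg : IsAlmostRegular vol L HQ j₀ FL₀) {a b : J1 m N π} :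
    legendre vol L a = legendre vol L b ↔ FL₀ a = FL₀ b := by
  rw [← hreg.comp_eq, ← hreg.comp_eq]
  exact hreg.embedding.isEmbedding.injective.eq_iff

/-- Equality of the values of `FL̃` is an equivalence relation that holds between nearby points of a
fibre of `FL`, joined by a curve in it; connectedness of the fibre makes it global. -/
lemma extLegendre_eq (hreg : IsAlmostRegular vol L HQ j₀ FL₀) (hvol_ne : ∀ x, vol x ≠ 0)
    (hL : ContMDiff 𝓘(ℝ, J1Model m N) 𝓘(ℝ, ℝ) ∞ L) {a b : J1 m N π} (h : FL₀ a = FL₀ b) :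
    extLegendre vol L a = extLegendre vol L b := by
  refine (hreg.connected b).isPreconnected.induction₂
    (fun a b => extLegendre vol L a = extLegendre vol L b) ?_
    (fun _ _ _ _ _ _ h h' => h.trans h') (fun _ _ _ _ h => h.symm) (hreg.legendre_eq_iff.2 h) rfl
  intro x hx
  have h1 := exists_curve_of_isSubmersion hreg.submersion x
  filter_upwards [nhdsWithin_le_nhds h1, self_mem_nhdsWithin] with y hy hy'
  have hx : legendre vol L x = legendre vol L b := hx
  have hy' : legendre vol L y = legendre vol L b := hy'
  obtain ⟨I, γ, hI, hI', h0, h2, hγ, hconst⟩ := hy (hreg.legendre_eq_iff.1 (hy'.trans hx.symm))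
  subst h0 h2
  exact (extLegendre_eq_of_curve hvol_ne hL hI hI' hγ
    fun t ht => hreg.legendre_eq_iff.2 (hconst t ht)).symm

/-- The arbitrary choice of preimages in the definition of `hMap` is harmless, since the extended
Legendre map is constant on the fibres of `FL₀`. -/
lemma hMap_comp (hreg : IsAlmostRegular vol L HQ j₀ FL₀) (hvol_ne : ∀ x, vol x ≠ 0)
    (hL : ContMDiff 𝓘(ℝ, J1Model m N) 𝓘(ℝ, ℝ) ∞ L) (a : J1 m N π) :
    hMap vol L hreg.surjective (FL₀ a) = extLegendre vol L a :=
  hreg.extLegendre_eq hvol_ne hL (Function.surjInv_eq hreg.surjective (FL₀ a))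

lemma mu_hMap (hreg : IsAlmostRegular vol L HQ j₀ FL₀) (q : Q) :
    mu (hMap vol L hreg.surjective q) = j₀ q := by
  conv_rhs => rw [← Function.surjInv_eq hreg.surjective q]
  exact (hreg.comp_eq _).symm

/-- Locally the map is the extended Legendre map composed with a smooth section of the submersion
`FL₀`. -/
lemma contMDiff_hMap (hreg : IsAlmostRegular vol L HQ j₀ FL₀) (hvol : IsSmoothForm vol)
    (hvol_ne : ∀ x, vol x ≠ 0) (hL : ContMDiff 𝓘(ℝ, J1Model m N) 𝓘(ℝ, ℝ) ∞ L) :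
    ContMDiff 𝓘(ℝ, HQ) 𝓘(ℝ, MPiTot m N) ∞ (hMap vol L hreg.surjective) := by
  intro q
  obtain ⟨a, rfl⟩ := hreg.surjective q
  obtain ⟨U, σ, hU, haU, -, hσ, hσ'⟩ := exists_section_of_isSubmersion hreg.submersion a
  have h1 : ContMDiffOn 𝓘(ℝ, HQ) 𝓘(ℝ, MPiTot m N) ∞ (fun q => extLegendre vol L (σ q)) U :=
    (contMDiff_extLegendre hvol hL).comp_contMDiffOn hσ
  refine (h1.congr fun q hq => ?_).contMDiffAt (hU.mem_nhds haU)
  rw [← hreg.hMap_comp hvol_ne hL (σ q), hσ' q hq]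

lemma tmap_mu_comp_tmap_hMap (hreg : IsAlmostRegular vol L HQ j₀ FL₀) (hvol : IsSmoothForm vol)
    (hvol_ne : ∀ x, vol x ≠ 0) (hL : ContMDiff 𝓘(ℝ, J1Model m N) 𝓘(ℝ, ℝ) ∞ L) (q : Q) :
    (tmap (MPiTot m N) (J1DualTot m N) mu (hMap vol L hreg.surjective q)).comp
      (tmap HQ (MPiTot m N) (hMap vol L hreg.surjective) q) = tmap HQ (J1DualTot m N) j₀ q := by
  have h1 : MDifferentiable 𝓘(ℝ, MPiTot m N) 𝓘(ℝ, J1DualTot m N) (mu (m := m) (N := N) (π := π)) :=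
    (contMDiff_mu (m := m) (N := N) (π := π)).mdifferentiable (by simp)
  have h2 := (hreg.contMDiff_hMap hvol hvol_ne hL).mdifferentiable (by simp)
  have h3 : mu ∘ hMap vol L hreg.surjective = j₀ := funext hreg.mu_hMap
  exact (tmap_comp q (h1 _) (h2 q)).symm.trans (congrArg (tmap HQ (J1DualTot m N) · q) h3)

lemma tmap_j₀_injective (hreg : IsAlmostRegular vol L HQ j₀ FL₀) (q : Q) :
    Function.Injective (tmap HQ (J1DualTot m N) j₀ q) :=
  tmap_injective_of_isImmersion hreg.embedding.isImmersion q

/-- Composition with `Tμ` gives `Tj₀`, which is injective. -/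
lemma tmap_hMap_injective (hreg : IsAlmostRegular vol L HQ j₀ FL₀) (hvol : IsSmoothForm vol)
    (hvol_ne : ∀ x, vol x ≠ 0) (hL : ContMDiff 𝓘(ℝ, J1Model m N) 𝓘(ℝ, ℝ) ∞ L) (q : Q) :
    Function.Injective (tmap HQ (MPiTot m N) (hMap vol L hreg.surjective) q) := by
  have h := hreg.tmap_j₀_injective q
  rw [← hreg.tmap_mu_comp_tmap_hMap hvol hvol_ne hL q] at h
  exact Function.Injective.of_comp h

end IsAlmostRegular

end Regular

/-! ### The canonical form -/

section Canonical

universe u v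

/-- The preferred chart at `a` is the one that identifies the tangent space at `a` with the model
space. -/
lemma tmap_chartAt_self {V : Type*} [NormedAddCommGroup V] [NormedSpace ℝ V] {A : Type*}
    [TopologicalSpace A] [ChartedSpace V A] [IsManifold 𝓘(ℝ, V) ∞ A] (a : A) :
    tmap V V (chartAt V a) a = ContinuousLinearMap.id ℝ V := by
  have : IsManifold 𝓘(ℝ, V) 1 A := IsManifold.of_le (n := ∞) (by simp)
  have h := mfderiv_chartAt_eq_tangentCoordChange (I := 𝓘(ℝ, V)) (mem_chart_source V a)
  ext w
  have h1 := (DFunLike.congr_fun h w).trans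
    (tangentCoordChange_self (I := 𝓘(ℝ, V)) (x := a) (z := a) (v := w) (by simp))
  exact h1

lemma tmap_comp_tmap_symm {V : Type*} [NormedAddCommGroup V] [NormedSpace ℝ V] {A : Type*}
    [TopologicalSpace A] [ChartedSpace V A]
    {V' : Type*} [NormedAddCommGroup V'] [NormedSpace ℝ V'] {B : Type*}
    [TopologicalSpace B] [ChartedSpace V' B] {f : A → B} {e : OpenPartialHomeomorph A V}
    (he : IsSmoothChart e) {e' : OpenPartialHomeomorph B V'} (he' : IsSmoothChart e')
    (F : V →L[ℝ] V') (h : ∀ p ∈ e.target, f (e.symm p) = e'.symm (F p)) {z : V}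
    (hz : z ∈ e.target) (hz' : F z ∈ e'.target)
    (hf : MDifferentiableAt 𝓘(ℝ, V) 𝓘(ℝ, V') f (e.symm z)) :
    (tmap V V' f (e.symm z)).comp (tmap V V e.symm z) = (tmap V' V' e'.symm (F z)).comp F := by
  have h1 : MDifferentiableAt 𝓘(ℝ, V) 𝓘(ℝ, V) e.symm z :=
    (he.contMDiffOn_symm.contMDiffAt (e.open_target.mem_nhds hz)).mdifferentiableAt (by simp)
  have h2 : MDifferentiableAt 𝓘(ℝ, V') 𝓘(ℝ, V') e'.symm (F z) :=
    (he'.contMDiffOn_symm.contMDiffAt (e'.open_target.mem_nhds hz')).mdifferentiableAt (by simp)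
  have h3 : tmap V V' F z = F := F.mfderiv_eq
  rw [← tmap_comp z hf h1, tmap_eq_of_eqOn (f := f ∘ e.symm) (g := e'.symm ∘ F) e.open_target h hz,
    tmap_comp z h2 F.mdifferentiableAt, h3]

lemma extDeriv_linear {V : Type*} [NormedAddCommGroup V] [NormedSpace ℝ V] {k : ℕ}
    (Λ : V →L[ℝ] Alt k V) (x : V) (w : Fin (k + 1) → V) :
    extDeriv Λ x w = ∑ i : Fin (k + 1), (-1) ^ (i : ℕ) • Λ (w i) (Fin.removeNth i w) := by
  rw [extDeriv, Λ.fderiv, ContinuousAlternatingMap.alternatizeUncurryFin_apply]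

lemma tmap_comp_tmap_of_chartAt {V : Type*} [NormedAddCommGroup V] [NormedSpace ℝ V] {A : Type*}
    [TopologicalSpace A] [ChartedSpace V A] [IsManifold 𝓘(ℝ, V) ∞ A]
    {V' : Type*} [NormedAddCommGroup V'] [NormedSpace ℝ V'] {B : Type*}
    [TopologicalSpace B] [ChartedSpace V' B] {a : A} {f : A → B}
    (hf : MDifferentiableAt 𝓘(ℝ, V) 𝓘(ℝ, V') f a) {e : OpenPartialHomeomorph B V'}
    (he : IsSmoothChart e) (ha : f a ∈ e.source) (F : V →L[ℝ] V')
    (h : ∀ p ∈ (chartAt V a).source, e (f p) = F (chartAt V a p)) :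
    (tmap V' V' e (f a)).comp (tmap V V' f a) = F := by
  have h1 : MDifferentiableAt 𝓘(ℝ, V) 𝓘(ℝ, V) (chartAt V a) a :=
    mdifferentiableAt_atlas (chart_mem_atlas _ _) (mem_chart_source _ _)
  have h2 := (he.hasMFDerivAt ha).mdifferentiableAt
  have h3 : tmap V V' F (chartAt V a a) = F := F.mfderiv_eq
  rw [← tmap_comp a h2 hf, tmap_eq_of_eqOn (f := e ∘ f) (g := F ∘ chartAt V a)
    (chartAt V a).open_source h (mem_chart_source V a), tmap_comp a F.mdifferentiableAt h1, h3,
    tmap_chartAt_self]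
  rfl

variable {m N : ℕ} {M : Type v} [TopologicalSpace M] [ChartedSpace (Base m) M]
  [IsManifold 𝓘(ℝ, Base m) ∞ M]
  {E : Type u} [TopologicalSpace E] [ChartedSpace (Tot m N) E] {π : E → M}
  [SmoothFiberBundle m N π]

lemma contMDiff_comp_MPi_proj :
    ContMDiff 𝓘(ℝ, MPiTot m N) 𝓘(ℝ, Base m) ∞ (π ∘ MPi.proj (m := m) (N := N) (π := π)) :=
  (SmoothFiberBundle.contMDiff (m := m) (N := N) (π := π)).comp contMDiff_MPi_proj

/-- The Liouville form is tautological: at a point with fibre coordinate `α` it is `α` pulled back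
to the total space. In these coordinates it therefore depends linearly on the point. -/
lemma AdaptedChart.formInChart_liouville (c : AdaptedChart m N π) {z : MPiTot m N}
    (hz : z ∈ c.mpiChart.target) :
    (liouville (π := π) (c.mpiChart.symm z)).compContinuousLinearMap
      (tmap (MPiTot m N) (MPiTot m N) c.mpiChart.symm z) =
    z.2.1.compContinuousLinearMap (ContinuousLinearMap.fst ℝ (Tot m N) (MPiModel m N)) := by
  set q := c.mpiChart.symm z with hq
  have hqs : q.proj ∈ c.tot.source := c.mpiChart.map_target hz
  have hzq : z = c.mpiChart q := (c.mpiChart.right_inv hz).symm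
  have h2 : MDifferentiable 𝓘(ℝ, MPiTot m N) 𝓘(ℝ, Tot m N) (MPi.proj (m := m) (N := N) (π := π)) :=
    (contMDiff_MPi_proj (m := m) (N := N) (π := π)).mdifferentiable (by simp)
  have hz1 : c.tot q.proj = z.1 := by rw [hzq, c.mpiChart_apply hqs]
  have h4 := tmap_comp_tmap_symm c.isSmoothChart_mpiChart c.smooth_tot
    (ContinuousLinearMap.fst ℝ (Tot m N) (MPiModel m N)) (fun p hp => c.proj_mpiChart_symm hp) hz hz
    (h2 _)
  have h3 : tmap (Tot m N) (Tot m N) c.tot.symm z.1 = ((c.D hqs).symm : Tot m N →L[ℝ] Tot m N) := by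
    rw [← hz1]
    exact (c.smooth_tot.hasMFDerivAt_symm hqs).mfderiv
  have h5 : z.2.1 = q.2.1.compContinuousLinearMap ((c.D hqs).symm : Tot m N →L[ℝ] Tot m N) := by
    rw [hzq, c.mpiChart_apply hqs]
    rfl
  rw [h5]
  change (q.2.1.compContinuousLinearMap (tmap (MPiTot m N) (Tot m N) MPi.proj q)).compContinuousLinearMap
    _ = _
  ext w
  change q.2.1 (fun i => tmap (MPiTot m N) (Tot m N) MPi.proj q
    (tmap (MPiTot m N) (MPiTot m N) c.mpiChart.symm z (w i))) =
    q.2.1 fun i => (c.D hqs).symm (w i).1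
  congr 1
  funext i
  refine (DFunLike.congr_fun h4 (w i)).trans ?_
  change tmap (Tot m N) (Tot m N) c.tot.symm z.1 (w i).1 = _
  rw [h3]
  rfl

/-- The exterior derivative of the Liouville form in the preferred chart. -/
lemma canonicalForm_apply (q : MPi m N π) (w : Fin (m + 1) → MPiTot m N) :
    canonicalForm q w =
      -∑ i : Fin (m + 1), (-1) ^ (i : ℕ) • (w i).2.1 fun j => (Fin.removeNth i w j).1 := by
  obtain ⟨c, hc⟩ : ∃ c : AdaptedChart m N π, chartAt (MPiTot m N) q = c.mpiChart := ⟨_, rfl⟩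
  -- The local expression of `Θ` is the linear map `Λ`, so its exterior derivative is the
  -- antisymmetrisation of `Λ` and does not depend on the point.
  let Λ : MPiTot m N →L[ℝ] Alt m (MPiTot m N) :=
    ((ContinuousAlternatingMap.compContinuousLinearMapCLM
      (ContinuousLinearMap.fst ℝ (Tot m N) (MPiModel m N))).comp
      (Lam1 m (fstL m N)).subtypeL).comp (ContinuousLinearMap.snd ℝ (Tot m N) (MPiModel m N))
  have hmem : chartAt (MPiTot m N) q q ∈ c.mpiChart.target := by
    rw [← hc]
    exact mem_chart_target _ _
  have h1 : formInChart (liouville (π := π)) q =ᶠ[𝓝 (chartAt (MPiTot m N) q q)] Λ := by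
    filter_upwards [c.mpiChart.open_target.mem_nhds hmem] with z hz
    rw [formInChart, hc]
    exact c.formInChart_liouville hz
  rw [canonicalForm, dForm, h1.extDeriv_eq]
  exact congrArg Neg.neg (extDeriv_linear Λ _ w)

/-- In the preferred chart, which is an adapted one, the projection to `M` reads off the coordinates
`x`. -/
lemma fst_fst_eq_zero {q : MPi m N π} {w : MPiTot m N}
    (hw : tmap (MPiTot m N) (Base m) (π ∘ MPi.proj) q w = 0) : w.1.1 = 0 := by
  obtain ⟨c, hc⟩ : ∃ c : AdaptedChart m N π, chartAt (MPiTot m N) q = c.mpiChart := ⟨_, rfl⟩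
  have hq : q.proj ∈ c.tot.source := by
    have := mem_chart_source (MPiTot m N) q
    rwa [hc] at this
  have h2 := (contMDiff_comp_MPi_proj (m := m) (N := N) (π := π)).mdifferentiable (by simp) q
  have h3 := tmap_comp_tmap_of_chartAt h2 c.smooth_bas (c.mapsTo _ hq)
    ((fstL m N).comp (ContinuousLinearMap.fst ℝ (Tot m N) (MPiModel m N))) (fun p hp => by
      rw [hc] at hp ⊢
      have hp : p.proj ∈ c.tot.source := hp
      rw [c.mpiChart_apply hp]
      exact (c.fst_tot _ hp).symm)
  have h4 := DFunLike.congr_fun h3 w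
  rw [ContinuousLinearMap.comp_apply, hw, map_zero] at h4
  exact h4.symm

/-- The canonical form vanishes on any three vertical vectors. -/
lemma canonicalForm_eq_zero_of_vertical (q : MPi m N π) (w : Fin (m + 1) → MPiTot m N)
    {i j k : Fin (m + 1)} (hij : i ≠ j) (hik : i ≠ k) (hjk : j ≠ k)
    (hi : tmap (MPiTot m N) (Base m) (π ∘ MPi.proj) q (w i) = 0)
    (hj : tmap (MPiTot m N) (Base m) (π ∘ MPi.proj) q (w j) = 0)
    (hk : tmap (MPiTot m N) (Base m) (π ∘ MPi.proj) q (w k) = 0) : canonicalForm q w = 0 := by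
  -- The `l`-th term evaluates a form of `Λ₁ᵐ` on the remaining vectors. Of three vertical vectors
  -- at least two remain when one is removed, and the form vanishes on them.
  have key : ∀ l a b : Fin (m + 1), a ≠ l → b ≠ l → a ≠ b → (w a).1.1 = 0 → (w b).1.1 = 0 →
      (w l).2.1 (fun r => (Fin.removeNth l w r).1) = 0 := by
    intro l a b ha hb hab ha' hb'
    obtain ⟨a', rfl⟩ := Fin.exists_succAbove_eq ha
    obtain ⟨b', rfl⟩ := Fin.exists_succAbove_eq hb
    exact (w l).2.2 _ a' b' (fun h => hab (by rw [h])) ha' hb'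
  have hi := fst_fst_eq_zero hi
  have hj := fst_fst_eq_zero hj
  have hk := fst_fst_eq_zero hk
  rw [canonicalForm_apply, neg_eq_zero]
  refine Finset.sum_eq_zero fun l _ => smul_eq_zero_of_right _ ?_
  by_cases h1 : l = i
  · subst h1
    exact key l j k hij.symm hik.symm hjk hj hk
  by_cases h2 : l = j
  · subst h2
    exact key l i k hij hjk.symm hik hi hk
  · exact key l i j (Ne.symm h1) (Ne.symm h2) hij hi hj

/-- The derivation defined by a projector whose image is isotropic for a form that vanishes on any
three vectors of its kernel. -/
lemma fderivComp_projector_sub {H W X : Type*} [NormedAddCommGroup H] [NormedSpace ℝ H]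
    [NormedAddCommGroup W] [NormedSpace ℝ W] [NormedAddCommGroup X] [NormedSpace ℝ X] {n : ℕ}
    (Ω : Alt (n + 1) W) (R : W →L[ℝ] X) (T : H →L[ℝ] W) (Y : X →L[ℝ] H)
    (hY : (R.comp T).comp Y = ContinuousLinearMap.id ℝ X)
    (hv : ∀ (w : Fin (n + 1) → W) (i j k : Fin (n + 1)), i ≠ j → i ≠ k → j ≠ k → R (w i) = 0 →
      R (w j) = 0 → R (w k) = 0 → Ω w = 0)
    (hΩ : ∀ w, (Ω.curryLeft (T w)).compContinuousLinearMap (T.comp Y) = 0) :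
    (Ω.fderivCompContinuousLinearMap (ContinuousLinearMap.id ℝ _) ((T.comp Y).comp R) -
      ((n : ℝ) - 1) • Ω).compContinuousLinearMap T = 0 := by
  have hRTY : ∀ x, R (T (Y x)) = x := fun x => DFunLike.congr_fun hY x
  -- The eigenvector statement is applied on `H`, to the pulled-back form and the projector `Y ∘ R ∘
  -- T`; `T` intertwines this projector with `T ∘ Y ∘ R`.
  have h := sum_update_projector (Ω.compContinuousLinearMap T)
    (Y.comp (R.comp T)) (fun w => by simp [hRTY]) ?_ ?_
  · ext w
    have hw := DFunLike.congr_fun h w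
    rw [ContinuousAlternatingMap.fderivCompContinuousLinearMap_apply] at hw
    change Ω.fderivCompContinuousLinearMap _ _ (fun i => T (w i)) -
      ((n : ℝ) - 1) * Ω (fun i => T (w i)) = 0
    rw [ContinuousAlternatingMap.fderivCompContinuousLinearMap_apply, sub_eq_zero]
    refine Eq.trans (Finset.sum_congr rfl fun k _ => ?_) hw
    change _ = Ω _
    congr 1
    funext l
    by_cases hl : l = k
    · subst hl
      simp
    · simp [Function.update_of_ne hl]
  · intro w i hw
    -- The one unrestricted argument is moved to the front at the cost of a sign; the others are
    -- horizontal, so the isotropy hypothesis `hΩ` applies.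
    have h1 : w = i.insertNth (w i) (i.removeNth w) := (Fin.insertNth_self_removeNth i w).symm
    have h2 := (Ω.compContinuousLinearMap T).toAlternatingMap.map_insertNth i (w i)
      (i.removeNth w)
    rw [← h1] at h2
    refine h2.trans (smul_eq_zero_of_right _ ?_)
    have h3 := DFunLike.congr_fun (hΩ (w i)) fun j => R (T (i.removeNth w j))
    refine Eq.trans ?_ h3
    change Ω (fun l => T (Matrix.vecCons (w i) (i.removeNth w) l)) =
      Ω (Matrix.vecCons (T (w i)) fun j => T (Y (R (T (i.removeNth w j)))))
    congr 1
    funext l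
    refine Fin.cases rfl (fun j => ?_) l
    exact congrArg T (hw _ (Fin.succAbove_ne i j)).symm
  · intro w i j k hij hik hjk hi hj hk
    -- The kernel of the projector consists of vectors that are vertical after `T`, because `Y` is
    -- injective.
    have hv' : ∀ l, (Y.comp (R.comp T)) (w l) = 0 → R (T (w l)) = 0 := by
      intro l hl
      have hl : Y (R (T (w l))) = 0 := hl
      rw [← hRTY (R (T (w l))), hl, map_zero, map_zero]
    exact hv (fun l => T (w l)) i j k hij hik hjk (hv' i hi) (hv' j hj) (hv' k hk)

end Canonical

/-! ### Integral sections and associated objects -/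

section Integral

variable {m : ℕ} {M : Type*} [TopologicalSpace M] [ChartedSpace (Base m) M]
  [IsManifold 𝓘(ℝ, Base m) ∞ M]
  {H : Type*} [NormedAddCommGroup H] [NormedSpace ℝ H] {H₂ : Type*}
  [NormedAddCommGroup H₂] [NormedSpace ℝ H₂]
  {A B : Type*} [TopologicalSpace A] [ChartedSpace H A] [TopologicalSpace B] [ChartedSpace H₂ B]
  [IsManifold 𝓘(ℝ, H₂) ∞ B]
  {ρ : B → M} {Φ : A → B} {p : A → M} {U : Set M} {φ : M → A} {Y C : A → Hom m H₂}
  {K : A → MV m H₂} {vol : M → Alt m (Base m)}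

/-- The tangent map of `Φ ∘ φ`, where `φ` is a section, is a right inverse of the tangent map of
the projection. -/
lemma IsSectionOn.tmap_comp_tmap (hφ : IsSectionOn m H p U φ) (hU : IsOpen U)
    (hρ : ContMDiff 𝓘(ℝ, H₂) 𝓘(ℝ, Base m) ∞ ρ) (hΦ : ContMDiff 𝓘(ℝ, H) 𝓘(ℝ, H₂) ∞ Φ)
    (hp : ∀ a, p a = ρ (Φ a)) {x : M} (hx : x ∈ U) :
    (tmap H₂ (Base m) ρ (Φ (φ x))).comp (tmap (Base m) H₂ (Φ ∘ φ) x) =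
      ContinuousLinearMap.id ℝ (Base m) := by
  have h1 : MDifferentiableAt 𝓘(ℝ, Base m) 𝓘(ℝ, H) φ x :=
    (hφ.smooth.contMDiffAt (hU.mem_nhds hx)).mdifferentiableAt (by simp)
  have h2 : MDifferentiableAt 𝓘(ℝ, Base m) 𝓘(ℝ, H₂) (Φ ∘ φ) x :=
    MDifferentiableAt.comp x (hΦ.mdifferentiable (by simp) (φ x)) h1
  have h3 := tmap_comp (g := ρ) (f := Φ ∘ φ) x (hρ.mdifferentiable (by simp) _) h2
  rw [tmap_eq_of_eqOn (f := ρ ∘ Φ ∘ φ) (g := id) hU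
    (fun y hy => (hp _).symm.trans (hφ.section_eq y hy)) hx, tmap_id] at h3
  exact h3.symm

/-- The tangent map of a section and the horizontal lift both split the projection, so equality of
their images is equality of the maps. -/
lemma isIntegralConn_iff (hU : IsOpen U) (hρ : ContMDiff 𝓘(ℝ, H₂) 𝓘(ℝ, Base m) ∞ ρ)
    (hΦ : ContMDiff 𝓘(ℝ, H) 𝓘(ℝ, H₂) ∞ Φ) (hp : ∀ a, p a = ρ (Φ a))
    (hY : ∀ a, (tmap H₂ (Base m) ρ (Φ a)).comp (Y a) = ContinuousLinearMap.id ℝ (Base m)) :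
    IsIntegralConn H H₂ p Φ Y U φ ↔ IsIntegralJet H H₂ p Φ Y U φ := by
  refine and_congr_right fun hφ => forall₂_congr fun x hx => ⟨fun h => ?_, fun h => by rw [h]⟩
  exact eq_of_range_eq (hφ.tmap_comp_tmap hU hρ hΦ hp hx) (hY _) h

/-- Among the multiples of `K` only `g K` can be the multivector of a splitting normalised by the
volume form. The unknown factor in the definition of an integral section is thus no extra freedom,
and `g` always serves as one. -/
lemma isIntegralMV_iff (hU : IsOpen U) (hρ : ContMDiff 𝓘(ℝ, H₂) 𝓘(ℝ, Base m) ∞ ρ)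
    (hΦ : ContMDiff 𝓘(ℝ, H) 𝓘(ℝ, H₂) ∞ Φ) (hp : ∀ a, p a = ρ (Φ a))
    (hY : ∀ a, (tmap H₂ (Base m) ρ (Φ a)).comp (Y a) = ContinuousLinearMap.id ℝ (Base m))
    {g : A → ℝ} (hg : ContMDiff 𝓘(ℝ, H) 𝓘(ℝ, ℝ) ∞ g) (hg_ne : ∀ a, g a ≠ 0)
    (hYK : ∀ a u, lmap m (Y a) u = (evalForm (vol (p a)) u * g a) • K a) :
    IsIntegralMV H H₂ vol p Φ K U φ ↔ IsIntegralJet H H₂ p Φ Y U φ := by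
  refine and_congr_right fun hφ => ⟨?_, fun h => ⟨g, hg, hg_ne, fun x hx u => ?_⟩⟩
  · rintro ⟨f, -, -, h⟩ x hx
    refine eq_of_lmap_eq_smul (c' := g (φ x)) (hφ.tmap_comp_tmap hU hρ hΦ hp hx) (hY _) (h x hx) fun u => ?_
    rw [hYK, hφ.section_eq x hx]
  · rw [h x hx, hYK, hφ.section_eq x hx]

/-- The connection form and the jet field associated with an `m`-vector field have the same
horizontal lifts. -/
lemma ConnectionAssociated.eq (hC : ConnectionAssociated H H₂ ρ Φ K C)
    (hY : JetAssociated H H₂ ρ Φ K Y) : C = Y := by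
  funext a
  have hR : Function.Surjective (tmap H₂ (Base m) ρ (Φ a)) := fun x =>
    ⟨Y a x, DFunLike.congr_fun (hY.1.right_inv a) x⟩
  exact eq_of_range_eq (comp_eq_id_of_semibasic hR (hC.1.semibasic a)) (hY.1.right_inv a)
    ((hC.2 a).trans (hY.2 a).symm)

lemma IsMVFieldAlong.exists_eq_ιMulti (hK : IsMVFieldAlong H H₂ ρ Φ K) (a : A) :
    ∃ v, K a = exteriorPower.ιMulti ℝ m v := by
  obtain ⟨U, -, ha, v, -, hv⟩ := hK.locally_decomposable a
  exact ⟨_, hv a ha⟩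

lemma JetAssociated.eq_lmap (hY : JetAssociated H H₂ ρ Φ K Y) (hK : IsMVFieldAlong H H₂ ρ Φ K)
    (a : A) : K a = lmap m (Y a) (lmap m (tmap H₂ (Base m) ρ (Φ a)) (K a)) :=
  eq_lmap_of_range_eq (hK.exists_eq_ιMulti a) (hK.ne_zero a) (hY.1.right_inv a) (hY.2 a)

/-- The multivectors of the horizontal subspaces of the associated jet field are the values of a
representative of the class of the `m`-vector field. -/
lemma JetAssociated.exists_density (hY : JetAssociated H H₂ ρ Φ K Y)
    (hK : IsMVFieldAlong H H₂ ρ Φ K) (hvol : IsSmoothForm vol) (hvol_ne : ∀ x, vol x ≠ 0)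
    (hρ : ContMDiff 𝓘(ℝ, H₂) 𝓘(ℝ, Base m) ∞ ρ) (hΦ : ContMDiff 𝓘(ℝ, H) 𝓘(ℝ, H₂) ∞ Φ) :
    ∃ g : A → ℝ, ContMDiff 𝓘(ℝ, H) 𝓘(ℝ, ℝ) ∞ g ∧ (∀ a, g a ≠ 0) ∧
      ∀ a u, lmap m (Y a) u = (evalForm (vol (ρ (Φ a))) u * g a) • K a := by
  have hne : ∀ a, evalForm (vol (ρ (Φ a))) (lmap m (tmap H₂ (Base m) ρ (Φ a)) (K a)) ≠ 0 :=
    fun a => evalForm_ne_zero (hvol_ne _) (hK.transverse a)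
  -- The density is forced by projecting to `M`: `ΛᵐTρ` must recover `u` itself. Transversality
  -- makes the inverted quantity non-zero, and a local decomposition of `K` makes it smooth.
  refine ⟨fun a => (evalForm (vol (ρ (Φ a))) (lmap m (tmap H₂ (Base m) ρ (Φ a)) (K a)))⁻¹,
    fun a => ?_, fun a => inv_ne_zero (hne a), fun a u => ?_⟩
  · obtain ⟨V, hV, ha, v, hv, hvK⟩ := hK.locally_decomposable a
    have h1 := contMDiffAt_apply_form (Φ := ρ ∘ Φ)
      (v := fun i b => tmap H₂ (Base m) ρ (Φ b) (v i b)) hvol hV (fun i => (hv i).map hρ)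
      (hρ.comp hΦ) ha
    refine ContMDiffAt.inv₀ ?_ (hne a)
    refine h1.congr_of_eventuallyEq ?_
    filter_upwards [hV.mem_nhds ha] with b hb
    rw [hvK b hb, lmap_ιMulti, evalForm_ιMulti]
    rfl
  · conv_rhs => rw [hY.eq_lmap hK a]
    rw [← map_smul]
    congr 1
    exact eq_smul_of_evalForm (hvol_ne _) (hK.transverse a) u

end Integral

/-! ### Transport of multivector fields and jet fields by a map over `M` -/

section Transport

variable {m : ℕ} {M : Type*} [TopologicalSpace M] [ChartedSpace (Base m) M]
  [IsManifold 𝓘(ℝ, Base m) ∞ M]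
  {HS : Type*} [NormedAddCommGroup HS] [NormedSpace ℝ HS]
  {HP : Type*} [NormedAddCommGroup HP] [NormedSpace ℝ HP]
  {HQ : Type*} [NormedAddCommGroup HQ] [NormedSpace ℝ HQ]
  {H : Type*} [NormedAddCommGroup H] [NormedSpace ℝ H]
  {S P Q B : Type*} [TopologicalSpace S] [ChartedSpace HS S] [TopologicalSpace P]
  [ChartedSpace HP P] [TopologicalSpace Q] [ChartedSpace HQ Q] [IsManifold 𝓘(ℝ, HQ) ∞ Q]
  [TopologicalSpace B] [ChartedSpace H B] [IsManifold 𝓘(ℝ, H) ∞ B]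
  {ρ : Q → M} {ρB : B → M} {jP : P → Q} {F : Q → B} {G : S → P} {Φ : S → B}
  {X : P → MV m HQ} {K : S → MV m H} {f : S → ℝ} {YX : P → Hom m HQ} {Y : S → Hom m H}

lemma tmap_comp_of_comp_eq (hF : ContMDiff 𝓘(ℝ, HQ) 𝓘(ℝ, H) ∞ F)
    (hρB : ContMDiff 𝓘(ℝ, H) 𝓘(ℝ, Base m) ∞ ρB) (hρ : ∀ q, ρB (F q) = ρ q) (q : Q) :
    (tmap H (Base m) ρB (F q)).comp (tmap HQ H F q) = tmap HQ (Base m) ρ q := by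
  have h := tmap_comp (g := ρB) (f := F) q (hρB.mdifferentiable (by simp) _)
    (hF.mdifferentiable (by simp) q)
  rw [← h, show ρB ∘ F = ρ from funext hρ]

/-- Because `F` covers the identity of `M`, the projection of the transported multivector is that of
`X` up to the factor `f`. This gives transversality, which in turn gives non-vanishing even though
`TF` is not assumed injective. -/
lemma IsMVFieldAlong.map_comp (hX : IsMVFieldAlong HP HQ ρ jP X) (hm : 1 ≤ m)
    (hF : ContMDiff 𝓘(ℝ, HQ) 𝓘(ℝ, H) ∞ F) (hρB : ContMDiff 𝓘(ℝ, H) 𝓘(ℝ, Base m) ∞ ρB)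
    (hρ : ∀ q, ρB (F q) = ρ q) (hG : ContMDiff 𝓘(ℝ, HS) 𝓘(ℝ, HP) ∞ G)
    (hf : ContMDiff 𝓘(ℝ, HS) 𝓘(ℝ, ℝ) ∞ f) (hf_ne : ∀ s, f s ≠ 0)
    (hΦ : ∀ s, Φ s = F (jP (G s)))
    (hK : ∀ s, K s = f s • lmap m (tmap HQ H F (jP (G s))) (X (G s))) :
    IsMVFieldAlong HS H ρB Φ K := by
  obtain rfl : Φ = F ∘ jP ∘ G := funext hΦ
  have htrans : ∀ s, lmap m (tmap H (Base m) ρB ((F ∘ jP ∘ G) s)) (K s) ≠ 0 := by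
    intro s
    rw [hK, map_smul, lmap_lmap]
    change f s • lmap m ((tmap H (Base m) ρB (F (jP (G s)))).comp _) _ ≠ 0
    rw [tmap_comp_of_comp_eq hF hρB hρ]
    exact smul_ne_zero (hf_ne s) (hX.transverse (G s))
  refine ⟨fun s h => htrans s (by rw [h, map_zero]), fun s => ?_, htrans⟩
  obtain ⟨V, hV, hs, v, hv, hvX⟩ := hX.locally_decomposable (G s)
  -- The factor `f` is absorbed into one vector of the decomposition; `1 ≤ m` guarantees that there
  -- is one.
  let i₀ : Fin m := ⟨0, hm⟩
  let w : Fin m → S → H := fun i s => tmap HQ H F (jP (G s)) (v i (G s))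
  have hw : ∀ i, IsSmoothVFOn HS H (F ∘ jP ∘ G) (w i) (G ⁻¹' V) := fun i =>
    IsSmoothVFOn.comp ((hv i).map hF) hG
  refine ⟨G ⁻¹' V, hV.preimage hG.continuous, hs,
    fun i s => if i = i₀ then f s • w i s else w i s, fun i => ?_, fun s hs => ?_⟩
  · by_cases hi : i = i₀
    · simp only [hi, if_true]
      exact (hw i₀).smul hf
    · simp only [hi, if_false]
      exact hw i
  · rw [hK, hvX _ hs, lmap_ιMulti]
    have h1 : (fun i => if i = i₀ then f s • w i s else w i s) =
        Function.update (fun i => w i s) i₀ (f s • w i₀ s) := by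
      funext i
      by_cases hi : i = i₀
      · subst hi
        simp
      · simp [hi]
    rw [h1, AlternatingMap.map_update_smul, Function.update_eq_self]

/-- Both sides split the projection of `B`, and both have the distribution of `K` as image. -/
lemma JetAssociated.eq_comp (hYX : JetAssociated HP HQ ρ jP X YX)
    (hX : IsMVFieldAlong HP HQ ρ jP X) (hY : JetAssociated HS H ρB Φ K Y)
    (hF : ContMDiff 𝓘(ℝ, HQ) 𝓘(ℝ, H) ∞ F) (hρB : ContMDiff 𝓘(ℝ, H) 𝓘(ℝ, Base m) ∞ ρB)
    (hρ : ∀ q, ρB (F q) = ρ q) (hf_ne : ∀ s, f s ≠ 0) (hΦ : ∀ s, Φ s = F (jP (G s)))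
    (hK : ∀ s, K s = f s • lmap m (tmap HQ H F (jP (G s))) (X (G s))) (s : S) :
    Y s = (tmap HQ H F (jP (G s))).comp (YX (G s)) := by
  have h1 : (tmap H (Base m) ρB (Φ s)).comp ((tmap HQ H F (jP (G s))).comp (YX (G s))) =
      ContinuousLinearMap.id ℝ (Base m) := by
    rw [hΦ, ← ContinuousLinearMap.comp_assoc, tmap_comp_of_comp_eq hF hρB hρ]
    exact hYX.1.right_inv (G s)
  refine eq_of_range_eq (hY.1.right_inv s) h1 ?_
  rw [hY.2, hK, distribution_smul (hf_ne s), hYX.eq_lmap hX (G s), lmap_lmap,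
    distribution_lmap (injective_of_comp_eq_id h1) (hX.transverse (G s))]

end Transport

/-! ### The correspondence of integral sections -/

section Correspondence

universe u v

variable {m N : ℕ} {M : Type v} [TopologicalSpace M] [ChartedSpace (Base m) M]
  [IsManifold 𝓘(ℝ, Base m) ∞ M]
  {E : Type u} [TopologicalSpace E] [ChartedSpace (Tot m N) E] {π : E → M}
  [SmoothFiberBundle m N π]
  {HS : Type*} [NormedAddCommGroup HS] [NormedSpace ℝ HS]
  {HP : Type*} [NormedAddCommGroup HP] [NormedSpace ℝ HP]
  {HQ : Type*} [NormedAddCommGroup HQ] [NormedSpace ℝ HQ]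
  {H : Type*} [NormedAddCommGroup H] [NormedSpace ℝ H]
  {S P Q B : Type*} [TopologicalSpace S] [ChartedSpace HS S] [TopologicalSpace P]
  [ChartedSpace HP P] [TopologicalSpace Q] [ChartedSpace HQ Q]
  [TopologicalSpace B] [ChartedSpace H B] {jS : S → J1 m N π} {G : S → P} {pS : S → M} {pP : P → M}

/-- Transfers the result for jet fields to multivector fields and connections, with the
characterisation of field operators supplied separately. -/
lemma IntegralCorrespondence.congr {IntK IntK' : Set M → (M → S) → Prop} {SemiK SemiK' : S → Prop}
    {OpK' : Prop} {IntX IntX' : Set M → (M → P) → Prop}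
    (h : IntegralCorrespondence (HS := HS) (HP := HP) jS G pS pP IntK SemiK (∀ s, SemiK s) IntX)
    (hK : ∀ U φ, IsOpen U → (IntK' U φ ↔ IntK U φ)) (hS : ∀ s, SemiK' s ↔ SemiK s)
    (hO : OpK' ↔ ∀ s, SemiK' s) (hX : ∀ U ψ, IsOpen U → (IntX' U ψ ↔ IntX U ψ)) :
    IntegralCorrespondence (HS := HS) (HP := HP) jS G pS pP IntK' SemiK' OpK' IntX' := by
  have hIK : Integrable pS IntK' ↔ Integrable pS IntK :=
    forall_congr' fun s => exists₂_congr fun U φ => and_congr_right fun hU => by rw [hK U φ hU]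
  have hIX : Integrable pP IntX' ↔ Integrable pP IntX :=
    forall_congr' fun s => exists₂_congr fun U φ => and_congr_right fun hU => by rw [hX U φ hU]
  refine ⟨fun h1 => hIX.2 (h.integrable_of_integrable (hIK.1 h1)), fun h1 => ?_,
    fun U φ hU h1 => (hX U _ hU).2 (h.integral_map U φ hU ((hK U φ hU).1 h1)),
    fun U ψ φ hU h1 h2 h3 => ?_, fun h1 => ?_, hO⟩
  · rw [hIK, hIX]
    exact h.integrable_iff h1
  · obtain ⟨h4, h5⟩ := h.integral_lift U ψ φ hU ((hX U ψ hU).1 h1) h2 h3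
    exact ⟨(hK U φ hU).2 h4, h5.trans (forall₂_congr fun x _ => (hS (φ x)).symm)⟩
  · have h2 := h.holonomic_iff (hIK.1 h1)
    rw [forall_congr' hS, ← h2]
    exact forall₂_congr fun U φ => forall_congr' fun hU => by rw [hK U φ hU]

variable {Φ : S → B} {F : Q → B} {jP : P → Q} {τ : B → E} {Y : S → Hom m H} {YX : P → Hom m HQ}

/-- Integral sections of jet fields along maps related by an immersion. -/
lemma isIntegralJet_comp_iff (hF : ContMDiff 𝓘(ℝ, HQ) 𝓘(ℝ, H) ∞ F)
    (hF_inj : ∀ q, Function.Injective (tmap HQ H F q)) (hG : ContMDiff 𝓘(ℝ, HS) 𝓘(ℝ, HP) ∞ G)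
    (hjP : ContMDiff 𝓘(ℝ, HP) 𝓘(ℝ, HQ) ∞ jP) (hΦ : ∀ s, Φ s = F (jP (G s)))
    (hY : ∀ s, Y s = (tmap HQ H F (jP (G s))).comp (YX (G s))) (hp : ∀ s, pP (G s) = pS s)
    {U : Set M} (hU : IsOpen U) {φ : M → S} :
    IsIntegralJet HS H pS Φ Y U φ ↔
      IsSectionOn m HS pS U φ ∧ IsIntegralJet HP HQ pP jP YX U (G ∘ φ) := by
  obtain rfl : Φ = F ∘ jP ∘ G := funext hΦ
  refine and_congr_right fun hφ => ?_
  have hψ : ContMDiffOn 𝓘(ℝ, Base m) 𝓘(ℝ, HP) ∞ (G ∘ φ) U := hG.comp_contMDiffOn hφ.smooth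
  have hsec : IsSectionOn m HP pP U (G ∘ φ) :=
    ⟨hψ, fun x hx => (hp (φ x)).trans (hφ.section_eq x hx)⟩
  rw [IsIntegralJet, and_iff_right hsec]
  refine forall₂_congr fun x hx => ?_
  have h1 : MDifferentiableAt 𝓘(ℝ, Base m) 𝓘(ℝ, HQ) (jP ∘ G ∘ φ) x :=
    MDifferentiableAt.comp x (hjP.mdifferentiable (by simp) _)
      ((hψ.contMDiffAt (hU.mem_nhds hx)).mdifferentiableAt (by simp))
  have h2 := tmap_comp (g := F) (f := jP ∘ G ∘ φ) x (hF.mdifferentiable (by simp) _) h1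
  have h3 : tmap (Base m) H ((F ∘ jP ∘ G) ∘ φ) x =
      (tmap HQ H F (jP (G (φ x)))).comp (tmap (Base m) HQ (jP ∘ G ∘ φ) x) := h2
  rw [h3, hY]
  -- Both sides carry the injective factor `TF`, which is cancelled.
  refine ⟨fun h => ?_, fun h => congrArg _ h⟩
  ext1 w
  exact hF_inj _ (DFunLike.congr_fun h w)

/-- An integral section of a jet field is holonomic if and only if the jet field is
semi-holonomic along it. -/
lemma isHolonomicOn_iff (hτ : ContMDiff 𝓘(ℝ, H) 𝓘(ℝ, Tot m N) ∞ τ)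
    (hΦ : ContMDiff 𝓘(ℝ, HS) 𝓘(ℝ, H) ∞ Φ) (hτΦ : ∀ s, τ (Φ s) = (jS s).proj)
    (hpS : ∀ s, pS s = π (jS s).proj) {U : Set M} (hU : IsOpen U) {φ : M → S}
    (hφ : IsIntegralJet HS H pS Φ Y U φ) :
    IsHolonomicOn U (jS ∘ φ) ↔ ∀ x ∈ U, IsSemiHolonomicJet H jS τ Φ Y (φ x) := by
  have hsm : ContMDiffOn 𝓘(ℝ, Base m) 𝓘(ℝ, H) ∞ (Φ ∘ φ) U := hΦ.comp_contMDiffOn hφ.1.smooth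
  -- The only possible underlying section of `π` is `τ ∘ Φ ∘ φ`, and integrality of `φ` makes its
  -- derivative `Tτ ∘ Y`.
  have key : ∀ φ₀ : M → E, (∀ x ∈ U, (jS (φ x)).proj = φ₀ x) → ∀ x ∈ U,
      tmap (Base m) (Tot m N) φ₀ x = (tmap H (Tot m N) τ (Φ (φ x))).comp (Y (φ x)) := by
    intro φ₀ h x hx
    have h1 := tmap_comp (g := τ) (f := Φ ∘ φ) x (hτ.mdifferentiable (by simp) _)
      ((hsm.contMDiffAt (hU.mem_nhds hx)).mdifferentiableAt (by simp))
    rw [tmap_eq_of_eqOn (f := φ₀) (g := τ ∘ Φ ∘ φ) hU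
      (fun y hy => (h y hy).symm.trans (hτΦ _).symm) hx, h1, hφ.2 x hx]
    rfl
  constructor
  · rintro ⟨φ₀, -, h⟩ x hx
    exact (key φ₀ (fun x hx => (h x hx).1) x hx).symm.trans (h x hx).2.symm
  · intro h
    refine ⟨fun x => (jS (φ x)).proj, ⟨?_, fun x hx => ?_⟩, fun x hx => ⟨rfl, ?_⟩⟩
    · exact (hτ.comp_contMDiffOn hsm).congr fun x _ => (hτΦ _).symm
    · exact (hpS _).symm.trans (hφ.1.section_eq x hx)
    · exact (h x hx).symm.trans (key _ (fun _ _ => rfl) x hx).symm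

/-- The common source of all six cases: it is used with `F = ĥ` for the extended objects and with `F
= j₀` for the restricted ones. -/
lemma integralCorrespondence_jet (hF : ContMDiff 𝓘(ℝ, HQ) 𝓘(ℝ, H) ∞ F)
    (hF_inj : ∀ q, Function.Injective (tmap HQ H F q)) (hG : ContMDiff 𝓘(ℝ, HS) 𝓘(ℝ, HP) ∞ G)
    (hG_surj : Function.Surjective G) (hjP : ContMDiff 𝓘(ℝ, HP) 𝓘(ℝ, HQ) ∞ jP)
    (hτ : ContMDiff 𝓘(ℝ, H) 𝓘(ℝ, Tot m N) ∞ τ) (hΦ : ∀ s, Φ s = F (jP (G s)))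
    (hY : ∀ s, Y s = (tmap HQ H F (jP (G s))).comp (YX (G s)))
    (hτΦ : ∀ s, τ (Φ s) = (jS s).proj) (hpS : ∀ s, pS s = π (jS s).proj)
    (hp : ∀ s, pP (G s) = pS s) :
    IntegralCorrespondence (HS := HS) (HP := HP) jS G pS pP (IsIntegralJet HS H pS Φ Y)
      (IsSemiHolonomicJet H jS τ Φ Y) (∀ s, IsSemiHolonomicJet H jS τ Φ Y s)
      (IsIntegralJet HP HQ pP jP YX) := by
  have hΦ' : ContMDiff 𝓘(ℝ, HS) 𝓘(ℝ, H) ∞ Φ := by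
    rw [show Φ = F ∘ jP ∘ G from funext hΦ]
    exact hF.comp (hjP.comp hG)
  have hiff : ∀ {U : Set M} {φ : M → S}, IsOpen U → (IsIntegralJet HS H pS Φ Y U φ ↔
      IsSectionOn m HS pS U φ ∧ IsIntegralJet HP HQ pP jP YX U (G ∘ φ)) := fun hU =>
    isIntegralJet_comp_iff hF hF_inj hG hjP hΦ hY hp hU
  have hcongr : ∀ {U : Set M} {ψ ψ' : M → P}, IsOpen U → (∀ x ∈ U, ψ' x = ψ x) →
      IsIntegralJet HP HQ pP jP YX U ψ → IsIntegralJet HP HQ pP jP YX U ψ' := by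
    intro U ψ ψ' hU h hψ
    refine ⟨⟨hψ.1.smooth.congr h, fun x hx => ?_⟩, fun x hx => ?_⟩
    · rw [h x hx]
      exact hψ.1.section_eq x hx
    · rw [h x hx, ← hψ.2 x hx]
      exact tmap_eq_of_eqOn hU (fun y hy => congrArg jP (h y hy)) hx
  have hlift : ∀ {U : Set M} {ψ : M → P} {φ : M → S}, IsOpen U →
      IsIntegralJet HP HQ pP jP YX U ψ → ContMDiffOn 𝓘(ℝ, Base m) 𝓘(ℝ, HS) ∞ φ U →
      (∀ x ∈ U, G (φ x) = ψ x) → IsIntegralJet HS H pS Φ Y U φ := by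
    intro U ψ φ hU hψ hφ h
    refine (hiff hU).2 ⟨⟨hφ, fun x hx => ?_⟩, hcongr hU h hψ⟩
    rw [← hp, h x hx]
    exact hψ.1.section_eq x hx
  have hmap : Integrable pS (IsIntegralJet HS H pS Φ Y) →
      Integrable pP (IsIntegralJet HP HQ pP jP YX) := by
    intro h p
    obtain ⟨s, rfl⟩ := hG_surj p
    obtain ⟨U, φ, hU, hs, hφ, hφs⟩ := h s
    refine ⟨U, G ∘ φ, hU, (hp s).symm ▸ hs, ((hiff hU).1 hφ).2, ?_⟩
    change G (φ (pP (G s))) = G s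
    rw [hp, hφs]
  have hhol : ∀ {U : Set M} {φ : M → S}, IsOpen U → IsIntegralJet HS H pS Φ Y U φ →
      (IsHolonomicOn U (jS ∘ φ) ↔ ∀ x ∈ U, IsSemiHolonomicJet H jS τ Φ Y (φ x)) :=
    fun hU hφ => isHolonomicOn_iff hτ hΦ' hτΦ hpS hU hφ
  refine ⟨hmap, fun hsub => ⟨hmap, fun h s => ?_⟩, fun U φ hU h => ((hiff hU).1 h).2,
    fun U ψ φ hU hψ hφ h => ⟨hlift hU hψ hφ h, hhol hU (hlift hU hψ hφ h)⟩,
    fun h => ⟨fun h1 s => ?_, fun h1 U φ hU hφ => (hhol hU hφ).2 fun x _ => h1 (φ x)⟩, Iff.rfl⟩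
  · obtain ⟨U, ψ, hU, hs, hψ, hψs⟩ := h (G s)
    -- The integral section through `G s` is lifted by a local section of `G` chosen through `s`,
    -- after shrinking its domain so that it lands in the domain of `σ`.
    obtain ⟨V, σ, hV, hsV, hσs, hσ, hσ'⟩ := exists_section_of_isSubmersion hsub s
    have hU' : IsOpen (U ∩ ψ ⁻¹' V) := hψ.1.smooth.continuousOn.isOpen_inter_preimage hU hV
    have hψ' : IsIntegralJet HP HQ pP jP YX (U ∩ ψ ⁻¹' V) ψ :=
      ⟨⟨hψ.1.smooth.mono inter_subset_left, fun x hx => hψ.1.section_eq x hx.1⟩,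
        fun x hx => hψ.2 x hx.1⟩
    rw [hp] at hs hψs
    refine ⟨U ∩ ψ ⁻¹' V, σ ∘ ψ, hU', ⟨hs, ?_⟩, hlift hU' hψ' (hσ.comp hψ'.1.smooth fun x hx => hx.2)
      fun x hx => hσ' _ hx.2, ?_⟩
    · change ψ (pS s) ∈ V
      rwa [hψs]
    · change σ (ψ (pS s)) = s
      rw [hψs, hσs]
  -- Integrability supplies an integral section through `s`; its holonomy gives semi-holonomy at
  -- `s`.
  · obtain ⟨U, φ, hU, hs, hφ, hφs⟩ := h s
    have h2 := (hhol hU hφ).1 (h1 U φ hU hφ) _ hs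
    rwa [hφs] at h2

/-- Semi-holonomy of an `m`-vector field and of the associated jet field. -/
lemma isSemiHolonomicMV_iff {K : S → MV m H} {α : Alt m (Base m)} (hα : α ≠ 0) {g : ℝ} {s : S}
    (hτΦ : τ (Φ s) = (jS s).proj)
    (hY : ((dproj m N π (τ (Φ s))).comp (tmap H (Tot m N) τ (Φ s))).comp (Y s) =
      ContinuousLinearMap.id ℝ (Base m)) (hg : g ≠ 0)
    (hYK : ∀ u, lmap m (Y s) u = (evalForm α u * g) • K s) :
    IsSemiHolonomicMV H jS τ Φ K s ↔ IsSemiHolonomicJet H jS τ Φ Y s := by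
  have hc : evalForm α (stdMV m) * g ≠ 0 := mul_ne_zero (evalForm_ne_zero hα stdMV_ne_zero) hg
  have h1 : K s = (evalForm α (stdMV m) * g)⁻¹ • lmap m (Y s) (stdMV m) := by
    rw [hYK, inv_smul_smul₀ hc]
  rw [ContinuousLinearMap.comp_assoc, hτΦ] at hY
  rw [IsSemiHolonomicMV, h1, map_smul, distribution_smul (inv_ne_zero hc), lmap_lmap,
    distribution_lmap (injective_of_comp_eq_id hY) stdMV_ne_zero]
  refine ⟨fun h => ?_, fun h => ?_⟩
  -- The projected jet `Tτ ∘ Y(s)` and the jet `j_S(s)` both split `Tπ`.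
  · exact eq_of_range_eq hY (jS s).2.2 h
  · rw [h]

end Correspondence

/-! ### Field operators -/

section Contraction

variable {m n : ℕ} {H : Type*} [NormedAddCommGroup H] [NormedSpace ℝ H]
  {H₂ : Type*} [NormedAddCommGroup H₂] [NormedSpace ℝ H₂]

lemma curryLeft_compContinuousLinearMap (Ω : Alt (n + 1) H₂) (T : H →L[ℝ] H₂) (w : H) :
    (Ω.compContinuousLinearMap T).curryLeft w =
      (Ω.curryLeft (T w)).compContinuousLinearMap T := by
  ext v
  change Ω (fun i => T (Matrix.vecCons w v i)) = Ω (Matrix.vecCons (T w) fun i => T (v i))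
  congr 1
  funext i
  exact Fin.cases rfl (fun _ => rfl) i

/-- Passes from the field equation for a multivector to the one for its jet: the values of the
pulled-back form are values of `α` on multiples of `X`. -/
lemma compContinuousLinearMap_eq_zero {α : Alt m H} {Y : Base m →L[ℝ] H} {X : MV m H}
    (hY : ∀ u, ∃ c : ℝ, lmap m Y u = c • X) (hα : evalForm α X = 0) :
    α.compContinuousLinearMap Y = 0 := by
  ext v
  obtain ⟨c, hc⟩ := hY (exteriorPower.ιMulti ℝ m v)
  rw [← evalForm_ιMulti, ← evalForm_lmap, hc, map_smul, hα, smul_zero]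
  rfl

end Contraction

/-! ### Field equations and semi-holonomy along the Legendre maps -/

section Operators

universe u v

variable {m N : ℕ} {M : Type v} [TopologicalSpace M] [ChartedSpace (Base m) M]
  [IsManifold 𝓘(ℝ, Base m) ∞ M]
  {E : Type u} [TopologicalSpace E] [ChartedSpace (Tot m N) E] {π : E → M}
  [SmoothFiberBundle m N π]
  {vol : M → Alt m (Base m)} {L : J1 m N π → ℝ}
  {HS S : Type*} [NormedAddCommGroup HS] [NormedSpace ℝ HS] [TopologicalSpace S]
  [ChartedSpace HS S] {jS : S → J1 m N π}

lemma tmap_proj_comp_tmap_mu (q : MPi m N π) :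
    (tmap (J1DualTot m N) (Tot m N) (J1Dual.proj (m := m) (N := N) (π := π)) (mu q)).comp
      (tmap (MPiTot m N) (J1DualTot m N) mu q) = tmap (MPiTot m N) (Tot m N) MPi.proj q := by
  have h1 : MDifferentiable 𝓘(ℝ, MPiTot m N) 𝓘(ℝ, J1DualTot m N) (mu (m := m) (N := N) (π := π)) :=
    (contMDiff_mu (m := m) (N := N) (π := π)).mdifferentiable (by simp)
  have h2 : MDifferentiable 𝓘(ℝ, J1DualTot m N) 𝓘(ℝ, Tot m N)
      (J1Dual.proj (m := m) (N := N) (π := π)) :=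
    (contMDiff_J1Dual_proj (m := m) (N := N) (π := π)).mdifferentiable (by simp)
  exact (tmap_comp q (h2 _) (h1 q)).symm

/-- Since `τ = τ¹ ∘ μ`, nothing that semi-holonomy sees is lost under `μ`. -/
lemma isSemiHolonomicMV_restrictMV (K : S → MV m (MPiTot m N)) (s : S) :
    IsSemiHolonomicMV (J1DualTot m N) jS J1Dual.proj (legendre vol L ∘ jS)
      (restrictMV vol L jS K) s ↔
    IsSemiHolonomicMV (MPiTot m N) jS MPi.proj (extLegendre vol L ∘ jS) K s := by
  have h := tmap_proj_comp_tmap_mu (extLegendre vol L (jS s))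
  have h1 : lmap m (tmap (J1DualTot m N) (Tot m N) J1Dual.proj ((legendre vol L ∘ jS) s))
      (restrictMV vol L jS K s) =
      lmap m (tmap (MPiTot m N) (Tot m N) MPi.proj ((extLegendre vol L ∘ jS) s)) (K s) :=
    (lmap_lmap _ _ _).trans (congrArg (fun F => lmap m F (K s)) h)
  rw [IsSemiHolonomicMV, IsSemiHolonomicMV, h1]

lemma isSemiHolonomicJet_restrictJet (Y : S → Hom m (MPiTot m N)) (s : S) :
    IsSemiHolonomicJet (J1DualTot m N) jS J1Dual.proj (legendre vol L ∘ jS)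
      (restrictJet vol L jS Y) s ↔
    IsSemiHolonomicJet (MPiTot m N) jS MPi.proj (extLegendre vol L ∘ jS) Y s := by
  have h := tmap_proj_comp_tmap_mu (extLegendre vol L (jS s))
  have h1 : (tmap (J1DualTot m N) (Tot m N) J1Dual.proj ((legendre vol L ∘ jS) s)).comp
      (restrictJet vol L jS Y s) =
      (tmap (MPiTot m N) (Tot m N) MPi.proj ((extLegendre vol L ∘ jS) s)).comp (Y s) :=
    (ContinuousLinearMap.comp_assoc _ _ _).symm.trans
      (congrArg (fun F : MPiTot m N →L[ℝ] Tot m N => F.comp (Y s)) h)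
  rw [IsSemiHolonomicJet, IsSemiHolonomicJet, h1]

/-- A restricted operator may come from an extended one other than `K`; this is harmless because
semi-holonomy depends only on the image under `μ`. -/
lemma isRestrictedMVOperator_iff {K : S → MV m (MPiTot m N)}
    (hK : IsExtMVOperator vol L HS jS K ↔
      ∀ s, IsSemiHolonomicMV (MPiTot m N) jS MPi.proj (extLegendre vol L ∘ jS) K s) :
    IsRestrictedMVOperator vol L jS HS (restrictMV vol L jS K) ↔
      ∀ s, IsSemiHolonomicMV (J1DualTot m N) jS J1Dual.proj (legendre vol L ∘ jS)
        (restrictMV vol L jS K) s := by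
  refine ⟨?_, fun h => ⟨K, hK.2 fun s => (isSemiHolonomicMV_restrictMV K s).1 (h s), rfl⟩⟩
  rintro ⟨K', hK', h⟩ s
  rw [h, isSemiHolonomicMV_restrictMV]
  exact hK'.semiHolonomic s

lemma isRestrictedJetOperator_iff {Y : S → Hom m (MPiTot m N)}
    (hY : IsExtJetOperator vol L HS jS Y ↔
      ∀ s, IsSemiHolonomicJet (MPiTot m N) jS MPi.proj (extLegendre vol L ∘ jS) Y s) :
    IsRestrictedJetOperator vol L jS HS (restrictJet vol L jS Y) ↔
      ∀ s, IsSemiHolonomicJet (J1DualTot m N) jS J1Dual.proj (legendre vol L ∘ jS)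
        (restrictJet vol L jS Y) s := by
  refine ⟨?_, fun h => ⟨Y, hY.2 fun s => (isSemiHolonomicJet_restrictJet Y s).1 (h s), rfl⟩⟩
  rintro ⟨Y', hY', h⟩ s
  rw [h, isSemiHolonomicJet_restrictJet]
  exact hY'.semiHolonomic s

lemma isRestrictedConnOperator_iff {C : S → Hom m (MPiTot m N)}
    (hC : IsExtConnOperator vol L HS jS C ↔
      ∀ s, IsSemiHolonomicJet (MPiTot m N) jS MPi.proj (extLegendre vol L ∘ jS) C s) :
    IsRestrictedConnOperator vol L jS HS (restrictJet vol L jS C) ↔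
      ∀ s, IsSemiHolonomicJet (J1DualTot m N) jS J1Dual.proj (legendre vol L ∘ jS)
        (restrictJet vol L jS C) s := by
  refine ⟨?_, fun h => ⟨C, hC.2 fun s => (isSemiHolonomicJet_restrictJet C s).1 (h s), rfl⟩⟩
  rintro ⟨C', hC', h⟩ s
  rw [h, isSemiHolonomicJet_restrictJet]
  exact hC'.semiHolonomic s

namespace IsAlmostRegular

variable {HQ : Type*} [NormedAddCommGroup HQ] [NormedSpace ℝ HQ]
  {Q : Type*} [TopologicalSpace Q] [ChartedSpace HQ Q] [IsManifold 𝓘(ℝ, HQ) ∞ Q]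
  {HP P : Type*} [NormedAddCommGroup HP] [NormedSpace ℝ HP] [TopologicalSpace P]
  [ChartedSpace HP P] {j₀ : Q → J1Dual m N π} {FL₀ : J1 m N π → Q} {jP : P → Q} {FLS : S → P}
  {X : P → MV m HQ} {K : S → MV m (MPiTot m N)} {f : S → ℝ} {YX : P → Hom m HQ}
  {Y : S → Hom m (MPiTot m N)}

/-- Through this factorisation the field equations on `J¹E` follow from those for `ĥ^*Ω`. -/
lemma tLegendre_eq (hreg : IsAlmostRegular vol L HQ j₀ FL₀) (hvol : IsSmoothForm vol)
    (hvol_ne : ∀ x, vol x ≠ 0) (hL : ContMDiff 𝓘(ℝ, J1Model m N) 𝓘(ℝ, ℝ) ∞ L) (a : J1 m N π) :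
    tLegendre vol L a = (tmap HQ (MPiTot m N) (hMap vol L hreg.surjective) (FL₀ a)).comp
      (tmap (J1Model m N) HQ FL₀ a) := by
  have h1 := (hreg.contMDiff_hMap hvol hvol_ne hL).mdifferentiable (by simp)
  have h2 := hreg.submersion.contMDiff.mdifferentiable (by simp)
  have h3 : hMap vol L hreg.surjective ∘ FL₀ = extLegendre vol L :=
    funext (hreg.hMap_comp hvol_ne hL)
  have h4 := tmap_comp a (h1 _) (h2 a)
  rw [h3] at h4
  exact h4

lemma proj_hMap (hreg : IsAlmostRegular vol L HQ j₀ FL₀) (q : Q) :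
    (π ∘ MPi.proj) (hMap vol L hreg.surjective q) = π (j₀ q).proj :=
  congrArg (fun r => π (J1Dual.proj r)) (hreg.mu_hMap q)

lemma extLegendre_comp_eq (hreg : IsAlmostRegular vol L HQ j₀ FL₀) (hvol_ne : ∀ x, vol x ≠ 0)
    (hL : ContMDiff 𝓘(ℝ, J1Model m N) 𝓘(ℝ, ℝ) ∞ L) (hFLS : ∀ s, jP (FLS s) = FL₀ (jS s)) (s : S) :
    extLegendre vol L (jS s) = hMap vol L hreg.surjective (jP (FLS s)) := by
  rw [hFLS, hreg.hMap_comp hvol_ne hL]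

/-- The pull-back by `ĥ` of the canonical form satisfies the field equation. -/
lemma evalForm_canonicalForm_hMap {ρ : Q → M} (hreg : IsAlmostRegular vol L HQ j₀ FL₀)
    (hX : IsHDW HP ρ (hMap vol L hreg.surjective) jP X) (p : P) (w : HQ) :
    evalForm ((canonicalForm (hMap vol L hreg.surjective (jP p))).curryLeft
      (tmap HQ (MPiTot m N) (hMap vol L hreg.surjective) (jP p) w))
      (lmap m (tmap HQ (MPiTot m N) (hMap vol L hreg.surjective) (jP p)) (X p)) = 0 := by
  rw [evalForm_lmap, ← curryLeft_compContinuousLinearMap]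
  exact hX.field_eq p w

/-- The field equation holds for free: vectors and multivector alike are images under `Tĥ`, so the
contraction is one of `ĥ^*Ω` with a multiple of `X`. -/
lemma isExtMVOperator_iff {ρ : Q → M} (hreg : IsAlmostRegular vol L HQ j₀ FL₀)
    (hvol : IsSmoothForm vol) (hvol_ne : ∀ x, vol x ≠ 0)
    (hL : ContMDiff 𝓘(ℝ, J1Model m N) 𝓘(ℝ, ℝ) ∞ L) (hFLS : ∀ s, jP (FLS s) = FL₀ (jS s))
    (hX : IsHDW HP ρ (hMap vol L hreg.surjective) jP X)
    (hKs : IsMVFieldAlong HS (MPiTot m N) (π ∘ MPi.proj) (extLegendre vol L ∘ jS) K)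
    (hK : ∀ s, K s =
      f s • lmap m (tmap HQ (MPiTot m N) (hMap vol L hreg.surjective) (jP (FLS s))) (X (FLS s))) :
    IsExtMVOperator vol L HS jS K ↔
      ∀ s, IsSemiHolonomicMV (MPiTot m N) jS MPi.proj (extLegendre vol L ∘ jS) K s := by
  refine ⟨fun h => h.semiHolonomic, fun h => ⟨hKs, fun s w => ?_, h⟩⟩
  rw [hK, map_smul, hreg.tLegendre_eq hvol hvol_ne hL, hreg.extLegendre_comp_eq hvol_ne hL hFLS,
    ← hFLS]
  have h1 := hreg.evalForm_canonicalForm_hMap hX (FLS s) (tmap (J1Model m N) HQ FL₀ (jS s) w)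
  exact smul_eq_zero_of_right _ h1

lemma compContinuousLinearMap_canonicalForm_hMap {ρ : Q → M}
    (hreg : IsAlmostRegular vol L HQ j₀ FL₀) (hX : IsHDW HP ρ (hMap vol L hreg.surjective) jP X)
    {p : P} {Z : Base m →L[ℝ] HQ} (hZ : ∀ u, ∃ c : ℝ, lmap m Z u = c • X p) (w : HQ) :
    ((canonicalForm (hMap vol L hreg.surjective (jP p))).curryLeft
      (tmap HQ (MPiTot m N) (hMap vol L hreg.surjective) (jP p) w)).compContinuousLinearMap
      ((tmap HQ (MPiTot m N) (hMap vol L hreg.surjective) (jP p)).comp Z) = 0 := by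
  refine compContinuousLinearMap_eq_zero (fun u => ?_) (hreg.evalForm_canonicalForm_hMap hX p w)
  obtain ⟨c, hc⟩ := hZ u
  exact ⟨c, by rw [← lmap_lmap, hc, map_smul]⟩

lemma isExtJetOperator_iff {ρ : Q → M} (hreg : IsAlmostRegular vol L HQ j₀ FL₀)
    (hvol : IsSmoothForm vol) (hvol_ne : ∀ x, vol x ≠ 0)
    (hL : ContMDiff 𝓘(ℝ, J1Model m N) 𝓘(ℝ, ℝ) ∞ L) (hFLS : ∀ s, jP (FLS s) = FL₀ (jS s))
    (hX : IsHDW HP ρ (hMap vol L hreg.surjective) jP X)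
    (hYX : ∀ p u, ∃ c : ℝ, lmap m (YX p) u = c • X p)
    (hYs : IsJetFieldAlong HS (MPiTot m N) (π ∘ MPi.proj) (extLegendre vol L ∘ jS) Y)
    (hY : ∀ s, Y s =
      (tmap HQ (MPiTot m N) (hMap vol L hreg.surjective) (jP (FLS s))).comp (YX (FLS s))) :
    IsExtJetOperator vol L HS jS Y ↔
      ∀ s, IsSemiHolonomicJet (MPiTot m N) jS MPi.proj (extLegendre vol L ∘ jS) Y s := by
  refine ⟨fun h => h.semiHolonomic, fun h => ⟨hYs, fun s w => ?_, h⟩⟩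
  rw [hY, hreg.tLegendre_eq hvol hvol_ne hL, hreg.extLegendre_comp_eq hvol_ne hL hFLS, ← hFLS]
  exact hreg.compContinuousLinearMap_canonicalForm_hMap hX (hYX (FLS s))
    (tmap (J1Model m N) HQ FL₀ (jS s) w)

lemma isExtConnOperator_iff {ρ : Q → M} (hreg : IsAlmostRegular vol L HQ j₀ FL₀)
    (hvol : IsSmoothForm vol) (hvol_ne : ∀ x, vol x ≠ 0)
    (hL : ContMDiff 𝓘(ℝ, J1Model m N) 𝓘(ℝ, ℝ) ∞ L) (hFLS : ∀ s, jP (FLS s) = FL₀ (jS s))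
    (hX : IsHDW HP ρ (hMap vol L hreg.surjective) jP X)
    (hYX : ∀ p u, ∃ c : ℝ, lmap m (YX p) u = c • X p)
    (hYs : IsConnectionAlong HS (MPiTot m N) (π ∘ MPi.proj) (extLegendre vol L ∘ jS) Y)
    (hYr : ∀ s, (tmap (MPiTot m N) (Base m) (π ∘ MPi.proj) (extLegendre vol L (jS s))).comp (Y s) =
      ContinuousLinearMap.id ℝ (Base m))
    (hY : ∀ s, Y s =
      (tmap HQ (MPiTot m N) (hMap vol L hreg.surjective) (jP (FLS s))).comp (YX (FLS s))) :
    IsExtConnOperator vol L HS jS Y ↔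
      ∀ s, IsSemiHolonomicJet (MPiTot m N) jS MPi.proj (extLegendre vol L ∘ jS) Y s := by
  refine ⟨fun h => h.semiHolonomic, fun h => ⟨hYs, fun s => ?_, h⟩⟩
  have h1 := hYr s
  rw [hY, hreg.extLegendre_comp_eq hvol_ne hL hFLS, ← ContinuousLinearMap.comp_assoc] at h1
  -- The identity is obtained on the tangent space of `𝒫` with `T = Tĥ`; composing with `TFL₀` then
  -- gives the pull-back by the extended Legendre map.
  have h2 := fderivComp_projector_sub
    (canonicalForm (hMap vol L hreg.surjective (jP (FLS s))))
    (tmap (MPiTot m N) (Base m) (π ∘ MPi.proj) (hMap vol L hreg.surjective (jP (FLS s))))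
    (tmap HQ (MPiTot m N) (hMap vol L hreg.surjective) (jP (FLS s))) (YX (FLS s)) h1
    (fun w i j k hij hik hjk hi hj hk =>
      canonicalForm_eq_zero_of_vertical _ w hij hik hjk hi hj hk)
    (hreg.compContinuousLinearMap_canonicalForm_hMap hX (hYX (FLS s)))
  rw [hY, hreg.tLegendre_eq hvol hvol_ne hL, hreg.extLegendre_comp_eq hvol_ne hL hFLS, ← hFLS]
  ext v
  exact DFunLike.congr_fun h2 fun i => tmap (J1Model m N) HQ FL₀ (jS s) (v i)

end IsAlmostRegular

end Operators

end FieldTheory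

/-! ### The six correspondences -/

set_option maxHeartbeats 1000000 in
theorem mainTheorem4 {m N : ℕ} (hm : 1 ≤ m)
    {M : Type*} [TopologicalSpace M] [ChartedSpace (Base m) M] [IsManifold 𝓘(ℝ, Base m) ∞ M]
    {E : Type*} [TopologicalSpace E] [ChartedSpace (Tot m N) E] [IsManifold 𝓘(ℝ, Tot m N) ∞ E]
    (π : E → M) [SmoothFiberBundle m N π]
    (vol : M → Base m [⋀^Fin m]→L[ℝ] ℝ) (hvol : IsSmoothForm vol) (hvol_ne : ∀ x, vol x ≠ 0)
    (L : J1 m N π → ℝ) (hL : ContMDiff 𝓘(ℝ, J1Model m N) 𝓘(ℝ, ℝ) ∞ L)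
    {HQ : Type*} [NormedAddCommGroup HQ] [NormedSpace ℝ HQ] [FiniteDimensional ℝ HQ]
    {Q : Type*} [TopologicalSpace Q] [ChartedSpace HQ Q] [IsManifold 𝓘(ℝ, HQ) ∞ Q]
    {HS : Type*} [NormedAddCommGroup HS] [NormedSpace ℝ HS] [FiniteDimensional ℝ HS]
    {S : Type*} [TopologicalSpace S] [ChartedSpace HS S] [IsManifold 𝓘(ℝ, HS) ∞ S]
    {HP : Type*} [NormedAddCommGroup HP] [NormedSpace ℝ HP] [FiniteDimensional ℝ HP]
    {P : Type*} [TopologicalSpace P] [ChartedSpace HP P] [IsManifold 𝓘(ℝ, HP) ∞ P]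
    (j₀ : Q → J1Dual m N π) (FL₀ : J1 m N π → Q) (hreg : IsAlmostRegular vol L HQ j₀ FL₀)
    (jS : S → J1 m N π) (hjS : Manifold.IsSmoothEmbedding 𝓘(ℝ, HS) 𝓘(ℝ, J1Model m N) ∞ jS)
    (jP : P → Q) (hjP : Manifold.IsSmoothEmbedding 𝓘(ℝ, HP) 𝓘(ℝ, HQ) ∞ jP)
    (FLS : S → P) (hFLS_smooth : ContMDiff 𝓘(ℝ, HS) 𝓘(ℝ, HP) ∞ FLS)
    (hFLS_surj : Function.Surjective FLS) (hFLS : ∀ s, jP (FLS s) = FL₀ (jS s))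
    (X : P → MV m HQ)
    (hX : IsHDW HP (fun q => π (j₀ q).proj) (hMap vol L hreg.surjective) jP X)
    (K : S → MV m (MPiTot m N))
    (f : S → ℝ) (hf : ContMDiff 𝓘(ℝ, HS) 𝓘(ℝ, ℝ) ∞ f) (hf_ne : ∀ s, f s ≠ 0)
    (hK : ∀ s, K s =
      f s • lmap m (tmap HQ (MPiTot m N) (hMap vol L hreg.surjective) (jP (FLS s))) (X (FLS s)))
    (YX : P → Hom m HQ) (hYX : JetAssociated HP HQ (fun q => π (j₀ q).proj) jP X YX)
    (CX : P → Hom m HQ) (hCX : ConnectionAssociated HP HQ (fun q => π (j₀ q).proj) jP X CX)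
    (Y : S → Hom m (MPiTot m N))
    (hY : JetAssociated HS (MPiTot m N) (π ∘ MPi.proj) (extLegendre vol L ∘ jS) K Y)
    (C : S → Hom m (MPiTot m N))
    (hC : ConnectionAssociated HS (MPiTot m N) (π ∘ MPi.proj) (extLegendre vol L ∘ jS) K C) :
    let pS : S → M := fun s => π (jS s).proj
    let pP : P → M := fun p => π (j₀ (jP p)).proj
    let ΦS : S → MPi m N π := extLegendre vol L ∘ jS
    let ΨS : S → J1Dual m N π := legendre vol L ∘ jS
    let K₁ : S → MV m (J1DualTot m N) := restrictMV vol L jS K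
    let Y₁ : S → Hom m (J1DualTot m N) := restrictJet vol L jS Y
    let C₁ : S → Hom m (J1DualTot m N) := restrictJet vol L jS C
    IntegralCorrespondence (HS := HS) (HP := HP) jS FLS pS pP (IsIntegralMV HS (J1DualTot m N) vol pS ΨS K₁)
      (IsSemiHolonomicMV (J1DualTot m N) jS J1Dual.proj ΨS K₁)
      (IsRestrictedMVOperator vol L jS HS K₁) (IsIntegralMV HP HQ vol pP jP X) ∧
    IntegralCorrespondence (HS := HS) (HP := HP) jS FLS pS pP (IsIntegralJet HS (J1DualTot m N) pS ΨS Y₁)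
      (IsSemiHolonomicJet (J1DualTot m N) jS J1Dual.proj ΨS Y₁)
      (IsRestrictedJetOperator vol L jS HS Y₁) (IsIntegralJet HP HQ pP jP YX) ∧
    IntegralCorrespondence (HS := HS) (HP := HP) jS FLS pS pP (IsIntegralConn HS (J1DualTot m N) pS ΨS C₁)
      (IsSemiHolonomicJet (J1DualTot m N) jS J1Dual.proj ΨS C₁)
      (IsRestrictedConnOperator vol L jS HS C₁) (IsIntegralConn HP HQ pP jP CX) ∧
    IntegralCorrespondence (HS := HS) (HP := HP) jS FLS pS pP (IsIntegralMV HS (MPiTot m N) vol pS ΦS K)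
      (IsSemiHolonomicMV (MPiTot m N) jS MPi.proj ΦS K)
      (IsExtMVOperator vol L HS jS K) (IsIntegralMV HP HQ vol pP jP X) ∧
    IntegralCorrespondence (HS := HS) (HP := HP) jS FLS pS pP (IsIntegralJet HS (MPiTot m N) pS ΦS Y)
      (IsSemiHolonomicJet (MPiTot m N) jS MPi.proj ΦS Y)
      (IsExtJetOperator vol L HS jS Y) (IsIntegralJet HP HQ pP jP YX) ∧
    IntegralCorrespondence (HS := HS) (HP := HP) jS FLS pS pP (IsIntegralConn HS (MPiTot m N) pS ΦS C)
      (IsSemiHolonomicJet (MPiTot m N) jS MPi.proj ΦS C)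
      (IsExtConnOperator vol L HS jS C) (IsIntegralConn HP HQ pP jP CX) := by
  intro pS pP ΦS ΨS K₁ Y₁ C₁
  -- From here on connection forms and jet fields are the same maps, on `P` and on `S`.
  obtain rfl := hCX.eq hYX
  obtain rfl := hC.eq hY
  set h := hMap vol L hreg.surjective with hh
  have hh_smooth : ContMDiff 𝓘(ℝ, HQ) 𝓘(ℝ, MPiTot m N) ∞ h :=
    hreg.contMDiff_hMap hvol hvol_ne hL
  have hj₀ : ContMDiff 𝓘(ℝ, HQ) 𝓘(ℝ, J1DualTot m N) ∞ j₀ := hreg.embedding.isImmersion.contMDiff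
  have hjP' : ContMDiff 𝓘(ℝ, HP) 𝓘(ℝ, HQ) ∞ jP := hjP.isImmersion.contMDiff
  have hρM : ContMDiff 𝓘(ℝ, MPiTot m N) 𝓘(ℝ, Base m) ∞ (π ∘ MPi.proj) :=
    contMDiff_comp_MPi_proj (m := m) (N := N) (π := π)
  have hρD : ContMDiff 𝓘(ℝ, J1DualTot m N) 𝓘(ℝ, Base m) ∞ (π ∘ J1Dual.proj) :=
    ContMDiff.comp (SmoothFiberBundle.contMDiff (m := m) (N := N) (π := π))
      (contMDiff_J1Dual_proj (m := m) (N := N) (π := π))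
  have hρ : ContMDiff 𝓘(ℝ, HQ) 𝓘(ℝ, Base m) ∞ (fun q => π (j₀ q).proj) := hρD.comp hj₀
  have hρh : ∀ q, (π ∘ MPi.proj) (h q) = π (j₀ q).proj := hreg.proj_hMap
  have hΦS : ∀ s, ΦS s = h (jP (FLS s)) := hreg.extLegendre_comp_eq hvol_ne hL hFLS
  have hΨS : ∀ s, ΨS s = j₀ (jP (FLS s)) := fun s => by
    rw [hFLS, hreg.comp_eq]
    rfl
  have hp : ∀ s, pP (FLS s) = pS s := fun s => congrArg (fun q => π (J1Dual.proj q)) (hΨS s).symm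
  have hΦS_smooth : ContMDiff 𝓘(ℝ, HS) 𝓘(ℝ, MPiTot m N) ∞ ΦS := by
    rw [show ΦS = h ∘ jP ∘ FLS from funext hΦS]
    exact hh_smooth.comp (hjP'.comp hFLS_smooth)
  have hΨS_smooth : ContMDiff 𝓘(ℝ, HS) 𝓘(ℝ, J1DualTot m N) ∞ ΨS := by
    rw [show ΨS = j₀ ∘ jP ∘ FLS from funext hΨS]
    exact hj₀.comp (hjP'.comp hFLS_smooth)
  obtain ⟨gX, hgX, hgX_ne, hYX_lmap⟩ :=
    hYX.exists_density hX.structural hvol hvol_ne hρ hjP'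
  have hKs : IsMVFieldAlong HS (MPiTot m N) (π ∘ MPi.proj) ΦS K :=
    hX.structural.map_comp hm hh_smooth hρM hρh hFLS_smooth hf hf_ne hΦS hK
  obtain ⟨g, hg, hg_ne, hY_lmap⟩ := hY.exists_density hKs hvol hvol_ne hρM hΦS_smooth
  have hYh : ∀ s, C s = (tmap HQ (MPiTot m N) h (jP (FLS s))).comp (CX (FLS s)) :=
    hYX.eq_comp hX.structural hY hh_smooth hρM hρh hf_ne hΦS hK
  have hYj : ∀ s, C₁ s = (tmap HQ (J1DualTot m N) j₀ (jP (FLS s))).comp (CX (FLS s)) := by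
    intro s
    have h1 := hreg.tmap_mu_comp_tmap_hMap hvol hvol_ne hL (jP (FLS s))
    rw [← h1]
    change (tmap _ _ mu (ΦS s)).comp (C s) = _
    rw [hYh, hΦS]
    rfl
  have hY₁r : ∀ s, (tmap (J1DualTot m N) (Base m) (π ∘ J1Dual.proj) (ΨS s)).comp (C₁ s) =
      ContinuousLinearMap.id ℝ (Base m) := by
    intro s
    have h1 := tmap_comp_of_comp_eq hj₀ hρD (fun q => rfl) (jP (FLS s))
    rw [hYj, hΨS, ← ContinuousLinearMap.comp_assoc, h1]
    exact hYX.1.right_inv (FLS s)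
  -- Applying `ΛᵐTμ` keeps the density, so `g` serves for the restricted objects as well.
  have hY₁_lmap : ∀ s u, lmap m (C₁ s) u = (evalForm (vol (pS s)) u * g s) • K₁ s := by
    intro s u
    have h1 : lmap m (C₁ s) u = lmap m (tMu vol L (jS s)) (lmap m (C s) u) := (lmap_lmap _ _ _).symm
    rw [h1, hY_lmap, map_smul]
    rfl
  have hMVsemi : ∀ s, IsSemiHolonomicMV (MPiTot m N) jS MPi.proj ΦS K s ↔
      IsSemiHolonomicJet (MPiTot m N) jS MPi.proj ΦS C s := by
    intro s
    refine isSemiHolonomicMV_iff (hvol_ne (pS s)) rfl ?_ (hg_ne s) (hY_lmap s)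
    have h1 := hY.1.right_inv s
    have h2 := tmap_comp (H := MPiTot m N) (H₂ := Tot m N) (H₃ := Base m) (g := π)
      (f := MPi.proj (m := m) (N := N) (π := π)) (ΦS s)
      ((SmoothFiberBundle.contMDiff (m := m) (N := N) (π := π)).mdifferentiable (by simp) _)
      ((contMDiff_MPi_proj (m := m) (N := N) (π := π)).mdifferentiable (by simp) _)
    rw [h2] at h1
    exact h1
  have hMVsemi₁ : ∀ s, IsSemiHolonomicMV (J1DualTot m N) jS J1Dual.proj ΨS K₁ s ↔
      IsSemiHolonomicJet (J1DualTot m N) jS J1Dual.proj ΨS C₁ s := fun s =>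
    (isSemiHolonomicMV_restrictMV K s).trans
      ((hMVsemi s).trans (isSemiHolonomicJet_restrictJet C s).symm)
  have hYX_smul : ∀ p u, ∃ c : ℝ, lmap m (CX p) u = c • X p := fun p u => ⟨_, hYX_lmap p u⟩
  have hOpK := hreg.isExtMVOperator_iff hvol hvol_ne hL hFLS hX hKs hK
  have hOpY := hreg.isExtJetOperator_iff hvol hvol_ne hL hFLS hX hYX_smul hY.1 hYh
  have hOpC := hreg.isExtConnOperator_iff hvol hvol_ne hL hFLS hX hYX_smul hC.1 hY.1.right_inv hYh
  have hext : IntegralCorrespondence (HS := HS) (HP := HP) jS FLS pS pP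
      (IsIntegralJet HS (MPiTot m N) pS ΦS C)
      (IsSemiHolonomicJet (MPiTot m N) jS MPi.proj ΦS C)
      (∀ s, IsSemiHolonomicJet (MPiTot m N) jS MPi.proj ΦS C s) (IsIntegralJet HP HQ pP jP CX) :=
    integralCorrespondence_jet hh_smooth (hreg.tmap_hMap_injective hvol hvol_ne hL) hFLS_smooth
      hFLS_surj hjP' (contMDiff_MPi_proj (m := m) (N := N) (π := π)) hΦS hYh (fun _ => rfl)
      (fun _ => rfl) hp
  have hres : IntegralCorrespondence (HS := HS) (HP := HP) jS FLS pS pP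
      (IsIntegralJet HS (J1DualTot m N) pS ΨS C₁)
      (IsSemiHolonomicJet (J1DualTot m N) jS J1Dual.proj ΨS C₁)
      (∀ s, IsSemiHolonomicJet (J1DualTot m N) jS J1Dual.proj ΨS C₁ s)
      (IsIntegralJet HP HQ pP jP CX) :=
    integralCorrespondence_jet hj₀ hreg.tmap_j₀_injective hFLS_smooth
      hFLS_surj hjP' (contMDiff_J1Dual_proj (m := m) (N := N) (π := π)) hΨS hYj (fun _ => rfl)
      (fun _ => rfl) hp
  have hXiff : ∀ (U : Set M) (ψ : M → P), IsOpen U →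
      (IsIntegralMV HP HQ vol pP jP X U ψ ↔ IsIntegralJet HP HQ pP jP CX U ψ) := fun U ψ hU =>
    isIntegralMV_iff hU hρ hjP' (fun _ => rfl) hYX.1.right_inv hgX hgX_ne hYX_lmap
  have hCXiff : ∀ (U : Set M) (ψ : M → P), IsOpen U →
      (IsIntegralConn HP HQ pP jP CX U ψ ↔ IsIntegralJet HP HQ pP jP CX U ψ) := fun U ψ hU =>
    isIntegralConn_iff hU hρ hjP' (fun _ => rfl) hYX.1.right_inv
  refine ⟨hres.congr (fun U φ hU => ?_) hMVsemi₁ (isRestrictedMVOperator_iff hOpK) hXiff,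
    hres.congr (fun _ _ _ => Iff.rfl) (fun _ => Iff.rfl) (isRestrictedJetOperator_iff hOpY)
      (fun _ _ _ => Iff.rfl),
    hres.congr (fun U φ hU => ?_) (fun _ => Iff.rfl) (isRestrictedConnOperator_iff hOpC) hCXiff,
    hext.congr (fun U φ hU => ?_) hMVsemi hOpK hXiff,
    hext.congr (fun _ _ _ => Iff.rfl) (fun _ => Iff.rfl) hOpY (fun _ _ _ => Iff.rfl),
    hext.congr (fun U φ hU => ?_) (fun _ => Iff.rfl) hOpC hCXiff⟩
  · exact isIntegralMV_iff hU hρD hΨS_smooth (fun _ => rfl) hY₁r hg hg_ne hY₁_lmap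
  · exact isIntegralConn_iff hU hρD hΨS_smooth (fun _ => rfl) hY₁r
  · exact isIntegralMV_iff hU hρM hΦS_smooth (fun _ => rfl) hY.1.right_inv hg hg_ne hY_lmap
  · exact isIntegralConn_iff hU hρM hΦS_smooth (fun _ => rfl) hY.1.right_inv
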